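/- Let $(V^+,Q^+)$ and $(V^-,Q^-)$ be finite-dimensional complex vector spaces with nondegenerate quadratic forms, of dimensions $a$ and $b$, and put $V=V^+\oplus V^-$ with the quadratic form $Q^+\oplus Q^-$. Let $\widetilde K=\mathrm{Spin}(V^+)\times\mathrm{Spin}(V^-)\cong \mathrm{Spin}(a,\mathbb C)\times \mathrm{Spin}(b,\mathbb C)$, acting on $V$ through $SO(V^+)\times SO(V^-)$, and let $\mathfrak s\subset\mathfrak{so}(V)$ be the space of skew endomorphisms of $V$ that map $V^+$ to $V^-$ and $V^-$ to $V^+$; $\widetilde K$ acts on $\mathfrak s$ by conjugation. For a nilpotent $e\in\mathfrak s$ with orbit $\mathcal O=\widetilde K\cdot e$ let $C_{\widetilde K}(e)$ be the centralizer of $e$ in $\widetilde K$, let $C_{\widetilde K}(e)^0$ be its identity component, and let $A_{\widetilde K}(\mathcal O)=C_{\widetilde K}(e)/C_{\widetilde K}(e)^0$ be the component group. The signed diagram of $e$ (or of $\mathcal O$) records the Jordan strings of $e$ in a Jordan basis of $V$ consisting of vectors of $V^+$ and of $V^-$ (these alternate along each string), each string having as its sign that of the summand containing its first vector. Write $[3^{\epsilon}2^{2k}1^{+,c}1^{-,d}]$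 for the diagram with one row of length $3$ starting with the sign $\epsilon$, with $2k$ rows of length $2$ ($k$ starting with each sign), with $c$ rows of length $1$ and sign $+$, and with $d$ rows of length $1$ and sign $-$; the exponents $c,d$ are omitted when they are $1$, and rows with multiplicity $0$ are omitted. When several orbits (labelled $I$, $II$) have the same diagram, each of the statements below holds for all of them. Let $k\ge 1$. Then: 1. If $\mathcal O=[3^+2^{2k}1^-]$ or $[3^-2^{2k}1^+]$, then $A_{\widetilde K}(\mathcal O)\cong\mathbb Z_2\times\mathbb Z_2$. 2. If $\mathcal O=[3^-2^{2k}1^{+,2r+1}]$ or $[3^+2^{2k}1^{-,2r+1}]$ with $r>0$, then $A_{\widetilde K}(\mathcal O)\cong\mathbb Z_2$. 3. If $\mathcal O=[3^+2^{2k}1^-1^{+,2r}]$ or $[3^-2^{2k}1^+1^{-,2r}]$ with $r>0$, then $A_{\widetilde K}(\mathcal O)\cong\mathbb Z_2$. 4. If $\mathcal O=[3^+2^{2k}1^+1^{-,2}]$ or $[3^-2^{2k}1^-1^{+,2}]$, then $A_{\widetilde K}(\mathcal O)\cong\mathbb Z_2$. 5. If $\mathcal O=[3^+2^{2k}1^+]$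 or $[3^-2^{2k}1^-]$, then $A_{\widetilde K}(\mathcal O)\cong\mathbb Z_2$. 6. If $\mathcal O=[3^+2^{2k}1^{+,2r+1}]$ or $[3^-2^{2k}1^{-,2r+1}]$ with $r>0$, then $A_{\widetilde K}(\mathcal O)=1$. 7. If $\mathcal O=[3^-2^{2k}1^-1^{+,2r}]$ or $[3^+2^{2k}1^+1^{-,2r}]$ with $r\ge 2$, then $A_{\widetilde K}(\mathcal O)\cong\mathbb Z_2$. -/

import Mathlib

noncomputable section

namespace SpinOrbit

open CliffordAlgebra

section SingleSpace

variable {V : Type*} [AddCommGroup V] [Module ℂ V]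

theorem ι_injective (Q : QuadraticForm ℂ V) : Function.Injective (ι Q) := by
  intro v w h
  have h2 := congrArg (equivExterior Q) h
  simp only [equivExterior, changeFormEquiv_apply, changeForm_ι] at h2
  exact (ExteriorAlgebra.ι_inj ℂ v w).1 h2

/-- The Clifford algebra of a complex quadratic space carries the finest topology that makes it a
topological complex vector space. In finite dimension this is the usual topology of a
finite-dimensional complex vector space. -/
instance instTopologicalSpaceClifford (Q : QuadraticForm ℂ V) :
    TopologicalSpace (CliffordAlgebra Q) := moduleTopology ℂ (CliffordAlgebra Q)

instance instIsModuleTopologyClifford (Q : QuadraticForm ℂ V) :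
    IsModuleTopology ℂ (CliffordAlgebra Q) := ⟨rfl⟩

instance instFiniteClifford [FiniteDimensional ℂ V] (Q : QuadraticForm ℂ V) :
    Module.Finite ℂ (CliffordAlgebra Q) :=
  have : Module.Finite ℂ (ExteriorAlgebra ℂ V) :=
    Module.Finite.of_basis (Module.finBasis ℂ V).ExteriorAlgebra
  Module.Finite.equiv (equivExterior Q).symm

instance instIsTopologicalRingClifford [FiniteDimensional ℂ V] (Q : QuadraticForm ℂ V) :
    IsTopologicalRing (CliffordAlgebra Q) :=
  IsModuleTopology.isTopologicalRing ℂ (CliffordAlgebra Q)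

theorem continuous_star_clifford (Q : QuadraticForm ℂ V) :
    Continuous (fun x : CliffordAlgebra Q => star x) := by
  have : ContinuousAdd (CliffordAlgebra Q) := IsModuleTopology.toContinuousAdd ℂ _
  exact IsModuleTopology.continuous_of_linearMap
    ((reverse (Q := Q)).comp (involute (Q := Q)).toLinearMap)

/-- `Spin(V)`, with the topology induced from the Clifford algebra, is a topological group. -/
instance instIsTopologicalGroupSpin [FiniteDimensional ℂ V] (Q : QuadraticForm ℂ V) :
    IsTopologicalGroup (spinGroup Q) where
  continuous_mul := by
    refine Continuous.subtype_mk ?_ _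
    exact (continuous_subtype_val.comp continuous_fst).mul
      (continuous_subtype_val.comp continuous_snd)
  continuous_inv := by
    refine Continuous.subtype_mk ?_ _
    exact (continuous_star_clifford Q).comp continuous_subtype_val

theorem spin_conj_mem_range (Q : QuadraticForm ℂ V) (x : spinGroup Q) (v : V) :
    (x : CliffordAlgebra Q) * ι Q v * star (x : CliffordAlgebra Q) ∈ LinearMap.range (ι Q) :=
  spinGroup.conjAct_smul_ι_mem_range_ι (x := spinGroup.toUnits x) x.2 v

/-- The action `ρ(x) v = x v x⋆` of `Spin(V)` on `V`, where `V` is viewed inside the Clifford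
algebra through `ι`; on `Spin(V)` one has `x⋆ = x⁻¹`. -/
def vectorRepLin (Q : QuadraticForm ℂ V) (x : spinGroup Q) : V →ₗ[ℂ] V :=
  (LinearEquiv.ofInjective (ι Q) (ι_injective Q)).symm.toLinearMap ∘ₗ
    (((LinearMap.mulRight ℂ (star (x : CliffordAlgebra Q))) ∘ₗ
      (LinearMap.mulLeft ℂ (x : CliffordAlgebra Q)) ∘ₗ ι Q).codRestrict
        (LinearMap.range (ι Q)) (spin_conj_mem_range Q x))

theorem ι_vectorRepLin (Q : QuadraticForm ℂ V) (x : spinGroup Q) (v : V) :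
    ι Q (vectorRepLin Q x v) =
      (x : CliffordAlgebra Q) * ι Q v * star (x : CliffordAlgebra Q) := by
  have h := LinearEquiv.apply_symm_apply (LinearEquiv.ofInjective (ι Q) (ι_injective Q))
    ⟨_, spin_conj_mem_range Q x v⟩
  exact congrArg Subtype.val h

/-- The vector representation `ρ` of `Spin(V)` (the covering map onto `SO(V)`). -/
def vectorRep (Q : QuadraticForm ℂ V) : spinGroup Q →* Module.End ℂ V where
  toFun := vectorRepLin Q
  map_one' := by
    ext v
    apply ι_injective Q
    simp [ι_vectorRepLin]
  map_mul' x y := by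
    ext v
    apply ι_injective Q
    simp [ι_vectorRepLin, mul_assoc]

end SingleSpace

section Pair

variable {Vp Vm : Type*} [AddCommGroup Vp] [Module ℂ Vp] [AddCommGroup Vm] [Module ℂ Vm]

/-- `K̃ = Spin(V⁺) × Spin(V⁻)`. -/
abbrev Ktilde (Qp : QuadraticForm ℂ Vp) (Qm : QuadraticForm ℂ Vm) : Type _ :=
  spinGroup Qp × spinGroup Qm

/-- The action of `K̃` on `V = V⁺ ⊕ V⁻` through `SO(V⁺) × SO(V⁻)`. -/
def ktildeRep (Qp : QuadraticForm ℂ Vp) (Qm : QuadraticForm ℂ Vm) :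
    Ktilde Qp Qm →* Module.End ℂ (Vp × Vm) where
  toFun g := (vectorRep Qp g.1).prodMap (vectorRep Qm g.2)
  map_one' := by
    ext v <;> simp
  map_mul' x y := by
    ext v <;> simp

/-- The summand `V⁺` (for sign `1`) or `V⁻` (for sign `-1`) of `V = V⁺ ⊕ V⁻`. -/
def signedPart (Vp Vm : Type*) [AddCommGroup Vp] [Module ℂ Vp] [AddCommGroup Vm] [Module ℂ Vm]
    (s : ℤˣ) : Submodule ℂ (Vp × Vm) :=
  if s = 1 then Submodule.prod ⊤ ⊥ else Submodule.prod ⊥ ⊤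

/-- The space `𝔰` of the Cartan decomposition `𝔰𝔬(V) = 𝔨 + 𝔰`: endomorphisms of `V = V⁺ ⊕ V⁻` that
are skew for the orthogonal sum of the two quadratic forms and that interchange `V⁺` and `V⁻`. -/
structure IsInS (Qp : QuadraticForm ℂ Vp) (Qm : QuadraticForm ℂ Vm)
    (e : Module.End ℂ (Vp × Vm)) : Prop where
  skew : (QuadraticMap.polarBilin (Qp.prod Qm)).IsSkewAdjoint e
  swap : ∀ s : ℤˣ, ∀ v ∈ signedPart Vp Vm s, e v ∈ signedPart Vp Vm (-s)

/-- A signed diagram: `D (s, ℓ)` is the number of rows of length `ℓ` that start with sign `s`.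
(Rows of length `0` play no role.) -/
abbrev SignedDiagram : Type := ℤˣ × ℕ → ℕ

/-- `e` has signed diagram `D`: there is a Jordan basis of `V` whose Jordan strings
`x₀ → x₁ → ⋯ → 0` correspond to the rows of `D`, where the vectors of the string alternate between
`V⁺` and `V⁻` as the signs of the row do. In particular `e` is nilpotent. -/
def HasSignedDiagram (e : Module.End ℂ (Vp × Vm)) (D : SignedDiagram) : Prop :=
  ∃ b : Module.Basis (Σ row : ℤˣ × ℕ, Fin (D row) × Fin row.2) ℂ (Vp × Vm),
    (∀ (row : ℤˣ × ℕ) (i : Fin (D row)) (j : Fin row.2),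
      b ⟨row, i, j⟩ ∈ signedPart Vp Vm (row.1 * (-1) ^ (j : ℕ))) ∧
    (∀ (row : ℤˣ × ℕ) (i : Fin (D row)) (j : Fin row.2), e (b ⟨row, i, j⟩) =
      if h : (j : ℕ) + 1 < row.2 then b ⟨row, i, ⟨(j : ℕ) + 1, h⟩⟩ else 0)

/-- The signed diagram `[3^s 2^{2k} 1^{+,c} 1^{-,d}]`: one row of length 3 starting with sign `s`,
`2k` rows of length 2 (`k` starting with each sign, as in every orthogonal signed diagram), `c`
rows of length 1 with sign `+` and `d` rows of length 1 with sign `-`. -/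
def diagram (s : ℤˣ) (k c d : ℕ) : SignedDiagram := fun row =>
  if row = (s, 3) then 1
  else if row.2 = 2 then k
  else if row = (1, 1) then c
  else if row = (-1, 1) then d
  else 0

/-- The centralizer `C_{K̃}(e)`. -/
def centralizer (Qp : QuadraticForm ℂ Vp) (Qm : QuadraticForm ℂ Vm)
    (e : Module.End ℂ (Vp × Vm)) : Subgroup (Ktilde Qp Qm) where
  carrier := {g | ktildeRep Qp Qm g * e = e * ktildeRep Qp Qm g}
  one_mem' := by simp
  mul_mem' {x y} hx hy := by
    simp only [Set.mem_ofPred_eq, map_mul] at hx hy ⊢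
    rw [mul_assoc, hy, ← mul_assoc, hx, mul_assoc]
  inv_mem' {x} hx := by
    simp only [Set.mem_ofPred_eq] at hx ⊢
    have h1 : ktildeRep Qp Qm x⁻¹ * ktildeRep Qp Qm x = 1 := by
      rw [← map_mul, inv_mul_cancel, map_one]
    have h2 : ktildeRep Qp Qm x * ktildeRep Qp Qm x⁻¹ = 1 := by
      rw [← map_mul, mul_inv_cancel, map_one]
    calc ktildeRep Qp Qm x⁻¹ * e
        = ktildeRep Qp Qm x⁻¹ * (e * ktildeRep Qp Qm x) * ktildeRep Qp Qm x⁻¹ := by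
          rw [mul_assoc, mul_assoc, h2, mul_one]
      _ = e * ktildeRep Qp Qm x⁻¹ := by
          rw [← hx, ← mul_assoc, h1, one_mul]

end Pair

instance instNormalIdentityComponent (G : Type*) [TopologicalSpace G] [Group G]
    [IsTopologicalGroup G] : (Subgroup.connectedComponentOfOne G).Normal where
  conj_mem n hn g := by
    have hc : Continuous fun x : G => g * x * g⁻¹ := by fun_prop
    have h := hc.image_connectedComponent_subset 1 ⟨n, hn, rfl⟩
    rw [mul_one, mul_inv_cancel] at h
    exact h

/-- The component group `G / G⁰` of a topological group. -/
abbrev ComponentGroup (G : Type*) [TopologicalSpace G] [Group G] [IsTopologicalGroup G] : Type _ :=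
  G ⧸ Subgroup.connectedComponentOfOne G

/-- The component group `A_{K̃}(𝒪) = C_{K̃}(e) / C_{K̃}(e)⁰` of the orbit `𝒪 = K̃ · e`. -/
abbrev A {Vp Vm : Type*} [AddCommGroup Vp] [Module ℂ Vp] [FiniteDimensional ℂ Vp]
    [AddCommGroup Vm] [Module ℂ Vm] [FiniteDimensional ℂ Vm]
    (Qp : QuadraticForm ℂ Vp) (Qm : QuadraticForm ℂ Vm) (e : Module.End ℂ (Vp × Vm)) : Type _ :=
  ComponentGroup (centralizer Qp Qm e)

/-- The cyclic group of order 2, written multiplicatively. -/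
abbrev Z2 : Type := Multiplicative (ZMod 2)

end SpinOrbit

end

/-! Let U₁ be the summand in which the row of length three starts and U₂ the other one. Then e
amounts to its two blocks α : U₁ → U₂ and β : U₂ → U₁; let c and d be the numbers of rows of length
one in U₁ and in U₂. The pairs of isometries commuting with α and β have reductive part {±1} × GL_k
× O_c × O_d: a sign ε on the string of length three, GL_k on the strings of length two, σ in O_c and
τ in O_d. The determinants are det σ on U₁ and ε det τ on U₂, so in SO × SO one has det σ = 1 and
det τ = ε. There ε is the only invariant of a component, and ε = -1 occurs exactly when d > 0.

Passing to Spin × Spin adds the kernel {±1}². As k > 0, a torus of GL_k joins (-1, -1) to the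
identity, so only the class of (-1, 1) is in doubt. If c ≥ 2 or d ≥ 2, a torus of SO_c or SO_d joins
it to the identity as well. For (c, d) = (1, 0) or (0, 1) it stays outside the identity component:
the centralizer preserves maximal isotropic subspaces of U₁ and of U₂, a spin element multiplies the
Clifford product of a basis of such a subspace by a square root of its determinant there
(`sq_eq_det`), and the two determinants are inverse to each other. The product of the two roots is
therefore a character with values ±1, and it is -1 at (-1, 1) (`exists_spinor_character`). This
gives Z₂ × Z₂ for (0, 1), Z₂ for (1, 0), the trivial group for d = 0 and c ≥ 2, and Z₂ for d > 0
with c ≥ 2 or d ≥ 2.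

No Levi decomposition is needed. The Cayley transform joins every commuting pair without eigenvalue
-1 to the identity (`mem_neutralImage_of_eigenvalue`), and every commuting pair loses that
eigenvalue after sign changes of the vectors of an adapted frame (`exists_signPair_mul_mem`).
Families of isometries are lifted to Spin by `exists_local_lift`, and `vectorRep_ne_reflection`
replaces the determinant. -/

noncomputable section

namespace SpinOrbit

open CliffordAlgebra

/-! ### Contractions and scalars in the Clifford algebra -/

section CliffordBasics

variable {V : Type*} [AddCommGroup V] [Module ℂ V]

/-- Left multiplication by a vector, minus right multiplication twisted by the grading involution,
is contraction with the polar form. -/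
theorem ι_mul_sub_involute_mul_ι (Q : QuadraticForm ℂ V) (v : V) (u : CliffordAlgebra Q) :
    ι Q v * u - involute u * ι Q v = contractLeft (QuadraticMap.polarBilin Q v) u := by
  induction u using CliffordAlgebra.left_induction with
  | algebraMap r => simp [Algebra.commutes]
  | add x y hx hy => rw [map_add, map_add, ← hx, ← hy]; noncomm_ring
  | ι_mul x w hx =>
    rw [contractLeft_ι_mul, ← hx, map_mul, involute_ι, QuadraticMap.polarBilin_apply_apply,
      Algebra.smul_def, ← ι_mul_ι_add_swap]
    noncomm_ring

/-- This is the Euler operator of the exterior algebra, which counts the degree. Contraction is an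
antiderivation, so moving the operator past one more factor `v` produces exactly one extra copy of
`v * x`. -/
theorem contractLeft_euler_of_mem [FiniteDimensional ℂ V] {n : ℕ} {u : ExteriorAlgebra ℂ V}
    (hu : u ∈ ⋀[ℂ]^n V) :
    ∑ i, ExteriorAlgebra.ι ℂ (Module.finBasis ℂ V i) *
      contractLeft (Q := (0 : QuadraticForm ℂ V)) ((Module.finBasis ℂ V).coord i) u
      = (n : ℂ) • u := by
  induction hu using Submodule.pow_induction_on_left' with
  | algebraMap r =>
    simp only [Nat.cast_zero, zero_smul]
    refine Finset.sum_eq_zero fun i _ => ?_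
    rw [show (algebraMap ℂ (ExteriorAlgebra ℂ V)) r
      = algebraMap ℂ (CliffordAlgebra (0 : QuadraticForm ℂ V)) r from rfl,
      contractLeft_algebraMap, mul_zero]
  | add x y i hx hy ihx ihy =>
    simp only [map_add, mul_add, Finset.sum_add_distrib, ihx, ihy, smul_add]
  | mem_mul m hm i x hx ih =>
    obtain ⟨v, rfl⟩ := hm
    have hv : ∑ i, (Module.finBasis ℂ V).coord i v • ExteriorAlgebra.ι ℂ (Module.finBasis ℂ V i)
        = ExteriorAlgebra.ι ℂ v := by
      simp_rw [← map_smul, ← map_sum]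
      congr 1
      exact (Module.finBasis ℂ V).sum_repr v
    have key : ∀ i, ExteriorAlgebra.ι ℂ (Module.finBasis ℂ V i) *
        contractLeft (Q := (0 : QuadraticForm ℂ V)) ((Module.finBasis ℂ V).coord i)
          (ExteriorAlgebra.ι ℂ v * x) =
        ((Module.finBasis ℂ V).coord i v • ExteriorAlgebra.ι ℂ (Module.finBasis ℂ V i)) * x +
        ExteriorAlgebra.ι ℂ v * (ExteriorAlgebra.ι ℂ (Module.finBasis ℂ V i) *
        contractLeft (Q := (0 : QuadraticForm ℂ V)) ((Module.finBasis ℂ V).coord i) x) := by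
      intro i
      have h1 : contractLeft (Q := (0 : QuadraticForm ℂ V)) ((Module.finBasis ℂ V).coord i)
          (ExteriorAlgebra.ι ℂ v * x) = (Module.finBasis ℂ V).coord i v • x -
          ExteriorAlgebra.ι ℂ v *
            contractLeft (Q := (0 : QuadraticForm ℂ V)) ((Module.finBasis ℂ V).coord i) x :=
        contractLeft_ι_mul _ _ _
      have h2 : ExteriorAlgebra.ι ℂ (Module.finBasis ℂ V i) * ExteriorAlgebra.ι ℂ v
          = - (ExteriorAlgebra.ι ℂ v * ExteriorAlgebra.ι ℂ (Module.finBasis ℂ V i)) :=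
        eq_neg_of_add_eq_zero_left (ExteriorAlgebra.ι_add_mul_swap _ _)
      rw [h1, mul_sub, ← mul_assoc, h2, mul_smul_comm, smul_mul_assoc]
      noncomm_ring
    simp_rw [key, Finset.sum_add_distrib, ← Finset.mul_sum, ← Finset.sum_mul]
    rw [hv, ih, mul_smul_comm]
    push_cast
    rw [add_smul, one_smul, add_comm]

/-- The Euler operator kills `u` but multiplies its component of degree `n` by `n`, so in
characteristic zero only degree zero survives. -/
theorem exterior_scalar_of_contractLeft_eq_zero [FiniteDimensional ℂ V] (u : ExteriorAlgebra ℂ V)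
    (h : ∀ d, contractLeft (Q := (0 : QuadraticForm ℂ V)) d u = 0) :
    ∃ r : ℂ, u = algebraMap ℂ _ r := by
  classical
  have hN : ∀ (u : ExteriorAlgebra ℂ V) (n : ℕ),
      ((DirectSum.decompose (fun i : ℕ => ⋀[ℂ]^i V)
        (∑ i, ExteriorAlgebra.ι ℂ (Module.finBasis ℂ V i) *
          contractLeft (Q := (0 : QuadraticForm ℂ V)) ((Module.finBasis ℂ V).coord i) u) n :
          ⋀[ℂ]^n V) : ExteriorAlgebra ℂ V)
      = (n : ℂ) • (DirectSum.decompose (fun i : ℕ => ⋀[ℂ]^i V) u n : ExteriorAlgebra ℂ V) := by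
    intro u n
    induction u using DirectSum.Decomposition.inductionOn (fun i : ℕ => ⋀[ℂ]^i V) with
    | zero => simp
    | homogeneous m =>
      rename_i j
      rw [contractLeft_euler_of_mem m.2, DirectSum.decompose_smul, DirectSum.decompose_coe]
      by_cases hj : j = n
      · subst hj; simp [DirectSum.smul_apply]
      · simp [DirectSum.smul_apply, DirectSum.of_eq_of_ne _ _ _ (Ne.symm hj)]
    | add x y hx hy =>
      simp only [map_add, mul_add, Finset.sum_add_distrib, DirectSum.decompose_add,
        DirectSum.add_apply, Submodule.coe_add, hx, hy, smul_add]
  have h0 : ∀ n : ℕ, n ≠ 0 →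
      (DirectSum.decompose (fun i : ℕ => ⋀[ℂ]^i V) u n : ExteriorAlgebra ℂ V) = 0 := by
    intro n hn
    have := hN u n
    simp only [h, mul_zero, Finset.sum_const_zero, DirectSum.decompose_zero, DirectSum.zero_apply,
      ZeroMemClass.coe_zero] at this
    exact (smul_eq_zero.1 this.symm).resolve_left (by exact_mod_cast hn)
  have hu : u = (DirectSum.decompose (fun i : ℕ => ⋀[ℂ]^i V) u 0 : ExteriorAlgebra ℂ V) := by
    conv_lhs => rw [← DirectSum.sum_support_decompose (fun i : ℕ => ⋀[ℂ]^i V) u]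
    by_cases hs : 0 ∈ (DirectSum.decompose (fun i : ℕ => ⋀[ℂ]^i V) u).support
    · exact Finset.sum_eq_single_of_mem 0 hs fun n _ hn => h0 n hn
    · rw [DFinsupp.notMem_support_iff] at hs
      rw [Finset.sum_eq_zero, hs]
      · rfl
      · intro n hn
        refine h0 n ?_
        rintro rfl
        exact (DFinsupp.mem_support_iff.1 hn) hs
  have hm := (DirectSum.decompose (fun i : ℕ => ⋀[ℂ]^i V) u 0).2
  rw [← hu] at hm
  change u ∈ (LinearMap.range (ExteriorAlgebra.ι ℂ)) ^ 0 at hm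
  rw [pow_zero] at hm
  obtain ⟨r, hr⟩ := Submodule.mem_one.1 hm
  exact ⟨r, hr.symm⟩

theorem polarBilin_surjective [FiniteDimensional ℂ V] {Q : QuadraticForm ℂ V}
    (hQ : (QuadraticMap.polarBilin Q).Nondegenerate) (d : Module.Dual ℂ V) :
    ∃ v, QuadraticMap.polarBilin Q v = d :=
  ⟨(LinearMap.BilinForm.toDual _ hQ).symm d, by
    ext w
    exact LinearMap.BilinForm.apply_toDual_symm_apply (hB := hQ) d w⟩

/-- An element of the Clifford algebra that is killed by all contractions is a scalar. -/
theorem scalar_of_contractLeft_eq_zero [FiniteDimensional ℂ V] {Q : QuadraticForm ℂ V}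
    (hQ : (QuadraticMap.polarBilin Q).Nondegenerate) {u : CliffordAlgebra Q}
    (hu : ∀ v, contractLeft (QuadraticMap.polarBilin Q v) u = 0) :
    ∃ r : ℂ, u = algebraMap ℂ _ r := by
  obtain ⟨r, hr⟩ := exterior_scalar_of_contractLeft_eq_zero (equivExterior Q u) (by
    intro d
    obtain ⟨v, rfl⟩ := polarBilin_surjective hQ d
    have h2 := changeForm_contractLeft changeForm.associated_neg_proof
      (QuadraticMap.polarBilin Q v) u
    rw [hu, map_zero] at h2
    exact h2.symm)
  refine ⟨r, (equivExterior Q).injective ?_⟩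
  rw [hr]
  exact (changeForm_algebraMap changeForm.associated_neg_proof r).symm

/-- An even element of the Clifford algebra that commutes with all vectors is a scalar. -/
theorem scalar_of_even_of_commute [FiniteDimensional ℂ V] {Q : QuadraticForm ℂ V}
    (hQ : (QuadraticMap.polarBilin Q).Nondegenerate) {u : CliffordAlgebra Q}
    (hu : involute u = u) (hc : ∀ v, ι Q v * u = u * ι Q v) : ∃ r : ℂ, u = algebraMap ℂ _ r :=
  scalar_of_contractLeft_eq_zero hQ fun v => by
    rw [← ι_mul_sub_involute_mul_ι, hu, hc, sub_self]

end CliffordBasics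

/-! ### The spin group and its vector representation -/

section SpinBasics

variable {V : Type*} [AddCommGroup V] [Module ℂ V] {Q : QuadraticForm ℂ V}

/-- Each factor is invertible and so lies in the Lipschitz group. `star` negates vectors, and the
two signs cancel, so unitarity only involves the product of the two norms; neither has to be 1. All
explicit spin elements below are of this kind. -/
theorem ι_mul_ι_mem_spinGroup {u v : V} (h : Q u * Q v = 1) : ι Q u * ι Q v ∈ spinGroup Q := by
  have hunit : ∀ w : V, Q w ≠ 0 →
      ∃ y : (CliffordAlgebra Q)ˣ, (y : CliffordAlgebra Q) = ι Q w ∧ y ∈ lipschitzGroup Q := by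
    intro w hw
    refine ⟨⟨ι Q w, (Q w)⁻¹ • ι Q w, ?_, ?_⟩, rfl, Subgroup.subset_closure ⟨w, rfl⟩⟩
    · rw [mul_smul_comm, ι_sq_scalar, Algebra.algebraMap_eq_smul_one, smul_smul,
        inv_mul_cancel₀ hw, one_smul]
    · rw [smul_mul_assoc, ι_sq_scalar, Algebra.algebraMap_eq_smul_one, smul_smul,
        inv_mul_cancel₀ hw, one_smul]
  have hu : Q u ≠ 0 := left_ne_zero_of_mul_eq_one h
  have hv : Q v ≠ 0 := right_ne_zero_of_mul_eq_one h
  obtain ⟨a, ha, ha'⟩ := hunit u hu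
  obtain ⟨b, hb, hb'⟩ := hunit v hv
  have hcomm : algebraMap ℂ (CliffordAlgebra Q) (Q u) * algebraMap ℂ _ (Q v) = 1 := by
    rw [← map_mul, h, map_one]
  refine ⟨⟨⟨a * b, mul_mem ha' hb', by simp [ha, hb]⟩, ?_⟩, ι_mul_ι_mem_evenOdd_zero Q u v⟩
  refine Unitary.mem_iff.2 ⟨?_, ?_⟩
  · rw [star_mul, star_ι, star_ι, neg_mul_neg, mul_assoc, ← mul_assoc (ι Q u), ι_sq_scalar,
      ← mul_assoc, ← Algebra.commutes, mul_assoc, ι_sq_scalar, hcomm]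
  · rw [star_mul, star_ι, star_ι, neg_mul_neg, mul_assoc, ← mul_assoc (ι Q v), ι_sq_scalar,
      ← mul_assoc, ← Algebra.commutes, mul_assoc, ι_sq_scalar, ← Algebra.commutes, hcomm]

theorem ι_vectorRep (x : spinGroup Q) (v : V) :
    ι Q (vectorRep Q x v) = (x : CliffordAlgebra Q) * ι Q v * star (x : CliffordAlgebra Q) :=
  ι_vectorRepLin Q x v

theorem ι_vectorRep_mul (x : spinGroup Q) (v : V) :
    ι Q (vectorRep Q x v) * x = x * ι Q v := by
  rw [ι_vectorRep, mul_assoc, spinGroup.star_mul_self_of_mem x.2, mul_one]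

theorem vectorRep_eq_of_mul {x : spinGroup Q} {v w : V}
    (h : ι Q w * x = x * ι Q v) : vectorRep Q x v = w := by
  apply ι_injective Q
  rw [ι_vectorRep, ← h, mul_assoc, spinGroup.mul_star_self_of_mem x.2, mul_one]

theorem algebraMap_clifford_injective (Q : QuadraticForm ℂ V) :
    Function.Injective (algebraMap ℂ (CliffordAlgebra Q)) := by
  intro a b h
  have h2 := congrArg (equivExterior Q) h
  simp only [equivExterior, changeFormEquiv_apply, changeForm_algebraMap] at h2
  exact (ExteriorAlgebra.algebraMap_inj V a b).1 h2

instance instNontrivialClifford (Q : QuadraticForm ℂ V) : Nontrivial (CliffordAlgebra Q) :=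
  (algebraMap_clifford_injective Q).nontrivial

theorem vectorRep_isometry (x : spinGroup Q) (v : V) : Q (vectorRep Q x v) = Q v := by
  apply algebraMap_clifford_injective Q
  have h : star (x : CliffordAlgebra Q) * x = 1 := spinGroup.star_mul_self_of_mem x.2
  rw [← ι_sq_scalar, ι_vectorRep]
  calc _ = (x : CliffordAlgebra Q) * ι Q v * (star (x : CliffordAlgebra Q) * x) * ι Q v
        * star (x : CliffordAlgebra Q) := by noncomm_ring
    _ = (x : CliffordAlgebra Q) * (ι Q v * ι Q v) * star (x : CliffordAlgebra Q) := by
        rw [h]; noncomm_ring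
    _ = _ := by
        rw [ι_sq_scalar, ← Algebra.commutes, mul_assoc, spinGroup.mul_star_self_of_mem x.2, mul_one]

theorem star_eq_reverse_of_mem_spinGroup {x : CliffordAlgebra Q} (hx : x ∈ spinGroup Q) :
    star x = reverse x := by
  rw [star_def, spinGroup.involute_eq hx]

/-- Such an element is even and commutes with all vectors, hence is a scalar `r`; on it `star` is
`reverse`, which fixes scalars, so unitarity reads `r * r = 1`. -/
theorem vectorRep_eq_one [FiniteDimensional ℂ V]
    (hQ : (QuadraticMap.polarBilin Q).Nondegenerate) {x : spinGroup Q}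
    (hx : vectorRep Q x = 1) : (x : CliffordAlgebra Q) = 1 ∨ (x : CliffordAlgebra Q) = -1 := by
  obtain ⟨r, hr⟩ := scalar_of_even_of_commute hQ (spinGroup.involute_eq x.2) (fun v => by
    rw [← ι_vectorRep_mul, hx]; rfl)
  have h : star (x : CliffordAlgebra Q) * x = 1 := spinGroup.star_mul_self_of_mem x.2
  rw [star_eq_reverse_of_mem_spinGroup x.2, hr, reverse.commutes, ← map_mul, ← map_one
    (algebraMap ℂ (CliffordAlgebra Q))] at h
  have h2 := algebraMap_clifford_injective Q h
  rcases mul_self_eq_one_iff.1 h2 with h3 | h3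
  · left; rw [hr, h3, map_one]
  · right; rw [hr, h3, map_neg, map_one]

/-- No element of the spin group acts as a reflection. -/
theorem vectorRep_ne_reflection {x : spinGroup Q} {f : V} (hf : Q f ≠ 0)
    (h1 : vectorRep Q x f = -f)
    (h2 : ∀ v, QuadraticMap.polar Q f v = 0 → vectorRep Q x v = v) : False := by
  -- If `x` acted as the reflection in `f`, then `u` would be odd and anticommute with all vectors,
  -- so `u * w = involute w * u` for every `w`. Taking `w = u` gives `u * u = -(u * u)`, which is
  -- impossible because `u` is invertible.
  set u : CliffordAlgebra Q := ι Q f * x with hu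
  have hodd : involute u = -u := by
    rw [hu, map_mul, involute_ι, spinGroup.involute_eq x.2, neg_mul]
  have hanti : ∀ v, u * ι Q v = -(ι Q v) * u := by
    have ha : u * ι Q f = -(ι Q f) * u := by
      rw [hu, mul_assoc, ← ι_vectorRep_mul, h1, map_neg]; noncomm_ring
    intro v
    set t := QuadraticMap.polar Q f v / QuadraticMap.polar Q f f
    have hff : QuadraticMap.polar Q f f ≠ 0 := by
      rw [QuadraticMap.polar_self]; simpa using hf
    have hw : QuadraticMap.polar Q f (v - t • f) = 0 := by
      rw [QuadraticMap.polar_sub_right, QuadraticMap.polar_smul_right, smul_eq_mul,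
        div_mul_cancel₀ _ hff, sub_self]
    have hb : u * ι Q (v - t • f) = -(ι Q (v - t • f)) * u := by
      have hc : ι Q f * ι Q (v - t • f) = - (ι Q (v - t • f) * ι Q f) := by
        rw [eq_neg_iff_add_eq_zero, ι_mul_ι_add_swap, hw, map_zero]
      rw [hu, mul_assoc, ← ι_vectorRep_mul, h2 _ hw, ← mul_assoc, hc]; noncomm_ring
    have hv : v = (v - t • f) + t • f := by abel
    rw [hv, map_add, mul_add, hb, map_smul, mul_smul_comm, ha]
    simp only [neg_add, add_mul, neg_mul, smul_mul_assoc, smul_neg]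
  have hall : ∀ w : CliffordAlgebra Q, u * w = involute w * u := by
    intro w
    induction w using CliffordAlgebra.induction with
    | algebraMap r => rw [AlgHom.commutes, Algebra.commutes]
    | ι v => rw [hanti, involute_ι]
    | mul a b ha hb => rw [← mul_assoc, ha, mul_assoc, hb, map_mul, mul_assoc]
    | add a b ha hb => rw [mul_add, ha, hb, map_add, add_mul]
  have h0 : u * u = 0 := by
    have h3 := hall u
    rw [hodd, neg_mul] at h3
    have h4 : (2 : ℂ) • (u * u) = 0 := by rw [two_smul]; nth_rewrite 1 [h3]; exact neg_add_cancel _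
    exact (smul_eq_zero.1 h4).resolve_left two_ne_zero
  have h5 : ι Q f * u = algebraMap ℂ _ (Q f) * x := by rw [hu, ← mul_assoc, ι_sq_scalar]
  have h6 : star (x : CliffordAlgebra Q) * (ι Q f * u) = algebraMap ℂ _ (Q f) := by
    rw [h5, ← mul_assoc, ← Algebra.commutes, mul_assoc, spinGroup.star_mul_self_of_mem x.2, mul_one]
  have h7 : algebraMap ℂ (CliffordAlgebra Q) (Q f) * u = 0 := by
    rw [← h6, mul_assoc, mul_assoc, h0, mul_zero, mul_zero]
  have h8 : u = 0 := by
    rw [← Algebra.smul_def] at h7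
    exact (smul_eq_zero.1 h7).resolve_left hf
  rw [h8, mul_zero, mul_zero] at h6
  exact hf (algebraMap_clifford_injective Q (h6.symm.trans (map_zero _).symm))

end SpinBasics

/-! ### The torus of a hyperbolic pair -/

section HyperbolicTorus

variable {V : Type*} [AddCommGroup V] [Module ℂ V] {Q : QuadraticForm ℂ V}

/-- Exhibits the torus element as a product of two vectors, both of norm 1 once `x` and `y` pair to
1; this is how it is seen to lie in the spin group. -/
theorem hyperbolic_torus_eq (Q : QuadraticForm ℂ V) {x y : V} (hx : Q x = 0) (hy : Q y = 0)
    (z : ℂˣ) :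
    ι Q (x + y) * ι Q ((z⁻¹ : ℂˣ) • x + z • y) =
      (z : ℂ) • (ι Q x * ι Q y) + ((z⁻¹ : ℂˣ) : ℂ) • (ι Q y * ι Q x) := by
  simp only [Units.smul_def, map_add, map_smul, mul_add, add_mul, mul_smul_comm, ι_sq_scalar, hx,
    hy, map_zero, zero_add, add_zero]
  abel

/-- The one-parameter torus in the spin group attached to a hyperbolic pair. -/
def hyperbolicTorus (Q : QuadraticForm ℂ V) {x y : V} (hx : Q x = 0) (hy : Q y = 0)
    (hxy : QuadraticMap.polar Q x y = 1) (z : ℂˣ) : spinGroup Q :=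
  ⟨(z : ℂ) • (ι Q x * ι Q y) + ((z⁻¹ : ℂˣ) : ℂ) • (ι Q y * ι Q x), by
    rw [← hyperbolic_torus_eq Q hx hy z]
    have hQ : ∀ s t : ℂ, Q (s • x + t • y) = s * t := by
      intro s t
      rw [QuadraticMap.map_add Q, QuadraticMap.map_smul, QuadraticMap.map_smul, hx, hy,
        QuadraticMap.polar_smul_left, QuadraticMap.polar_smul_right, hxy]
      simp
    apply ι_mul_ι_mem_spinGroup
    have h1 := hQ 1 1
    have h2 := hQ ((z⁻¹ : ℂˣ) : ℂ) z
    rw [one_smul, one_smul] at h1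
    rw [Units.smul_def, Units.smul_def, h1, h2]
    simp⟩

variable {x y : V} (hx : Q x = 0) (hy : Q y = 0) (hxy : QuadraticMap.polar Q x y = 1)

theorem coe_hyperbolicTorus (z : ℂˣ) : (hyperbolicTorus Q hx hy hxy z : CliffordAlgebra Q) =
    (z : ℂ) • (ι Q x * ι Q y) + ((z⁻¹ : ℂˣ) : ℂ) • (ι Q y * ι Q x) := rfl

theorem continuous_hyperbolicTorus : Continuous (hyperbolicTorus Q hx hy hxy) := by
  have : ContinuousAdd (CliffordAlgebra Q) := IsModuleTopology.toContinuousAdd ℂ _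
  have : ContinuousSMul ℂ (CliffordAlgebra Q) := IsModuleTopology.toContinuousSMul ℂ _
  have hinv : Continuous fun z : ℂˣ => ((z⁻¹ : ℂˣ) : ℂ) :=
    Units.continuous_coe_inv
  have h : Continuous fun z : ℂˣ =>
      (z : ℂ) • (ι Q x * ι Q y) + ((z⁻¹ : ℂˣ) : ℂ) • (ι Q y * ι Q x) :=
    by fun_prop
  exact h.subtype_mk _

include hxy in
theorem ι_mul_add_ι_mul : ι Q x * ι Q y + ι Q y * ι Q x = 1 := by
  rw [ι_mul_ι_add_swap, hxy, map_one]

theorem hyperbolicTorus_one : hyperbolicTorus Q hx hy hxy 1 = 1 := by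
  apply Subtype.ext
  rw [coe_hyperbolicTorus]
  simpa using ι_mul_add_ι_mul hxy

theorem coe_hyperbolicTorus_neg_one :
    (hyperbolicTorus Q hx hy hxy (-1) : CliffordAlgebra Q) = -1 := by
  rw [coe_hyperbolicTorus, ← ι_mul_add_ι_mul hxy]
  simp [add_comm]

/-- The torus scales `x` by `z²` and `y` by `z⁻²` and fixes their orthogonal complement. So `z = -1`
acts trivially although it is the element -1 of the spin group, and `z = i` acts as -1 on the
hyperbolic plane. -/
theorem vectorRep_hyperbolicTorus (z : ℂˣ) (v : V) :
    vectorRep Q (hyperbolicTorus Q hx hy hxy z) v =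
      v + (((z : ℂ) ^ 2 - 1) * QuadraticMap.polar Q v y) • x
        + ((((z⁻¹ : ℂˣ) : ℂ) ^ 2 - 1) * QuadraticMap.polar Q v x) • y := by
  apply vectorRep_eq_of_mul
  rw [coe_hyperbolicTorus]
  have hz : (z : ℂ) * ((z⁻¹ : ℂˣ) : ℂ) = 1 := by simp
  set a : ℂ := (z : ℂ)
  set b : ℂ := ((z⁻¹ : ℂˣ) : ℂ)
  set p := QuadraticMap.polar Q v y with hp
  set q := QuadraticMap.polar Q v x with hq
  have exx : ι Q x * ι Q x = 0 := by rw [ι_sq_scalar, hx, map_zero]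
  have eyy : ι Q y * ι Q y = 0 := by rw [ι_sq_scalar, hy, map_zero]
  have eyx : ι Q y * ι Q x = 1 - ι Q x * ι Q y := by rw [← ι_mul_add_ι_mul hxy]; abel
  have exv : ι Q x * ι Q v = algebraMap ℂ _ q - ι Q v * ι Q x := by
    rw [hq, ← ι_mul_ι_add_swap]; abel
  have eyv : ι Q y * ι Q v = algebraMap ℂ _ p - ι Q v * ι Q y := by
    rw [hp, ← ι_mul_ι_add_swap]; abel
  have exyx : ι Q x * (ι Q y * ι Q x) = ι Q x := by
    rw [eyx, mul_sub, mul_one, ← mul_assoc, exx, zero_mul, sub_zero]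
  have eyxy : ι Q y * (ι Q x * ι Q y) = ι Q y := by
    rw [← mul_assoc, eyx, sub_mul, one_mul, mul_assoc, eyy, mul_zero, sub_zero]
  have exxy : ι Q x * (ι Q x * ι Q y) = 0 := by rw [← mul_assoc, exx, zero_mul]
  have eyyx : ι Q y * (ι Q y * ι Q x) = 0 := by rw [← mul_assoc, eyy, zero_mul]
  have exyv : ι Q x * ι Q y * ι Q v = p • ι Q x - q • ι Q y + ι Q v * (ι Q x * ι Q y) := by
    rw [mul_assoc, eyv, mul_sub, ← mul_assoc, exv, sub_mul, Algebra.algebraMap_eq_smul_one,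
      Algebra.algebraMap_eq_smul_one, mul_smul_comm, mul_one, smul_mul_assoc, one_mul]
    noncomm_ring
  have eyxv : ι Q y * ι Q x * ι Q v = q • ι Q y - p • ι Q x + ι Q v * (ι Q y * ι Q x) := by
    rw [mul_assoc, exv, mul_sub, ← mul_assoc, eyv, sub_mul, Algebra.algebraMap_eq_smul_one,
      Algebra.algebraMap_eq_smul_one, mul_smul_comm, mul_one, smul_mul_assoc, one_mul]
    noncomm_ring
  simp only [map_add, map_smul, add_mul, mul_add, smul_mul_assoc, mul_smul_comm, exyv, eyxv,
    exyx, eyxy, exxy, eyyx, smul_zero, add_zero, smul_add, smul_sub, smul_smul]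
  have h1 : (a ^ 2 - 1) * p * b = a * p - b * p := by linear_combination a * p * hz
  have h2 : (b ^ 2 - 1) * q * a = b * q - a * q := by linear_combination b * q * hz
  have h1' : b * ((a ^ 2 - 1) * p) = a * p - b * p := by linear_combination a * p * hz
  have h2' : a * ((b ^ 2 - 1) * q) = b * q - a * q := by linear_combination b * q * hz
  simp only [h1', h2', sub_smul]
  abel

end HyperbolicTorus

/-! ### Completing families to orthonormal vectors and frames -/

section Frames

variable {V : Type*} [AddCommGroup V] [Module ℂ V] {Q : QuadraticForm ℂ V}

theorem polar_eq_zero_of_forall_isotropic {W : Submodule ℂ V} (h : ∀ w ∈ W, Q w = 0) {u v : V}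
    (hu : u ∈ W) (hv : v ∈ W) : QuadraticMap.polar Q u v = 0 := by
  rw [QuadraticMap.polar, h _ (W.add_mem hu hv), h _ hu, h _ hv]; simp

/-- A family with a dual family with respect to the polar form is linearly independent. -/
theorem linearIndependent_of_dual {I : Type*} [Fintype I] [DecidableEq I] {v v' : I → V}
    (h : ∀ i j, QuadraticMap.polar Q (v i) (v' j) = if i = j then 1 else 0) :
    LinearIndependent ℂ v := by
  rw [Fintype.linearIndependent_iff]
  intro g hg j
  have h1 : QuadraticMap.polarBilin Q (∑ i, g i • v i) (v' j) = g j := by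
    simp [map_sum, h]
  rw [← h1, hg]; simp

/-- A family whose dual family is a permutation of it up to scalars, and which does not exhaust the
space, can be extended by a vector of norm one that is orthogonal to it. -/
theorem exists_orthogonal_unit [FiniteDimensional ℂ V]
    (hQ : (QuadraticMap.polarBilin Q).Nondegenerate) {I : Type*} [Fintype I] [DecidableEq I]
    {v v' : I → V} (h : ∀ i j, QuadraticMap.polar Q (v i) (v' j) = if i = j then 1 else 0)
    (hv' : ∀ w, (∀ i, QuadraticMap.polar Q (v i) w = 0) → ∀ i, QuadraticMap.polar Q (v' i) w = 0)
    (hcard : Fintype.card I < Module.finrank ℂ V) :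
    ∃ f, Q f = 1 ∧ ∀ i, QuadraticMap.polar Q (v i) f = 0 := by
  by_contra hcon
  push Not at hcon
  set N : Submodule ℂ V := ⨅ i, LinearMap.ker (QuadraticMap.polarBilin Q (v i)) with hN
  have hmem : ∀ w, w ∈ N ↔ ∀ i, QuadraticMap.polar Q (v i) w = 0 := by
    intro w; simp [hN, Submodule.mem_iInf]
  -- A vector of `N` with nonzero norm could be rescaled to norm 1 by a complex square root, against
  -- `hcon`.
  have hiso : ∀ w ∈ N, Q w = 0 := by
    intro w hw
    by_contra hne
    obtain ⟨s, hs⟩ := IsAlgClosed.exists_pow_nat_eq ((Q w)⁻¹) (n := 2) two_pos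
    obtain ⟨i, hi⟩ := hcon (s • w) (by
      rw [QuadraticMap.map_smul, ← pow_two, hs, smul_eq_mul, inv_mul_cancel₀ hne])
    exact hi ((hmem _).1 (N.smul_mem s hw) i)
  have hproj : ∀ u : V, u - ∑ j, QuadraticMap.polar Q (v j) u • v' j ∈ N := by
    intro u
    rw [hmem]
    intro i
    have : QuadraticMap.polarBilin Q (v i) (u - ∑ j, QuadraticMap.polar Q (v j) u • v' j) = 0 := by
      simp [map_sub, map_sum, h]
    exact this
  -- A vector of `N` is orthogonal to `N`, which is totally isotropic, and by `hv'` to all `v' j`.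
  -- By `hproj` these span the space together with `N`, so the vector lies in the radical.
  have hbot : N = ⊥ := by
    rw [eq_bot_iff]
    intro w hw
    rw [Submodule.mem_bot]
    refine (LinearMap.BilinForm.nondegenerate_iff_ker_eq_bot.1 hQ).le ?_
    rw [LinearMap.mem_ker]
    ext u
    have h1 : QuadraticMap.polarBilin Q w (u - ∑ j, QuadraticMap.polar Q (v j) u • v' j) = 0 :=
      polar_eq_zero_of_forall_isotropic hiso hw (hproj u)
    have h2 : ∀ j, QuadraticMap.polarBilin Q w (v' j) = 0 := fun j => by
      rw [QuadraticMap.polarBilin_apply_apply, QuadraticMap.polar_comm]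
      exact hv' w ((hmem w).1 hw) j
    rw [map_sub, map_sum, sub_eq_zero] at h1
    rw [h1]
    simp [h2]
  have hspan : ⊤ ≤ Submodule.span ℂ (Set.range v') := by
    intro u _
    have := hproj u
    rw [hbot, Submodule.mem_bot, sub_eq_zero] at this
    rw [this]
    exact Submodule.sum_mem _ fun j _ => Submodule.smul_mem _ _ (Submodule.subset_span ⟨j, rfl⟩)
  have h3 := finrank_range_le_card (R := ℂ) v'
  rw [Set.finrank, top_le_iff.1 hspan, finrank_top] at h3
  omega

/-- A basis of a quadratic space made of hyperbolic pairs `x i, y i` and of orthogonal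
non-isotropic vectors `l j`. -/
structure WittFrame (Q : QuadraticForm ℂ V) (H L : Type*) [DecidableEq H] where
  /-- The underlying basis. -/
  basis : Module.Basis (H ⊕ H ⊕ L) ℂ V
  polar_xx : ∀ i j, QuadraticMap.polar Q (basis (.inl i)) (basis (.inl j)) = 0
  polar_yy : ∀ i j, QuadraticMap.polar Q (basis (.inr (.inl i))) (basis (.inr (.inl j))) = 0
  polar_xy : ∀ i j, QuadraticMap.polar Q (basis (.inl i)) (basis (.inr (.inl j))) =
    if i = j then 1 else 0
  polar_xl : ∀ i j, QuadraticMap.polar Q (basis (.inl i)) (basis (.inr (.inr j))) = 0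
  polar_yl : ∀ i j, QuadraticMap.polar Q (basis (.inr (.inl i))) (basis (.inr (.inr j))) = 0
  polar_ll : ∀ i j, i ≠ j →
    QuadraticMap.polar Q (basis (.inr (.inr i))) (basis (.inr (.inr j))) = 0
  polar_l_ne_zero : ∀ i, Q (basis (.inr (.inr i))) ≠ 0

/-- Hyperbolic pairs and orthonormal vectors can be completed to a frame. -/
theorem exists_orthonormal_completion [FiniteDimensional ℂ V]
    (hQ : (QuadraticMap.polarBilin Q).Nondegenerate) {I : Type*} [Fintype I] [DecidableEq I]
    {v v' : I → V} (h : ∀ i j, QuadraticMap.polar Q (v i) (v' j) = if i = j then 1 else 0)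
    (hv' : ∀ w, (∀ i, QuadraticMap.polar Q (v i) w = 0) → ∀ i, QuadraticMap.polar Q (v' i) w = 0)
    (n : ℕ) (hcard : Fintype.card I + n ≤ Module.finrank ℂ V) :
    ∃ f : Fin n → V, (∀ j, Q (f j) = 1) ∧ (∀ i j, QuadraticMap.polar Q (v i) (f j) = 0) ∧
      ∀ i j, i ≠ j → QuadraticMap.polar Q (f i) (f j) = 0 := by
  induction n with
  | zero => exact ⟨Fin.elim0, fun j => j.elim0, fun _ j => j.elim0, fun i => i.elim0⟩
  | succ n ih =>
    obtain ⟨f, hf1, hf2, hf3⟩ := ih (by omega)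
    -- The polar form is twice the norm on the diagonal, hence `f j / 2` is dual to `f j`.
    obtain ⟨g, hg1, hg2⟩ := exists_orthogonal_unit (Q := Q) hQ (I := I ⊕ Fin n)
      (v := Sum.elim v f) (v' := Sum.elim v' (fun j => (2⁻¹ : ℂ) • f j)) (by
        rintro (i | i) (j | j)
        · simpa using h i j
        · simp [QuadraticMap.polar_smul_right, hf2]
        · have := hv' (f i) (fun l => hf2 l i) j
          rw [QuadraticMap.polar_comm] at this
          simpa using this
        · by_cases hij : i = j
          · subst hij
            simp [QuadraticMap.polar_smul_right, QuadraticMap.polar_self, hf1]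
          · simp [QuadraticMap.polar_smul_right, hf3 i j hij, hij])
      (by
        intro w hw
        rintro (i | i)
        · exact hv' w (fun l => hw (.inl l)) i
        · have := hw (.inr i)
          simp only [Sum.elim_inr] at this ⊢
          rw [QuadraticMap.polar_smul_left, this, smul_zero])
      (by simp; omega)
    refine ⟨Fin.snoc f g, ?_, ?_, ?_⟩
    · intro j
      refine Fin.lastCases ?_ (fun j => ?_) j <;> simp [hg1, hf1]
    · intro i j
      refine Fin.lastCases ?_ (fun j => ?_) j
      · simpa using hg2 (.inl i)
      · simpa using hf2 i j
    · intro i j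
      refine Fin.lastCases ?_ (fun j => ?_) j <;> refine Fin.lastCases ?_ (fun i => ?_) i
      · simp
      · intro _; simpa using hg2 (.inr i)
      · intro _; rw [QuadraticMap.polar_comm]; simpa using hg2 (.inr j)
      · intro hij
        simpa using hf3 i j (fun h => hij (by rw [h]))

theorem exists_orthonormal_basis [FiniteDimensional ℂ V]
    (hQ : (QuadraticMap.polarBilin Q).Nondegenerate) :
    ∃ b : Module.Basis (Fin (Module.finrank ℂ V)) ℂ V, (∀ i, Q (b i) = 1) ∧
      ∀ i j, i ≠ j → QuadraticMap.polar Q (b i) (b j) = 0 := by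
  obtain ⟨f, h1, -, h3⟩ := exists_orthonormal_completion (I := Empty) (v := Empty.elim)
    (v' := Empty.elim) hQ (fun i => i.elim) (fun _ _ i => i.elim) (Module.finrank ℂ V) (by simp)
  have hli : LinearIndependent ℂ f := linearIndependent_of_dual (Q := Q)
    (v' := fun j => (2⁻¹ : ℂ) • f j) (by
      intro i j
      by_cases hij : i = j
      · subst hij
        simp [QuadraticMap.polar_smul_right, QuadraticMap.polar_self, h1]
      · simp [QuadraticMap.polar_smul_right, h3 i j hij, hij])
  refine ⟨basisOfLinearIndependentOfCardEqFinrank' f hli (by simp), ?_, ?_⟩ <;> simpa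

end Frames

/-! ### Lifting continuous families of isometries to the spin group -/

section LocalLift

variable {V : Type*} [AddCommGroup V] [Module ℂ V] {Q : QuadraticForm ℂ V}
  {X : Type*} [TopologicalSpace X]

theorem continuous_clifford_functional (l : CliffordAlgebra Q →ₗ[ℂ] ℂ) : Continuous l :=
  have : ContinuousAdd (CliffordAlgebra Q) := IsModuleTopology.toContinuousAdd ℂ _
  have : ContinuousSMul ℂ (CliffordAlgebra Q) := IsModuleTopology.toContinuousSMul ℂ _
  IsModuleTopology.continuous_of_linearMap l

theorem exists_clifford_functional (Q : QuadraticForm ℂ V) (l : V →ₗ[ℂ] ℂ) :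
    ∃ L : CliffordAlgebra Q →ₗ[ℂ] ℂ, ∀ v, L (ι Q v) = l v := by
  obtain ⟨g, hg⟩ := LinearMap.exists_leftInverse_of_injective (ι Q)
    (LinearMap.ker_eq_bot.2 (ι_injective Q))
  refine ⟨l ∘ₗ g, fun v => ?_⟩
  have := LinearMap.congr_fun hg v
  simpa using congrArg l this

/-- `V` carries no topology here: continuity of a family of vectors is expressed by all linear
functionals. -/
theorem continuousOn_ι [FiniteDimensional ℂ V] {γ : X → V} {U : Set X}
    (h : ∀ l : V →ₗ[ℂ] ℂ, ContinuousOn (fun z => l (γ z)) U) :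
    ContinuousOn (fun z => ι Q (γ z)) U := by
  have : ContinuousAdd (CliffordAlgebra Q) := IsModuleTopology.toContinuousAdd ℂ _
  have : ContinuousSMul ℂ (CliffordAlgebra Q) := IsModuleTopology.toContinuousSMul ℂ _
  have he : (fun z => ι Q (γ z)) = fun z => ∑ i, (Module.finBasis ℂ V).coord i (γ z) •
      ι Q (Module.finBasis ℂ V i) := by
    funext z
    conv_lhs => rw [← (Module.finBasis ℂ V).sum_repr (γ z)]
    simp only [map_sum, map_smul, Module.Basis.coord_apply]
  rw [he]
  exact continuousOn_finsetSum _ fun i _ => ContinuousOn.fun_smul (h _) continuousOn_const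

theorem continuous_vectorRep_functional [FiniteDimensional ℂ V] (l : V →ₗ[ℂ] ℂ) (v : V) :
    Continuous fun x : spinGroup Q => l (vectorRep Q x v) := by
  obtain ⟨L, hL⟩ := exists_clifford_functional Q l
  simp_rw [← hL, ι_vectorRep]
  refine (continuous_clifford_functional L).comp ?_
  exact (continuous_subtype_val.mul continuous_const).mul
    ((continuous_star_clifford Q).comp continuous_subtype_val)

/-- Induction on the number `d` of basis vectors that `γ` need not fix. For the first of them, `e`,
reflecting in `γ z e + e` and then in `γ z e` sends `e` to `-γ z e` and on to `γ z e`, and fixes the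
earlier basis vectors, which are orthogonal to both. The normalized product of these two vectors is
a spin element depending continuously on `z`; dividing it out leaves a family that fixes one more
vector. -/
theorem exists_local_lift_of_fixed [FiniteDimensional ℂ V] {n : ℕ} (b : Module.Basis (Fin n) ℂ V)
    (hb1 : ∀ i, Q (b i) = 1) (hb2 : ∀ i j, i ≠ j → QuadraticMap.polar Q (b i) (b j) = 0)
    (x₀ : X) (d : ℕ) : ∀ (m : ℕ) (_ : m + d = n) (γ : X → Module.End ℂ V) (U : Set X)
    (_ : IsOpen U) (_ : x₀ ∈ U)
    (_ : ∀ (v : V) (l : V →ₗ[ℂ] ℂ), ContinuousOn (fun z => l (γ z v)) U)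
    (_ : ∀ z ∈ U, ∀ v, Q (γ z v) = Q v) (_ : γ x₀ = 1)
    (_ : ∀ z ∈ U, ∀ i : Fin n, i.val < m → γ z (b i) = b i),
    ∃ U' : Set X, IsOpen U' ∧ x₀ ∈ U' ∧ ∃ s : X → CliffordAlgebra Q, ContinuousOn s U' ∧
      s x₀ = 1 ∧ ∀ z ∈ U', ∃ h : s z ∈ spinGroup Q, vectorRep Q ⟨s z, h⟩ = γ z := by
  induction d with
  | zero =>
    intro m hm γ U hU hxU hγ hiso h0 hfix
    refine ⟨U, hU, hxU, fun _ => 1, continuousOn_const, rfl, fun z hz => ⟨one_mem _, ?_⟩⟩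
    rw [show (⟨1, one_mem _⟩ : spinGroup Q) = 1 from rfl, map_one]
    exact b.ext fun i => (hfix z hz i (by omega)).symm
  | succ d ih =>
    intro m hm γ U hU hxU hγ hiso h0 hfix
    have := IsModuleTopology.toContinuousSMul ℂ (CliffordAlgebra Q)
    set e : V := b ⟨m, by omega⟩ with he
    have hQe : Q e = 1 := hb1 _
    set c : X → ℂ := fun z => Q (γ z e + e) with hc
    have hpol : ∀ z ∈ U, ∀ u v, QuadraticMap.polar Q (γ z u) (γ z v) = QuadraticMap.polar Q u v := by
      intro z hz u v
      simp only [QuadraticMap.polar, ← map_add, hiso z hz]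
    have hcU : ContinuousOn c U := by
      have h1 : ContinuousOn (fun z => 2 + QuadraticMap.polarBilin Q e (γ z e)) U :=
        continuousOn_const.add (hγ e _)
      refine h1.congr fun z hz => ?_
      simp only [hc]
      rw [QuadraticMap.map_add Q, hiso z hz, hQe, QuadraticMap.polar_comm,
        QuadraticMap.polarBilin_apply_apply]
      norm_num
    have hc0 : c x₀ = 4 := by
      simp only [hc, h0, Module.End.one_apply]
      rw [← two_smul ℂ e, QuadraticMap.map_smul, hQe]; norm_num
    set U₁ : Set X := U ∩ (fun z => c z / 4) ⁻¹' Complex.slitPlane with hU₁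
    have hU₁o : IsOpen U₁ := (hcU.div_const 4).isOpen_inter_preimage hU Complex.isOpen_slitPlane
    have hxU₁ : x₀ ∈ U₁ := ⟨hxU, by simp [hc0]⟩
    -- A continuous branch of `c⁻¹ᐟ²`. At the base point `c` is `Q (2 • e) = 4`, so `c / 4` is near
    -- 1 and the principal logarithm applies; the value there is 1/2, which makes `xs x₀ = 1`.
    set r : X → ℂ := fun z => Complex.exp (-Complex.log (c z / 4) / 2) / 2 with hr
    have hrU : ContinuousOn r U₁ := by
      refine ContinuousOn.div_const (Complex.continuous_exp.comp_continuousOn ?_) 2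
      refine ContinuousOn.div_const (ContinuousOn.neg ?_) 2
      exact ContinuousOn.clog ((hcU.mono Set.inter_subset_left).div_const 4) fun z hz => hz.2
    have hr0 : r x₀ = 2⁻¹ := by simp [hr, hc0]
    have hrc : ∀ z ∈ U₁, r z * r z * c z = 1 := by
      intro z hz
      have hne : c z / 4 ≠ 0 := Complex.slitPlane_ne_zero hz.2
      have h1 : r z * r z = Complex.exp (-Complex.log (c z / 4)) / 4 := by
        simp only [hr]
        rw [div_mul_div_comm, ← Complex.exp_add, add_halves]; norm_num
      rw [h1, Complex.exp_neg, Complex.exp_log hne]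
      have hne' : c z ≠ 0 := fun h => hne (by rw [h, zero_div])
      field_simp
    set xs : X → CliffordAlgebra Q := fun z => ι Q (r z • γ z e) * ι Q (γ z e + e) with hxs
    have hmem : ∀ z ∈ U₁, xs z ∈ spinGroup Q := by
      intro z hz
      apply ι_mul_ι_mem_spinGroup
      rw [QuadraticMap.map_smul, hiso z hz.1, hQe, smul_eq_mul, mul_one]
      exact hrc z hz
    have hιU : ContinuousOn (fun z => ι Q (γ z e)) U := continuousOn_ι (hγ e)
    have hxsU : ContinuousOn xs U₁ := by
      have h1 := hιU.mono (Set.inter_subset_left (t := (fun z => c z / 4) ⁻¹' Complex.slitPlane))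
      simp only [hxs, map_smul, map_add]
      exact (hrU.smul h1).mul (h1.add continuousOn_const)
    have hxs0 : xs x₀ = 1 := by
      simp only [hxs, h0, hr0, Module.End.one_apply]
      rw [← two_smul ℂ e, map_smul, map_smul, smul_mul_smul_comm, ι_sq_scalar, hQe]
      simp
    have hρe : ∀ z (hz : z ∈ U₁), vectorRep Q ⟨xs z, hmem z hz⟩ e = γ z e := by
      intro z hz
      apply vectorRep_eq_of_mul
      have h1 : ι Q (γ z e) * ι Q (γ z e) = 1 := by rw [ι_sq_scalar, hiso z hz.1, hQe, map_one]
      have h2 : ι Q e * ι Q e = 1 := by rw [ι_sq_scalar, hQe, map_one]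
      have h3 : ι Q (γ z e) * (ι Q (γ z e) * ι Q e) = ι Q e := by rw [← mul_assoc, h1, one_mul]
      simp only [hxs, map_smul, map_add, smul_mul_assoc, mul_smul_comm, mul_add, add_mul, mul_assoc,
        h1, h2, h3, mul_one, one_mul]
      rw [add_comm]
    have hρi : ∀ z (hz : z ∈ U₁) (i : Fin n), i.val < m →
        vectorRep Q ⟨xs z, hmem z hz⟩ (b i) = b i := by
      intro z hz i hi
      have h1 : QuadraticMap.polar Q (b i) e = 0 := hb2 _ _ (by rintro rfl; simp at hi)
      have h2 : QuadraticMap.polar Q (b i) (γ z e) = 0 := by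
        rw [← hfix z hz.1 i hi, hpol z hz.1, h1]
      have h3 : QuadraticMap.polar Q (b i) (γ z e + e) = 0 := by
        rw [QuadraticMap.polar_add_right, h1, h2, add_zero]
      have h4 : ι Q (b i) * ι Q (γ z e) = -(ι Q (γ z e) * ι Q (b i)) := by
        rw [eq_neg_iff_add_eq_zero, ι_mul_ι_add_swap, h2, map_zero]
      have h5 : ι Q (b i) * ι Q (γ z e + e) = -(ι Q (γ z e + e) * ι Q (b i)) := by
        rw [eq_neg_iff_add_eq_zero, ι_mul_ι_add_swap, h3, map_zero]
      apply vectorRep_eq_of_mul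
      simp only [hxs]
      rw [map_smul, smul_mul_assoc, mul_smul_comm, smul_mul_assoc, ← mul_assoc, h4, neg_mul,
        mul_assoc, h5, mul_neg, neg_neg, mul_assoc]
    classical
    set γ' : X → Module.End ℂ V := fun z =>
      if h : xs z ∈ spinGroup Q then vectorRep Q (⟨xs z, h⟩ : spinGroup Q)⁻¹ * γ z else 1 with hγ'
    have hγ'eq : ∀ z (hz : z ∈ U₁),
        γ' z = vectorRep Q (⟨xs z, hmem z hz⟩ : spinGroup Q)⁻¹ * γ z := by
      intro z hz
      simp only [hγ', dif_pos (hmem z hz)]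
    have hinv : ∀ (g : spinGroup Q) (u w : V), vectorRep Q g u = w → vectorRep Q g⁻¹ w = u := by
      rintro g u w rfl
      rw [← Module.End.mul_apply, ← map_mul, inv_mul_cancel, map_one, Module.End.one_apply]
    obtain ⟨U', hU'o, hxU', s', hs'c, hs'0, hs'⟩ := ih (m + 1) (by omega) γ' U₁ hU₁o hxU₁
      (by
        intro v l
        obtain ⟨L, hL⟩ := exists_clifford_functional Q l
        have h1 : ContinuousOn (fun z => L (star (xs z) * ι Q (γ z v) * star (star (xs z)))) U₁ := by
          refine (continuous_clifford_functional L).comp_continuousOn ?_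
          have h2 := (continuous_star_clifford Q).comp_continuousOn hxsU
          have h3 := (continuous_star_clifford Q).comp_continuousOn h2
          exact (h2.mul ((continuousOn_ι (hγ v)).mono Set.inter_subset_left)).mul h3
        refine h1.congr fun z hz => ?_
        simp only
        rw [hγ'eq z hz, ← hL, Module.End.mul_apply, ι_vectorRep]
        rfl)
      (by
        intro z hz v
        rw [hγ'eq z hz, Module.End.mul_apply, vectorRep_isometry, hiso z hz.1])
      (by
        rw [hγ'eq x₀ hxU₁, h0, mul_one]
        have : (⟨xs x₀, hmem x₀ hxU₁⟩ : spinGroup Q) = 1 := Subtype.ext hxs0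
        rw [this, inv_one, map_one])
      (by
        intro z hz i hi
        rw [hγ'eq z hz, Module.End.mul_apply]
        apply hinv
        rcases Nat.lt_succ_iff_lt_or_eq.1 hi with h | h
        · rw [hρi z hz i h, hfix z hz.1 i h]
        · have : b i = e := by rw [he]; congr 1; exact Fin.ext h
          rw [this, hρe z hz])
    refine ⟨U₁ ∩ U', hU₁o.inter hU'o, ⟨hxU₁, hxU'⟩, fun z => xs z * s' z,
      (hxsU.mono Set.inter_subset_left).mul (hs'c.mono Set.inter_subset_right),
      by simp [hxs0, hs'0], ?_⟩
    rintro z ⟨hz1, hz2⟩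
    obtain ⟨h, hh⟩ := hs' z hz2
    refine ⟨mul_mem (hmem z hz1) h, ?_⟩
    have : (⟨xs z * s' z, mul_mem (hmem z hz1) h⟩ : spinGroup Q) =
      ⟨xs z, hmem z hz1⟩ * ⟨s' z, h⟩ := rfl
    rw [this, map_mul, hh, hγ'eq z hz1, ← mul_assoc, ← map_mul, mul_inv_cancel, map_one, one_mul]

/-- A continuous family of isometries starting at the identity lifts locally to the spin group. -/
theorem exists_local_lift [FiniteDimensional ℂ V] (hQ : (QuadraticMap.polarBilin Q).Nondegenerate)
    (x₀ : X) (γ : X → Module.End ℂ V)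
    (hγ : ∀ (v : V) (l : V →ₗ[ℂ] ℂ), Continuous (fun z => l (γ z v)))
    (hiso : ∀ z v, Q (γ z v) = Q v) (h0 : γ x₀ = 1) :
    ∃ U' : Set X, IsOpen U' ∧ x₀ ∈ U' ∧ ∃ s : X → CliffordAlgebra Q, ContinuousOn s U' ∧
      s x₀ = 1 ∧ ∀ z ∈ U', ∃ h : s z ∈ spinGroup Q, vectorRep Q ⟨s z, h⟩ = γ z := by
  obtain ⟨b, hb1, hb2⟩ := exists_orthonormal_basis hQ
  exact exists_local_lift_of_fixed b hb1 hb2 x₀ _ 0 (zero_add _) γ Set.univ isOpen_univ trivial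
    (fun v l => (hγ v l).continuousOn) (fun z _ => hiso z) h0 (fun z _ i hi => absurd hi (by omega))

end LocalLift

/-! ### Centralizers of a pair of maps, in the spin groups and in the isometry groups -/

section PairCentralizer

variable {U₁ U₂ : Type*} [AddCommGroup U₁] [Module ℂ U₁] [AddCommGroup U₂] [Module ℂ U₂]

/-- The pairs of elements of the spin groups that commute with `α` and `β`. -/
def pairCentralizer (Q₁ : QuadraticForm ℂ U₁) (Q₂ : QuadraticForm ℂ U₂) (α : U₁ →ₗ[ℂ] U₂)
    (β : U₂ →ₗ[ℂ] U₁) : Subgroup (spinGroup Q₁ × spinGroup Q₂) where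
  carrier := {g | (∀ u, vectorRep Q₂ g.2 (α u) = α (vectorRep Q₁ g.1 u)) ∧
    ∀ v, vectorRep Q₁ g.1 (β v) = β (vectorRep Q₂ g.2 v)}
  one_mem' := by simp
  mul_mem' {x y} hx hy := by
    refine ⟨fun u => ?_, fun v => ?_⟩
    · rw [Prod.snd_mul, Prod.fst_mul, map_mul, map_mul, Module.End.mul_apply,
        Module.End.mul_apply, hy.1, hx.1]
    · rw [Prod.snd_mul, Prod.fst_mul, map_mul, map_mul, Module.End.mul_apply,
        Module.End.mul_apply, hy.2, hx.2]
  inv_mem' {x} hx := by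
    have h1 : ∀ u, vectorRep Q₁ x.1⁻¹ (vectorRep Q₁ x.1 u) = u := fun u => by
      rw [← Module.End.mul_apply, ← map_mul, inv_mul_cancel, map_one, Module.End.one_apply]
    have h2 : ∀ u, vectorRep Q₂ x.2⁻¹ (vectorRep Q₂ x.2 u) = u := fun u => by
      rw [← Module.End.mul_apply, ← map_mul, inv_mul_cancel, map_one, Module.End.one_apply]
    have h3 : ∀ u, vectorRep Q₁ x.1 (vectorRep Q₁ x.1⁻¹ u) = u := fun u => by
      rw [← Module.End.mul_apply, ← map_mul, mul_inv_cancel, map_one, Module.End.one_apply]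
    have h4 : ∀ u, vectorRep Q₂ x.2 (vectorRep Q₂ x.2⁻¹ u) = u := fun u => by
      rw [← Module.End.mul_apply, ← map_mul, mul_inv_cancel, map_one, Module.End.one_apply]
    refine ⟨fun u => ?_, fun v => ?_⟩
    · have := hx.1 (vectorRep Q₁ x.1⁻¹ u)
      rw [h3] at this
      rw [Prod.snd_inv, Prod.fst_inv, ← this, h2]
    · have := hx.2 (vectorRep Q₂ x.2⁻¹ v)
      rw [h4] at this
      rw [Prod.snd_inv, Prod.fst_inv, ← this, h1]

/-- The pairs of isometries that commute with `α` and `β`. -/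
def isometryCentralizer (Q₁ : QuadraticForm ℂ U₁) (Q₂ : QuadraticForm ℂ U₂) (α : U₁ →ₗ[ℂ] U₂)
    (β : U₂ →ₗ[ℂ] U₁) : Subgroup ((Module.End ℂ U₁)ˣ × (Module.End ℂ U₂)ˣ) where
  carrier := {h | (∀ u, Q₁ (h.1.val u) = Q₁ u) ∧ (∀ v, Q₂ (h.2.val v) = Q₂ v) ∧
    (∀ u, h.2.val (α u) = α (h.1.val u)) ∧ ∀ v, h.1.val (β v) = β (h.2.val v)}
  one_mem' := by simp
  mul_mem' {x y} hx hy := by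
    obtain ⟨a1, a2, a3, a4⟩ := hx
    obtain ⟨b1, b2, b3, b4⟩ := hy
    refine ⟨fun u => ?_, fun v => ?_, fun u => ?_, fun v => ?_⟩ <;>
      simp only [Prod.fst_mul, Prod.snd_mul, Units.val_mul, Module.End.mul_apply]
    · rw [a1, b1]
    · rw [a2, b2]
    · rw [b3, a3]
    · rw [b4, a4]
  inv_mem' {x} hx := by
    obtain ⟨a1, a2, a3, a4⟩ := hx
    have h1 : ∀ u, (x.1⁻¹).val (x.1.val u) = u := fun u => by
      rw [← Module.End.mul_apply, Units.inv_mul, Module.End.one_apply]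
    have h2 : ∀ u, (x.2⁻¹).val (x.2.val u) = u := fun u => by
      rw [← Module.End.mul_apply, Units.inv_mul, Module.End.one_apply]
    have h3 : ∀ u, x.1.val ((x.1⁻¹).val u) = u := fun u => by
      rw [← Module.End.mul_apply, Units.mul_inv, Module.End.one_apply]
    have h4 : ∀ u, x.2.val ((x.2⁻¹).val u) = u := fun u => by
      rw [← Module.End.mul_apply, Units.mul_inv, Module.End.one_apply]
    refine ⟨fun u => ?_, fun v => ?_, fun u => ?_, fun v => ?_⟩ <;>
      simp only [Prod.fst_inv, Prod.snd_inv]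
    · rw [← a1, h3]
    · rw [← a2, h4]
    · have := a3 ((x.1⁻¹).val u)
      rw [h3] at this
      rw [← this, h2]
    · have := a4 ((x.2⁻¹).val v)
      rw [h4] at this
      rw [← this, h1]

/-- The product of the vector representations, with values in invertible endomorphisms. -/
def unitsRep (Q₁ : QuadraticForm ℂ U₁) (Q₂ : QuadraticForm ℂ U₂) :
    spinGroup Q₁ × spinGroup Q₂ →* (Module.End ℂ U₁)ˣ × (Module.End ℂ U₂)ˣ :=
  (vectorRep Q₁).toHomUnits.prodMap (vectorRep Q₂).toHomUnits

variable {Q₁ : QuadraticForm ℂ U₁} {Q₂ : QuadraticForm ℂ U₂} {α : U₁ →ₗ[ℂ] U₂} {β : U₂ →ₗ[ℂ] U₁}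

@[simp] theorem unitsRep_fst (g : spinGroup Q₁ × spinGroup Q₂) :
    ((unitsRep Q₁ Q₂ g).1 : Module.End ℂ U₁) = vectorRep Q₁ g.1 := rfl

@[simp] theorem unitsRep_snd (g : spinGroup Q₁ × spinGroup Q₂) :
    ((unitsRep Q₁ Q₂ g).2 : Module.End ℂ U₂) = vectorRep Q₂ g.2 := rfl

theorem unitsRep_mem_iff (g : spinGroup Q₁ × spinGroup Q₂) :
    unitsRep Q₁ Q₂ g ∈ isometryCentralizer Q₁ Q₂ α β ↔ g ∈ pairCentralizer Q₁ Q₂ α β :=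
  ⟨fun h => ⟨h.2.2.1, h.2.2.2⟩, fun h => ⟨vectorRep_isometry g.1, vectorRep_isometry g.2, h.1, h.2⟩⟩

variable [FiniteDimensional ℂ U₁] [FiniteDimensional ℂ U₂]

variable (Q₁ Q₂ α β) in
/-- The image in the isometry groups of the identity component of the centralizer. -/
def neutralImage : Subgroup ((Module.End ℂ U₁)ˣ × (Module.End ℂ U₂)ˣ) :=
  ((Subgroup.connectedComponentOfOne (pairCentralizer Q₁ Q₂ α β)).map
    (pairCentralizer Q₁ Q₂ α β).subtype).map (unitsRep Q₁ Q₂)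

theorem mem_neutralImage {h : (Module.End ℂ U₁)ˣ × (Module.End ℂ U₂)ˣ} :
    h ∈ neutralImage Q₁ Q₂ α β ↔ ∃ g : pairCentralizer Q₁ Q₂ α β,
      g ∈ Subgroup.connectedComponentOfOne (pairCentralizer Q₁ Q₂ α β) ∧
        unitsRep Q₁ Q₂ g = h := by
  simp [neutralImage]

theorem mem_component_of_family {G : Type*} [TopologicalSpace G] [Group G] [IsTopologicalGroup G]
    {X : Type*} [TopologicalSpace X] [PreconnectedSpace X] {f : X → G} (hf : Continuous f) {x₀ : X}
    (h0 : f x₀ = 1) (x : X) : f x ∈ Subgroup.connectedComponentOfOne G := by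
  have := (isPreconnected_range hf).subset_connectedComponent (Set.mem_range_self x₀)
  rw [h0] at this
  exact this (Set.mem_range_self x)

/-- Membership in `pairCentralizer` depends only on the action on vectors. The local lifts of both
components therefore stay in the centralizer, and over a connected neighbourhood they stay in its
identity component, since they start at 1. -/
theorem eventually_mem_neutralImage (hQ₁ : (QuadraticMap.polarBilin Q₁).Nondegenerate)
    (hQ₂ : (QuadraticMap.polarBilin Q₂).Nondegenerate)
    {X : Type*} [TopologicalSpace X] [LocallyConnectedSpace X]
    {γ : X → (Module.End ℂ U₁)ˣ × (Module.End ℂ U₂)ˣ}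
    (hγ : ∀ x, γ x ∈ isometryCentralizer Q₁ Q₂ α β)
    (hc1 : ∀ (v : U₁) (l : U₁ →ₗ[ℂ] ℂ), Continuous fun x => l ((γ x).1.val v))
    (hc2 : ∀ (v : U₂) (l : U₂ →ₗ[ℂ] ℂ), Continuous fun x => l ((γ x).2.val v))
    {x₀ : X} (h0 : γ x₀ = 1) : ∀ᶠ x in nhds x₀, γ x ∈ neutralImage Q₁ Q₂ α β := by
  obtain ⟨V₁, hV₁, hx₁, s, hs, hs0, hs'⟩ := exists_local_lift hQ₁ x₀ (fun x => (γ x).1.val) hc1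
    (fun x => (hγ x).1) (by rw [h0]; rfl)
  obtain ⟨V₂, hV₂, hx₂, t, ht, ht0, ht'⟩ := exists_local_lift hQ₂ x₀ (fun x => (γ x).2.val) hc2
    (fun x => (hγ x).2.1) (by rw [h0]; rfl)
  obtain ⟨W, hWV, hWo, hxW, hWc⟩ := locallyConnectedSpace_iff_subsets_isOpen_isConnected.1
    ‹LocallyConnectedSpace X› x₀ (V₁ ∩ V₂) ((hV₁.inter hV₂).mem_nhds ⟨hx₁, hx₂⟩)
  have : PreconnectedSpace W := isPreconnected_iff_preconnectedSpace.1 hWc.isPreconnected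
  have hsm : ∀ x : W, s x ∈ spinGroup Q₁ := fun x => (hs' x (hWV x.2).1).1
  have htm : ∀ x : W, t x ∈ spinGroup Q₂ := fun x => (ht' x (hWV x.2).2).1
  have hrep : ∀ x : W, unitsRep Q₁ Q₂ (⟨s x, hsm x⟩, ⟨t x, htm x⟩) = γ x := by
    intro x
    apply Prod.ext <;> apply Units.ext
    · exact (hs' x (hWV x.2).1).2
    · exact (ht' x (hWV x.2).2).2
  let f : W → pairCentralizer Q₁ Q₂ α β := fun x => ⟨(⟨s x, hsm x⟩, ⟨t x, htm x⟩),
    (unitsRep_mem_iff _).1 (by rw [hrep]; exact hγ x)⟩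
  have hf : Continuous f := by
    refine Continuous.subtype_mk (Continuous.prodMk (Continuous.subtype_mk ?_ _)
      (Continuous.subtype_mk ?_ _)) _
    · exact continuousOn_iff_continuous_domRestrict.1 (hs.mono fun x hx => (hWV hx).1)
    · exact continuousOn_iff_continuous_domRestrict.1 (ht.mono fun x hx => (hWV hx).2)
  have hf0 : f ⟨x₀, hxW⟩ = 1 := by
    apply Subtype.ext
    exact Prod.ext (Subtype.ext hs0) (Subtype.ext ht0)
  filter_upwards [hWo.mem_nhds hxW] with x hx
  exact mem_neutralImage.2 ⟨f ⟨x, hx⟩, mem_component_of_family hf hf0 _, hrep ⟨x, hx⟩⟩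

/-- A connected family of isometries commuting with `α` and `β` that contains the identity lies in
the image of the identity component. -/
theorem mem_neutralImage_of_family (hQ₁ : (QuadraticMap.polarBilin Q₁).Nondegenerate)
    (hQ₂ : (QuadraticMap.polarBilin Q₂).Nondegenerate)
    {X : Type*} [TopologicalSpace X] [PreconnectedSpace X] [LocallyConnectedSpace X]
    {γ : X → (Module.End ℂ U₁)ˣ × (Module.End ℂ U₂)ˣ}
    (hγ : ∀ x, γ x ∈ isometryCentralizer Q₁ Q₂ α β)
    (hc1 : ∀ (v : U₁) (l : U₁ →ₗ[ℂ] ℂ), Continuous fun x => l ((γ x).1.val v))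
    (hc2 : ∀ (v : U₂) (l : U₂ →ₗ[ℂ] ℂ), Continuous fun x => l ((γ x).2.val v))
    {x₀ : X} (h0 : γ x₀ = 1) (x : X) : γ x ∈ neutralImage Q₁ Q₂ α β := by
  -- Translating by `(γ x₁)⁻¹` reduces any point to the case where the family passes through 1. The
  -- parameters mapped into the subgroup `neutralImage` then form an open set with open complement.
  have hloc : ∀ x₁, ∀ᶠ x in nhds x₁, γ x * (γ x₁)⁻¹ ∈ neutralImage Q₁ Q₂ α β := by
    intro x₁
    refine eventually_mem_neutralImage hQ₁ hQ₂ (γ := fun x => γ x * (γ x₁)⁻¹)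
      (fun x => mul_mem (hγ x) (inv_mem (hγ x₁))) (fun v l => ?_) (fun v l => ?_)
      (mul_inv_cancel _)
    · exact hc1 (((γ x₁).1⁻¹).val v) l
    · exact hc2 (((γ x₁).2⁻¹).val v) l
  have hclopen : IsClopen {x | γ x ∈ neutralImage Q₁ Q₂ α β} := by
    constructor
    · rw [← isOpen_compl_iff, isOpen_iff_eventually]
      intro x₁ hx₁
      filter_upwards [hloc x₁] with x hx hx2
      refine hx₁ ?_
      have h3 := mul_mem (inv_mem hx) hx2
      rwa [mul_inv_rev, inv_inv, inv_mul_cancel_right] at h3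
    · rw [isOpen_iff_eventually]
      intro x₁ hx₁
      filter_upwards [hloc x₁] with x hx
      have h3 := mul_mem hx hx₁
      rwa [inv_mul_cancel_right] at h3
  have huniv := hclopen.eq_univ ⟨x₀, by simp only [Set.mem_ofPred_eq, h0]; exact one_mem _⟩
  exact (Set.eq_univ_iff_forall.1 huniv) x

end PairCentralizer

/-! ### The Cayley transform -/

section Cayley

variable {V : Type*} [AddCommGroup V] [Module ℂ V]

/-- The affine line of endomorphisms joining the identity to `f`. -/
def interp (f : Module.End ℂ V) (t : ℂ) : Module.End ℂ V := (1 - t) • 1 + t • f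

theorem interp_apply (f : Module.End ℂ V) (t : ℂ) (v : V) :
    interp f t v = (1 - t) • v + t • f v := rfl

variable [FiniteDimensional ℂ V]

theorem toMatrix_interp (f : Module.End ℂ V) (t : ℂ) :
    LinearMap.toMatrix (Module.finBasis ℂ V) (Module.finBasis ℂ V) (interp f t) =
      (1 - t) • 1 + t • LinearMap.toMatrix (Module.finBasis ℂ V) (Module.finBasis ℂ V) f := by
  rw [interp, map_add, map_smul, map_smul, LinearMap.toMatrix_one]

theorem exists_polynomial_det_interp (f : Module.End ℂ V) :
    ∃ P : Polynomial ℂ, ∀ t, P.eval t = LinearMap.det (interp f t) := by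
  set A := LinearMap.toMatrix (Module.finBasis ℂ V) (Module.finBasis ℂ V) f with hA
  refine ⟨Matrix.det ((1 - Polynomial.X : Polynomial ℂ) • 1 +
    (Polynomial.X : Polynomial ℂ) • A.map Polynomial.C), fun t => ?_⟩
  rw [← LinearMap.det_toMatrix (Module.finBasis ℂ V), toMatrix_interp, ← Polynomial.coe_evalRingHom,
    RingHom.map_det]
  congr 1
  ext i j
  by_cases hij : i = j
  · subst hij; simp [← hA]; ring
  · simp [← hA, hij]; ring

/-- The determinant is a polynomial in `t` whose value at `t = 0` is 1. -/
theorem finite_det_interp_eq_zero (f : Module.End ℂ V) :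
    {t : ℂ | LinearMap.det (interp f t) = 0}.Finite := by
  obtain ⟨P, hP⟩ := exists_polynomial_det_interp f
  have hP0 : P ≠ 0 := by
    rintro rfl
    have := hP 0
    simp [interp] at this
  refine (Polynomial.finite_setOfPred_isRoot hP0).subset fun t ht => ?_
  rw [Set.mem_ofPred_eq, Polynomial.IsRoot.def, hP]
  exact ht

theorem continuous_det_interp (f : Module.End ℂ V) :
    Continuous fun t => LinearMap.det (interp f t) := by
  obtain ⟨P, hP⟩ := exists_polynomial_det_interp f
  simp_rw [← hP]
  exact P.continuous

/-- The endomorphisms `interp f t` that are invertible, as units. -/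
def interpUnit (f : Module.End ℂ V) (t : ℂ) (h : LinearMap.det (interp f t) ≠ 0) :
    (Module.End ℂ V)ˣ :=
  ((LinearMap.isUnit_iff_isUnit_det (interp f t)).2 (isUnit_iff_ne_zero.2 h)).unit

@[simp] theorem coe_interpUnit (f : Module.End ℂ V) (t : ℂ) (h : LinearMap.det (interp f t) ≠ 0) :
    (interpUnit f t h : Module.End ℂ V) = interp f t := rfl

/-- Cramer's rule: the inverse is the adjugate divided by the determinant, and both depend
continuously on the parameter. -/
theorem continuous_interpUnit_inv (f : Module.End ℂ V) {X : Type*} [TopologicalSpace X]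
    {τ : X → ℂ} (hτ : Continuous τ) (h : ∀ x, LinearMap.det (interp f (τ x)) ≠ 0) (v : V)
    (l : V →ₗ[ℂ] ℂ) : Continuous fun x => l ((interpUnit f (τ x) (h x))⁻¹.val v) := by
  set b := Module.finBasis ℂ V
  have hadj : ∀ x, (interpUnit f (τ x) (h x))⁻¹.val = (LinearMap.det (interp f (τ x)))⁻¹ •
      Matrix.toLin b b (LinearMap.toMatrix b b (interp f (τ x))).adjugate := by
    intro x
    apply Units.inv_eq_of_mul_eq_one_right
    rw [coe_interpUnit, mul_smul_comm]
    conv_lhs => rw [← Matrix.toLin_toMatrix b b (interp f (τ x))]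
    rw [Module.End.mul_eq_comp, ← Matrix.toLin_mul, LinearMap.toMatrix_toLin, Matrix.mul_adjugate,
      map_smul, Matrix.toLin_one, LinearMap.det_toLin, LinearMap.det_toMatrix, smul_smul,
      inv_mul_cancel₀ (h x), one_smul]
    rfl
  let T : Matrix (Fin (Module.finrank ℂ V)) (Fin (Module.finrank ℂ V)) ℂ →ₗ[ℂ] ℂ :=
    l ∘ₗ LinearMap.applyₗ v ∘ₗ (Matrix.toLin b b).toLinearMap
  have hT : Continuous T := LinearMap.continuous_of_finiteDimensional T
  have he : (fun x => l ((interpUnit f (τ x) (h x))⁻¹.val v)) = fun x =>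
      (LinearMap.det (interp f (τ x)))⁻¹ *
        T (LinearMap.toMatrix b b (interp f (τ x))).adjugate := by
    funext x
    rw [hadj, LinearMap.smul_apply, map_smul, smul_eq_mul]
    rfl
  rw [he]
  refine (((continuous_det_interp f).comp hτ).inv₀ h).mul (hT.comp ?_)
  refine Continuous.matrix_adjugate ?_
  simp_rw [b, toMatrix_interp]
  fun_prop

omit [FiniteDimensional ℂ V] in
theorem det_interp_zero (f : (Module.End ℂ V)ˣ) :
    LinearMap.det (interp f.val 0) ≠ 0 ∧ LinearMap.det (interp f.val (1 - 0)) ≠ 0 := by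
  constructor
  · simp [interp]
  · simpa [interp] using (f.isUnit.map LinearMap.det).ne_zero

/-- At the parameter 1/2 the interpolation is `(1 + f) / 2`, whose kernel is the eigenspace for -1.
-/
theorem det_interp_half (f : (Module.End ℂ V)ˣ) (hf : ∀ v, f.val v = -v → v = 0) :
    LinearMap.det (interp f.val 2⁻¹) ≠ 0 := by
  rw [← isUnit_iff_ne_zero, ← LinearMap.isUnit_iff_isUnit_det, LinearMap.isUnit_iff_ker_eq_bot,
    LinearMap.ker_eq_bot']
  intro v hv
  apply hf
  rw [interp_apply, show (1 - 2⁻¹ : ℂ) = 2⁻¹ by norm_num, ← smul_add] at hv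
  exact eq_neg_of_add_eq_zero_right ((smul_eq_zero.1 hv).resolve_left (by norm_num))

end Cayley

section CayleyPair

variable {U₁ U₂ : Type*} [AddCommGroup U₁] [Module ℂ U₁] [AddCommGroup U₂] [Module ℂ U₂]
  [FiniteDimensional ℂ U₁] [FiniteDimensional ℂ U₂]
  {Q₁ : QuadraticForm ℂ U₁} {Q₂ : QuadraticForm ℂ U₂} {α : U₁ →ₗ[ℂ] U₂} {β : U₂ →ₗ[ℂ] U₁}

-- For an isometry `f` the norm of `(1 - t) v + t f v` is symmetric under `t ↦ 1 - t`. Hence `interp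
-- f (1 - t) * (interp f t)⁻¹` is an isometry wherever it is defined.
omit [FiniteDimensional ℂ U₁] in
theorem interp_isometry {f : Module.End ℂ U₁}
    (hf : ∀ v, Q₁ (f v) = Q₁ v) (t : ℂ) (v : U₁) :
    Q₁ (interp f (1 - t) v) = Q₁ (interp f t v) := by
  simp only [interp_apply, QuadraticMap.map_add Q₁, QuadraticMap.map_smul, hf,
    QuadraticMap.polar_smul_left, QuadraticMap.polar_smul_right, smul_eq_mul]
  ring

omit [FiniteDimensional ℂ U₁] [FiniteDimensional ℂ U₂] in
theorem interp_comp {f : Module.End ℂ U₁} {g : Module.End ℂ U₂} {α : U₁ →ₗ[ℂ] U₂}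
    (h : ∀ v, g (α v) = α (f v)) (t : ℂ) (v : U₁) :
    interp g t (α v) = α (interp f t v) := by
  simp [interp_apply, h]

/-- An isometry commuting with `α` and `β` that does not have the eigenvalue `-1` lies in the image
of the identity component: it is joined to the identity by the Cayley transform. -/
theorem mem_neutralImage_of_eigenvalue (hQ₁ : (QuadraticMap.polarBilin Q₁).Nondegenerate)
    (hQ₂ : (QuadraticMap.polarBilin Q₂).Nondegenerate)
    {h : (Module.End ℂ U₁)ˣ × (Module.End ℂ U₂)ˣ} (hh : h ∈ isometryCentralizer Q₁ Q₂ α β)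
    (h1 : ∀ v, h.1.val v = -v → v = 0) (h2 : ∀ v, h.2.val v = -v → v = 0) :
    h ∈ neutralImage Q₁ Q₂ α β := by
  obtain ⟨i1, i2, i3, i4⟩ := hh
  -- The finitely many parameters at which one of the four interpolations is singular. The
  -- complement of a finite set in the complex plane is connected, which a real path could not
  -- guarantee.
  set Z : Set ℂ := ({t | LinearMap.det (interp h.1.val t) = 0} ∪
    {t | LinearMap.det (interp h.1.val (1 - t)) = 0}) ∪
    ({t | LinearMap.det (interp h.2.val t) = 0} ∪
    {t | LinearMap.det (interp h.2.val (1 - t)) = 0}) with hZ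
  have hfin : Z.Finite := by
    have hinj : ∀ s : Set ℂ, Set.InjOn (fun t : ℂ => 1 - t) s :=
      fun s => (sub_right_injective (b := (1 : ℂ))).injOn
    exact ((finite_det_interp_eq_zero _).union
      ((finite_det_interp_eq_zero h.1.val).preimage (hinj _))).union
      ((finite_det_interp_eq_zero _).union
      ((finite_det_interp_eq_zero h.2.val).preimage (hinj _)))
  have hconn : IsConnected Zᶜ := hfin.countable.isConnected_compl_of_one_lt_rank (by simp)
  have hopen : IsOpen Zᶜ := hfin.isClosed.isOpen_compl
  have : PreconnectedSpace (Zᶜ : Set ℂ) :=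
    isPreconnected_iff_preconnectedSpace.1 hconn.isPreconnected
  have : LocallyConnectedSpace (Zᶜ : Set ℂ) := hopen.locallyConnectedSpace
  have d1 : ∀ x : (Zᶜ : Set ℂ), LinearMap.det (interp h.1.val x) ≠ 0 :=
    fun x hx => x.2 (.inl (.inl hx))
  have d1' : ∀ x : (Zᶜ : Set ℂ), LinearMap.det (interp h.1.val (1 - x)) ≠ 0 :=
    fun x hx => x.2 (.inl (.inr hx))
  have d2 : ∀ x : (Zᶜ : Set ℂ), LinearMap.det (interp h.2.val x) ≠ 0 :=
    fun x hx => x.2 (.inr (.inl hx))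
  have d2' : ∀ x : (Zᶜ : Set ℂ), LinearMap.det (interp h.2.val (1 - x)) ≠ 0 :=
    fun x hx => x.2 (.inr (.inr hx))
  have m0 : (0 : ℂ) ∈ Zᶜ := by
    rintro ((h0 | h0) | (h0 | h0))
    · exact (det_interp_zero h.1).1 h0
    · exact (det_interp_zero h.1).2 h0
    · exact (det_interp_zero h.2).1 h0
    · exact (det_interp_zero h.2).2 h0
  have e12 : (1 - 2⁻¹ : ℂ) = 2⁻¹ := by norm_num
  have mh : (2⁻¹ : ℂ) ∈ Zᶜ := by
    rintro ((h0 | h0) | (h0 | h0))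
    · exact det_interp_half h.1 h1 h0
    · rw [Set.mem_ofPred_eq, e12] at h0; exact det_interp_half h.1 h1 h0
    · exact det_interp_half h.2 h2 h0
    · rw [Set.mem_ofPred_eq, e12] at h0; exact det_interp_half h.2 h2 h0
  -- This family is `h` at `t = 0` and the identity at `t = 1/2`; the absence of the eigenvalue -1
  -- is what makes 1/2 admissible.
  set γ : (Zᶜ : Set ℂ) → (Module.End ℂ U₁)ˣ × (Module.End ℂ U₂)ˣ := fun x =>
    (interpUnit _ _ (d1' x) * (interpUnit _ _ (d1 x))⁻¹,
      interpUnit _ _ (d2' x) * (interpUnit _ _ (d2 x))⁻¹) with hγ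
  have hinv1 : ∀ (x : (Zᶜ : Set ℂ)) v,
      interp h.1.val x ((interpUnit _ _ (d1 x))⁻¹.val v) = v := fun x v => by
    rw [← coe_interpUnit _ _ (d1 x), ← Module.End.mul_apply, Units.mul_inv, Module.End.one_apply]
  have hinv2 : ∀ (x : (Zᶜ : Set ℂ)) v,
      interp h.2.val x ((interpUnit _ _ (d2 x))⁻¹.val v) = v := fun x v => by
    rw [← coe_interpUnit _ _ (d2 x), ← Module.End.mul_apply, Units.mul_inv, Module.End.one_apply]
  have hinv1' : ∀ (x : (Zᶜ : Set ℂ)) v,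
      (interpUnit _ _ (d1 x))⁻¹.val (interp h.1.val x v) = v := fun x v => by
    rw [← coe_interpUnit _ _ (d1 x), ← Module.End.mul_apply, Units.inv_mul, Module.End.one_apply]
  have hinv2' : ∀ (x : (Zᶜ : Set ℂ)) v,
      (interpUnit _ _ (d2 x))⁻¹.val (interp h.2.val x v) = v := fun x v => by
    rw [← coe_interpUnit _ _ (d2 x), ← Module.End.mul_apply, Units.inv_mul, Module.End.one_apply]
  have hcα : ∀ (x : (Zᶜ : Set ℂ)) v,
      (interpUnit _ _ (d2 x))⁻¹.val (α v) = α ((interpUnit _ _ (d1 x))⁻¹.val v) := by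
    intro x v
    conv_lhs => rw [← hinv1 x v]
    rw [← interp_comp i3, hinv2']
  have hcβ : ∀ (x : (Zᶜ : Set ℂ)) v,
      (interpUnit _ _ (d1 x))⁻¹.val (β v) = β ((interpUnit _ _ (d2 x))⁻¹.val v) := by
    intro x v
    conv_lhs => rw [← hinv2 x v]
    rw [← interp_comp i4, hinv1']
  have hg : γ ⟨0, m0⟩ = h := by
    apply Prod.ext
    · simp only [hγ]
      rw [mul_inv_eq_iff_eq_mul]
      apply Units.ext
      simp [interp]
    · simp only [hγ]
      rw [mul_inv_eq_iff_eq_mul]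
      apply Units.ext
      simp [interp]
  have hg1 : γ ⟨2⁻¹, mh⟩ = 1 := by
    apply Prod.ext
    · simp only [hγ, Prod.fst_one]
      rw [mul_inv_eq_one]
      apply Units.ext
      simp [e12]
    · simp only [hγ, Prod.snd_one]
      rw [mul_inv_eq_one]
      apply Units.ext
      simp [e12]
  rw [← hg]
  refine mem_neutralImage_of_family hQ₁ hQ₂ (γ := γ) (fun x => ?_) (fun v l => ?_) (fun v l => ?_)
    hg1 _
  · refine ⟨fun u => ?_, fun v => ?_, fun u => ?_, fun v => ?_⟩ <;>
      simp only [hγ, Units.val_mul, Module.End.mul_apply, coe_interpUnit]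
    · rw [interp_isometry i1, hinv1]
    · rw [interp_isometry i2, hinv2]
    · rw [hcα, interp_comp i3]
    · rw [hcβ, interp_comp i4]
  · have c1 := continuous_interpUnit_inv h.1.val continuous_subtype_val d1 v l
    have c2 := continuous_interpUnit_inv h.1.val continuous_subtype_val d1 v (l ∘ₗ h.1.val)
    simp only [hγ, Units.val_mul, Module.End.mul_apply, coe_interpUnit, interp_apply, map_add,
      map_smul, smul_eq_mul]
    have cx : Continuous fun x : (Zᶜ : Set ℂ) => 1 - (x : ℂ) :=
      continuous_const.sub continuous_subtype_val
    exact Continuous.fun_add (Continuous.fun_mul (continuous_const.sub cx) c1)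
      (Continuous.fun_mul cx c2)
  · have c1 := continuous_interpUnit_inv h.2.val continuous_subtype_val d2 v l
    have c2 := continuous_interpUnit_inv h.2.val continuous_subtype_val d2 v (l ∘ₗ h.2.val)
    simp only [hγ, Units.val_mul, Module.End.mul_apply, coe_interpUnit, interp_apply, map_add,
      map_smul, smul_eq_mul]
    have cx : Continuous fun x : (Zᶜ : Set ℂ) => 1 - (x : ℂ) :=
      continuous_const.sub continuous_subtype_val
    exact Continuous.fun_add (Continuous.fun_mul (continuous_const.sub cx) c1)
      (Continuous.fun_mul cx c2)

end CayleyPair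

/-! ### Removing the eigenvalue -1 by sign changes -/

section SignMatrices

/-- The sign of a unit of `ℤ` as a complex number. -/
def sg (u : ℤˣ) : ℂ := ((u : ℤ) : ℂ)

@[simp] theorem sg_one : sg 1 = 1 := by simp [sg]

@[simp] theorem sg_neg_one : sg (-1) = -1 := by simp [sg]

theorem sg_mul (u v : ℤˣ) : sg (u * v) = sg u * sg v := by simp [sg]

@[simp] theorem sg_mul_self (u : ℤˣ) : sg u * sg u = 1 := by
  rw [← sg_mul, Int.units_mul_self, sg_one]

/-- The rows of the identity are replaced one at a time by rows of `M + D`. By linearity in row `a`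
the new determinant is a constant plus `±det R` with `det R ≠ 0`, so it cannot vanish for both
signs. -/
theorem exists_sign_updateRow {n : Type*} [Fintype n] [DecidableEq n] (M : Matrix n n ℂ)
    (s : Finset n) : ∃ D : n → ℤˣ,
      (Matrix.of fun i => if i ∈ s then M i + sg (D i) • Pi.single i 1 else Pi.single i 1).det ≠ 0 := by
  induction s using Finset.induction_on with
  | empty =>
    refine ⟨1, ?_⟩
    have : (Matrix.of fun i : n => if i ∈ (∅ : Finset n) then M i + sg ((1 : n → ℤˣ) i) •
        Pi.single i (1 : ℂ) else Pi.single i 1) = (1 : Matrix n n ℂ) := by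
      ext i j
      simp [Matrix.one_apply, Pi.single_apply, eq_comm]
    rw [this, Matrix.det_one]
    exact one_ne_zero
  | insert a s ha ih =>
    obtain ⟨D, hD⟩ := ih
    set R : Matrix n n ℂ :=
      Matrix.of fun i => if i ∈ s then M i + sg (D i) • Pi.single i 1 else Pi.single i 1 with hR
    have hup : ∀ e : ℤˣ, (Matrix.of fun i => if i ∈ insert a s then
        M i + sg (Function.update D a e i) • Pi.single i (1 : ℂ) else Pi.single i 1) =
        R.updateRow a (M a + sg e • Pi.single a 1) := by
      intro e
      ext i j
      by_cases hi : i = a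
      · subst hi; simp
      · simp [hR, hi]
    have hRa : R.updateRow a (Pi.single a 1) = R := by
      ext i j
      by_cases hi : i = a
      · subst hi; simp [hR, ha]
      · rw [Matrix.updateRow_ne hi]
    have hdet : ∀ e : ℤˣ, (R.updateRow a (M a + sg e • Pi.single a 1)).det =
        (R.updateRow a (M a)).det + sg e * R.det := by
      intro e
      rw [Matrix.det_updateRow_add, Matrix.det_updateRow_smul, hRa]
    by_cases h1 : (R.updateRow a (M a)).det + R.det = 0
    · refine ⟨Function.update D a (-1), ?_⟩
      rw [hup, hdet]
      intro h2
      apply hD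
      rw [sg_neg_one] at h2
      linear_combination h1 / 2 - h2 / 2
    · refine ⟨Function.update D a 1, ?_⟩
      rw [hup, hdet, sg_one, one_mul]
      exact h1

/-- Any square matrix becomes free of the eigenvalue `-1` after changing signs of columns. -/
theorem exists_sign_no_eigenvalue {n : Type*} [Fintype n] [DecidableEq n] (M : Matrix n n ℂ) :
    ∃ D : n → ℤˣ, ∀ x : n → ℂ, (∀ i, ∑ j, M i j * (sg (D j) * x j) = -x i) → x = 0 := by
  obtain ⟨D, hD⟩ := exists_sign_updateRow M Finset.univ
  refine ⟨D, fun x hx => ?_⟩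
  -- In terms of `z = D x` the equation `M D x = -x` becomes `(M + D) z = 0`, because `D` is its own
  -- inverse.
  set z : n → ℂ := fun j => sg (D j) * x j with hz
  have hxz : ∀ j, x j = sg (D j) * z j := by
    intro j; simp only [hz]; rw [← mul_assoc, sg_mul_self, one_mul]
  have h1 := Matrix.eq_zero_of_mulVec_eq_zero hD (v := z) (by
    ext i
    simp only [Finset.mem_univ, if_true, Matrix.mulVec, dotProduct, Matrix.of_apply, Pi.add_apply,
      Pi.smul_apply, add_mul, Finset.sum_add_distrib, smul_eq_mul, Pi.zero_apply]
    rw [show ∑ j, M i j * z j = -x i from hx i, hxz i]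
    simp [Pi.single_apply])
  ext j
  rw [hxz j, h1]; simp

end SignMatrices

/-! ### Coordinates and sign changes in a Witt frame -/

section WittFrames

variable {V : Type*} [AddCommGroup V] [Module ℂ V] {Q : QuadraticForm ℂ V} {H L : Type*}
  [DecidableEq H]

namespace WittFrame

variable (F : WittFrame Q H L)

/-- The first vector of a hyperbolic pair. -/
def x (i : H) : V := F.basis (.inl i)
/-- The second vector of a hyperbolic pair. -/
def y (i : H) : V := F.basis (.inr (.inl i))
/-- The non-isotropic vectors. -/
def l (j : L) : V := F.basis (.inr (.inr j))

theorem Q_x (i : H) : Q (F.x i) = 0 := by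
  have := F.polar_xx i i
  rw [QuadraticMap.polar_self, two_smul, ← two_mul] at this
  exact (mul_eq_zero.1 this).resolve_left two_ne_zero

theorem Q_y (i : H) : Q (F.y i) = 0 := by
  have := F.polar_yy i i
  rw [QuadraticMap.polar_self, two_smul, ← two_mul] at this
  exact (mul_eq_zero.1 this).resolve_left two_ne_zero

theorem polar_x_y (i : H) : QuadraticMap.polar Q (F.x i) (F.y i) = 1 :=
  (F.polar_xy i i).trans (if_pos rfl)

theorem polar_xy' (i j : H) : QuadraticMap.polar Q (F.x i) (F.y j) = if i = j then 1 else 0 :=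
  F.polar_xy i j

theorem polar_yx' (i j : H) : QuadraticMap.polar Q (F.y i) (F.x j) = if j = i then 1 else 0 := by
  rw [QuadraticMap.polar_comm]; exact F.polar_xy j i

theorem ext_iff_basis {W : Type*} [AddCommGroup W] [Module ℂ W] {f g : V →ₗ[ℂ] W}
    (hx : ∀ i, f (F.x i) = g (F.x i)) (hy : ∀ i, f (F.y i) = g (F.y i))
    (hl : ∀ j, f (F.l j) = g (F.l j)) : f = g := by
  refine F.basis.ext ?_
  rintro (i | i | j)
  exacts [hx i, hy i, hl j]

theorem repr_x (v : V) (i : H) : F.basis.repr v (.inl i) = QuadraticMap.polar Q v (F.y i) := by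
  have : F.basis.coord (.inl i) = (QuadraticMap.polarBilin Q).flip (F.y i) := by
    apply F.ext_iff_basis
    · intro j
      rw [Module.Basis.coord_apply, LinearMap.flip_apply, QuadraticMap.polarBilin_apply_apply,
        F.polar_xy', x, Module.Basis.repr_self]
      by_cases h : j = i
      · subst h; simp
      · simp [h]
    · intro j
      simp [y, F.polar_yy]
    · intro j
      simp only [l, y, Module.Basis.coord_apply, Module.Basis.repr_self, LinearMap.flip_apply,
        QuadraticMap.polarBilin_apply_apply]
      rw [QuadraticMap.polar_comm, F.polar_yl]
      simp
  exact LinearMap.congr_fun this v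

theorem repr_y (v : V) (i : H) :
    F.basis.repr v (.inr (.inl i)) = QuadraticMap.polar Q v (F.x i) := by
  have : F.basis.coord (.inr (.inl i)) = (QuadraticMap.polarBilin Q).flip (F.x i) := by
    apply F.ext_iff_basis
    · intro j
      simp [x, F.polar_xx]
    · intro j
      rw [Module.Basis.coord_apply, LinearMap.flip_apply, QuadraticMap.polarBilin_apply_apply,
        F.polar_yx', y, Module.Basis.repr_self]
      by_cases h : i = j
      · subst h; simp
      · simp [h]
    · intro j
      simp only [l, x, Module.Basis.coord_apply, Module.Basis.repr_self, LinearMap.flip_apply,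
        QuadraticMap.polarBilin_apply_apply]
      rw [QuadraticMap.polar_comm, F.polar_xl]
      simp
  exact LinearMap.congr_fun this v

theorem sum_repr [Fintype H] [Fintype L] (v : V) :
    ∑ i, F.basis.repr v (.inl i) • F.x i + (∑ i, F.basis.repr v (.inr (.inl i)) • F.y i +
      ∑ j, F.basis.repr v (.inr (.inr j)) • F.l j) = v := by
  conv_rhs => rw [← F.basis.sum_repr v]
  rw [Fintype.sum_sum_type, Fintype.sum_sum_type]
  rfl

/-- The signs attached to the vectors of a frame: the two vectors of a hyperbolic pair get the same
sign. -/
def weight (s : (H → ℤˣ) × (L → ℤˣ)) : H ⊕ H ⊕ L → ℤˣ := Sum.elim s.1 (Sum.elim s.1 s.2)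

/-- Sign changes of the vectors of a frame. -/
def sign : (H → ℤˣ) × (L → ℤˣ) →* Module.End ℂ V where
  toFun s := F.basis.constr ℂ fun j => sg (weight s j) • F.basis j
  map_one' := by
    refine F.basis.ext ?_
    rintro (i | i | j) <;> simp [weight]
  map_mul' s t := by
    refine F.basis.ext ?_
    rintro (i | i | j) <;> simp [weight, sg_mul, smul_smul, mul_comm]

@[simp] theorem sign_x (s : (H → ℤˣ) × (L → ℤˣ)) (i : H) :
    F.sign s (F.x i) = sg (s.1 i) • F.x i := by simp [sign, x, weight]

@[simp] theorem sign_y (s : (H → ℤˣ) × (L → ℤˣ)) (i : H) :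
    F.sign s (F.y i) = sg (s.1 i) • F.y i := by simp [sign, y, weight]

@[simp] theorem sign_l (s : (H → ℤˣ) × (L → ℤˣ)) (j : L) :
    F.sign s (F.l j) = sg (s.2 j) • F.l j := by simp [sign, l, weight]

/-- Two frame vectors with nonzero pairing are either equal or form a hyperbolic pair, and so carry
the same sign. -/
theorem polar_sign (s : (H → ℤˣ) × (L → ℤˣ)) (u v : V) :
    QuadraticMap.polar Q (F.sign s u) (F.sign s v) = QuadraticMap.polar Q u v := by
  have : (QuadraticMap.polarBilin Q).compl₁₂ (F.sign s) (F.sign s) = QuadraticMap.polarBilin Q := by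
    have key : ∀ i j, sg (weight s i) * (sg (weight s j) *
        QuadraticMap.polar Q (F.basis i) (F.basis j)) =
        QuadraticMap.polar Q (F.basis i) (F.basis j) := by
      rintro (i | i | i) (j | j | j)
      · simp [F.polar_xx]
      · by_cases h : i = j
        · subst h; simp [weight, F.polar_xy]
        · simp [F.polar_xy, h]
      · simp [F.polar_xl]
      · rw [QuadraticMap.polar_comm]
        by_cases h : j = i
        · subst h; simp [weight, F.polar_xy]
        · simp [F.polar_xy, h]
      · simp [F.polar_yy]
      · simp [F.polar_yl]
      · rw [QuadraticMap.polar_comm]; simp [F.polar_xl]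
      · rw [QuadraticMap.polar_comm]; simp [F.polar_yl]
      · by_cases h : i = j
        · subst h; rw [← mul_assoc]; simp [weight]
        · simp [F.polar_ll _ _ h]
    refine F.basis.ext fun i => F.basis.ext fun j => ?_
    simp only [sign, MonoidHom.coe_mk, OneHom.coe_mk, LinearMap.compl₁₂_apply,
      Module.Basis.constr_basis, map_smul, LinearMap.smul_apply, smul_eq_mul,
      QuadraticMap.polarBilin_apply_apply]
    rw [mul_left_comm]
    exact key i j
  exact LinearMap.congr_fun (LinearMap.congr_fun this u) v

theorem Q_sign (s : (H → ℤˣ) × (L → ℤˣ)) (v : V) : Q (F.sign s v) = Q v := by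
  have := F.polar_sign s v v
  rw [QuadraticMap.polar_self, QuadraticMap.polar_self, two_smul, two_smul, ← two_mul,
    ← two_mul] at this
  exact mul_left_cancel₀ two_ne_zero this

end WittFrame

end WittFrames

/-! ### Frames adapted to the Jordan strings -/

section AdaptedFrames

variable {U₁ U₂ : Type*} [AddCommGroup U₁] [Module ℂ U₁] [AddCommGroup U₂] [Module ℂ U₂]
  {Q₁ : QuadraticForm ℂ U₁} {Q₂ : QuadraticForm ℂ U₂} {α : U₁ →ₗ[ℂ] U₂} {β : U₂ →ₗ[ℂ] U₁}

/-- Frames of the two spaces that consist of Jordan strings: one string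
`x none ↦ l none ↦ y none` of length three, strings `x (some i) ↦ x i` and `-y i ↦ y (some i)` of
length two, and strings `l j` and `l (some j)` of length one. -/
structure AdaptedFrame (Q₁ : QuadraticForm ℂ U₁) (Q₂ : QuadraticForm ℂ U₂) (α : U₁ →ₗ[ℂ] U₂)
    (β : U₂ →ₗ[ℂ] U₁) (k c d : ℕ) where
  /-- The frame of the first space. -/
  fr₁ : WittFrame Q₁ (Option (Fin k)) (Fin c)
  /-- The frame of the second space. -/
  fr₂ : WittFrame Q₂ (Fin k) (Option (Fin d))
  skew : ∀ u v, QuadraticMap.polar Q₂ (α u) v = -QuadraticMap.polar Q₁ u (β v)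
  α_x_none : α (fr₁.x none) = fr₂.l none
  α_x_some : ∀ i, α (fr₁.x (some i)) = fr₂.x i
  α_y : ∀ i, α (fr₁.y i) = 0
  α_l : ∀ i, α (fr₁.l i) = 0
  β_x : ∀ i, β (fr₂.x i) = 0
  β_y : ∀ i, β (fr₂.y i) = -fr₁.y (some i)
  β_l_none : β (fr₂.l none) = fr₁.y none
  β_l_some : ∀ j, β (fr₂.l (some j)) = 0

namespace AdaptedFrame

variable {k c d : ℕ} (A : AdaptedFrame Q₁ Q₂ α β k c d)

/-- The sign changes of an adapted frame that commute with `α` and `β`. -/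
def signPair : (Option (Fin k) → ℤˣ) × (Fin c → ℤˣ) × (Fin d → ℤˣ) →*
    (Module.End ℂ U₁)ˣ × (Module.End ℂ U₂)ˣ :=
  MonoidHom.prod
    (MonoidHom.toHomUnits
      { toFun := fun s => A.fr₁.sign (s.1, s.2.1)
        map_one' := A.fr₁.sign.map_one
        map_mul' := fun s t => A.fr₁.sign.map_mul (s.1, s.2.1) (t.1, t.2.1) })
    (MonoidHom.toHomUnits
      -- Commutation leaves no choice on the strings: `x i` and `y i` inherit the sign of string `i`
      -- of length two, and `l none` that of the string of length three.
      { toFun := fun s => A.fr₂.sign (s.1 ∘ some, fun o => o.elim (s.1 none) s.2.2)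
        map_one' := by
          have : (((1 : (Option (Fin k) → ℤˣ) × (Fin c → ℤˣ) × (Fin d → ℤˣ)).1 ∘ some,
              fun o : Option (Fin d) => o.elim (1 : ℤˣ) 1) :
              (Fin k → ℤˣ) × (Option (Fin d) → ℤˣ)) = 1 :=
            Prod.ext rfl (funext fun o => by cases o <;> rfl)
          exact (congrArg A.fr₂.sign this).trans (map_one _)
        map_mul' := fun s t => by
          rw [← map_mul]
          congr 1
          ext1
          · rfl
          · funext o; cases o <;> rfl })

theorem signPair_fst (s : (Option (Fin k) → ℤˣ) × (Fin c → ℤˣ) × (Fin d → ℤˣ)) :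
    (A.signPair s).1.val = A.fr₁.sign (s.1, s.2.1) := rfl

theorem signPair_snd (s : (Option (Fin k) → ℤˣ) × (Fin c → ℤˣ) × (Fin d → ℤˣ)) :
    (A.signPair s).2.val = A.fr₂.sign (s.1 ∘ some, fun o => o.elim (s.1 none) s.2.2) := rfl

theorem signPair_mem (s : (Option (Fin k) → ℤˣ) × (Fin c → ℤˣ) × (Fin d → ℤˣ)) :
    A.signPair s ∈ isometryCentralizer Q₁ Q₂ α β := by
  refine ⟨fun u => A.fr₁.Q_sign _ u, fun v => A.fr₂.Q_sign _ v, fun u => ?_, fun v => ?_⟩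
  · rw [signPair_fst, signPair_snd]
    refine LinearMap.congr_fun (f := (A.fr₂.sign _) ∘ₗ α) (g := α ∘ₗ (A.fr₁.sign _))
      (A.fr₁.ext_iff_basis ?_ ?_ ?_) u
    · rintro (_ | i) <;> simp [A.α_x_none, A.α_x_some]
    · rintro i; simp [A.α_y]
    · rintro j; simp [A.α_l]
  · rw [signPair_fst, signPair_snd]
    refine LinearMap.congr_fun (f := (A.fr₁.sign _) ∘ₗ β) (g := β ∘ₗ (A.fr₂.sign _))
      (A.fr₂.ext_iff_basis ?_ ?_ ?_) v
    · rintro i; simp [A.β_x]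
    · rintro i; simp [A.β_y]
    · rintro (_ | j) <;> simp [A.β_l_none, A.β_l_some]

end AdaptedFrame

end AdaptedFrames

/-! ### Reducing commuting isometries to sign changes -/

namespace AdaptedFrame

variable {U₁ U₂ : Type*} [AddCommGroup U₁] [Module ℂ U₁] [AddCommGroup U₂] [Module ℂ U₂]
  {Q₁ : QuadraticForm ℂ U₁} {Q₂ : QuadraticForm ℂ U₂} {α : U₁ →ₗ[ℂ] U₂} {β : U₂ →ₗ[ℂ] U₁}
  {k c d : ℕ} (A : AdaptedFrame Q₁ Q₂ α β k c d)

theorem α_apply (u : U₁) : α u = A.fr₁.basis.repr u (.inl none) • A.fr₂.l none +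
    ∑ i, A.fr₁.basis.repr u (.inl (some i)) • A.fr₂.x i := by
  conv_lhs => rw [← A.fr₁.sum_repr u]
  simp [A.α_x_none, A.α_x_some, A.α_y, A.α_l, Fintype.sum_option]

theorem β_apply (v : U₂) : β v = A.fr₂.basis.repr v (.inr (.inr none)) • A.fr₁.y none -
    ∑ i, A.fr₂.basis.repr v (.inr (.inl i)) • A.fr₁.y (some i) := by
  conv_lhs => rw [← A.fr₂.sum_repr v]
  simp [A.β_x, A.β_y, A.β_l_none, A.β_l_some, Fintype.sum_option]
  abel

/-- The composite `β ∘ α` has rank one. Its image is an intrinsic line, and its kernel singles out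
the string of length three. -/
theorem β_α (u : U₁) : β (α u) = A.fr₁.basis.repr u (.inl none) • A.fr₁.y none := by
  rw [A.α_apply]
  simp [A.β_l_none, A.β_x]

theorem α_mem_span (u : U₁) (h : A.fr₁.basis.repr u (.inl none) = 0) :
    α u ∈ Submodule.span ℂ (Set.range A.fr₂.x) := by
  rw [A.α_apply, h, zero_smul, zero_add]
  exact Submodule.sum_mem _ fun i _ => Submodule.smul_mem _ _ (Submodule.subset_span ⟨i, rfl⟩)

theorem y_ne_zero (i) : A.fr₁.y i ≠ 0 := A.fr₁.basis.ne_zero _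

theorem repr_eq_zero {u : U₁} (h : β (α u) = 0) : A.fr₁.basis.repr u (.inl none) = 0 := by
  rw [A.β_α] at h
  exact (smul_eq_zero.1 h).resolve_right (A.y_ne_zero _)

theorem y_mem_range (i : Option (Fin k)) : A.fr₁.y i ∈ LinearMap.range β := by
  cases i with
  | none => exact ⟨_, A.β_l_none⟩
  | some i => exact ⟨-A.fr₂.y i, by rw [map_neg, A.β_y, neg_neg]⟩

variable {h : (Module.End ℂ U₁)ˣ × (Module.End ℂ U₂)ˣ}

/-- `h` commutes with `β ∘ α`; this is that relation evaluated at `x none`. -/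
theorem map_y_none (hh : h ∈ isometryCentralizer Q₁ Q₂ α β) :
    h.1.val (A.fr₁.y none) =
      A.fr₁.basis.repr (h.1.val (A.fr₁.x none)) (.inl none) • A.fr₁.y none := by
  rw [← A.β_α, ← hh.2.2.1, ← hh.2.2.2, A.α_x_none, A.β_l_none]

theorem polar_isometry (hh : h ∈ isometryCentralizer Q₁ Q₂ α β) (u v : U₁) :
    QuadraticMap.polar Q₁ (h.1.val u) (h.1.val v) = QuadraticMap.polar Q₁ u v := by
  rw [QuadraticMap.polar, ← map_add, hh.1, hh.1, hh.1, QuadraticMap.polar]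

/-- The eigenvalue at `y none` is also the coefficient of `x none` in the image of `x none`, so
preserving the pairing of these two vectors forces its square to be 1. -/
theorem exists_sign_y_none (hh : h ∈ isometryCentralizer Q₁ Q₂ α β) :
    ∃ ε : ℤˣ, h.1.val (A.fr₁.y none) = sg ε • A.fr₁.y none := by
  have h1 := A.map_y_none hh
  have h2 := polar_isometry hh (A.fr₁.x none) (A.fr₁.y none)
  set e := A.fr₁.basis.repr (h.1.val (A.fr₁.x none)) (.inl none)
  rw [h1, QuadraticMap.polar_smul_right, ← A.fr₁.repr_x, A.fr₁.polar_x_y, smul_eq_mul] at h2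
  rcases mul_self_eq_one_iff.1 h2 with h3 | h3
  · exact ⟨1, by rw [h1, sg_one, h3]⟩
  · exact ⟨-1, by rw [h1, sg_neg_one, h3]⟩

/-- The span of the `x i` is the image under `α` of the kernel of `β ∘ α`, hence is invariant. -/
theorem map_x_mem (hh : h ∈ isometryCentralizer Q₁ Q₂ α β) (i : Fin k) :
    h.2.val (A.fr₂.x i) ∈ Submodule.span ℂ (Set.range A.fr₂.x) := by
  rw [← A.α_x_some, hh.2.2.1]
  apply A.α_mem_span
  apply A.repr_eq_zero
  rw [← hh.2.2.1, ← hh.2.2.2, A.α_x_some, A.β_x, map_zero]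

theorem map_y_mem (hh : h ∈ isometryCentralizer Q₁ Q₂ α β) (i : Option (Fin k)) :
    h.1.val (A.fr₁.y i) ∈ LinearMap.range β := by
  obtain ⟨w, hw⟩ := A.y_mem_range i
  exact ⟨h.2.val w, by rw [← hh.2.2.2, hw]⟩

theorem repr_range (w : U₂) (j : Fin c) : A.fr₁.basis.repr (β w) (.inr (.inr j)) = 0 := by
  rw [A.β_apply]
  simp [WittFrame.y]

theorem repr_span {w : U₂} (hw : w ∈ Submodule.span ℂ (Set.range A.fr₂.x)) (j : Option (Fin d)) :
    A.fr₂.basis.repr w (.inr (.inr j)) = 0 := by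
  have : Submodule.span ℂ (Set.range A.fr₂.x) ≤ LinearMap.ker (A.fr₂.basis.coord (.inr (.inr j))) := by
    rw [Submodule.span_le]
    rintro _ ⟨i, rfl⟩
    simp [WittFrame.x]
  exact this hw

/-- The eigenvalue -1 is excluded on the pieces of an invariant filtration. The hypotheses treat `y
none`, the span of the `x i`, ker α / range β, and ker β modulo that span. Range β needs no
hypothesis of its own: by skewness it is paired with range α. -/
theorem no_eigenvalue [FiniteDimensional ℂ U₂] (hQ₁ : (QuadraticMap.polarBilin Q₁).Nondegenerate)
    (hh : h ∈ isometryCentralizer Q₁ Q₂ α β) (hy : h.1.val (A.fr₁.y none) = A.fr₁.y none)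
    (hM : ∀ w ∈ Submodule.span ℂ (Set.range A.fr₂.x), h.2.val w = -w → w = 0)
    (hA : ∀ u, α u = 0 → h.1.val u + u ∈ LinearMap.range β → u ∈ LinearMap.range β)
    (hB : ∀ v, β v = 0 → h.2.val v + v ∈ Submodule.span ℂ (Set.range A.fr₂.x) →
      v ∈ Submodule.span ℂ (Set.range A.fr₂.x)) :
    (∀ u, h.1.val u = -u → u = 0) ∧ ∀ v, h.2.val v = -v → v = 0 := by
  have key : ∀ u, h.2.val (α u) = -α u → α u = 0 := by
    intro u hu
    refine hM _ (A.α_mem_span u (A.repr_eq_zero ?_)) hu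
    have h1 := hh.2.2.2 (α u)
    rw [hu, map_neg, A.β_α, map_smul, hy] at h1
    rw [A.β_α]
    have h2 : (2 : ℂ) • (A.fr₁.basis.repr u (.inl none) • A.fr₁.y none) = 0 := by
      rw [two_smul]
      nth_rewrite 1 [h1]
      exact neg_add_cancel _
    exact (smul_eq_zero.1 h2).resolve_left two_ne_zero
  have hU₁ : ∀ u, h.1.val u = -u → u = 0 := by
    intro u hu
    have h1 : α u = 0 := key u (by rw [hh.2.2.1, hu, map_neg])
    obtain ⟨w, rfl⟩ := hA u h1 (by rw [hu, neg_add_cancel]; exact zero_mem _)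
    -- An eigenvector for -1 is orthogonal to the image of `h + 1`. On range α the map `h + 1` is
    -- injective, hence surjective, so every `u` agrees modulo ker α with an element of that image;
    -- since ker α is orthogonal to range β, the vector `β w` is orthogonal to everything.
    have h2 : ∀ u, QuadraticMap.polar Q₁ (h.1.val u + u) (β w) = 0 := by
      intro u
      have := polar_isometry hh u (β w)
      rw [hu, QuadraticMap.polar_neg_right] at this
      rw [QuadraticMap.polar_add_left, ← this]
      ring
    have h3 : ∀ x : LinearMap.range α, (h.2.val + 1) x ∈ LinearMap.range α := by
      rintro ⟨_, u, rfl⟩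
      exact ⟨h.1.val u + u, by
        rw [map_add, ← hh.2.2.1, LinearMap.add_apply, Module.End.one_apply]⟩
    have h4 : Function.Injective ((h.2.val + 1).restrict (fun x hx => h3 ⟨x, hx⟩)) := by
      rw [← LinearMap.ker_eq_bot, LinearMap.ker_eq_bot']
      rintro ⟨_, u, rfl⟩ h5
      have h6 := congrArg Subtype.val h5
      rw [LinearMap.coe_restrict_apply, LinearMap.add_apply, Module.End.one_apply] at h6
      exact Subtype.ext (key u (eq_neg_of_add_eq_zero_left h6))
    have h5 := LinearMap.surjective_of_injective h4
    refine hQ₁.2 _ fun u => ?_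
    obtain ⟨⟨_, u', rfl⟩, hu'⟩ := h5 ⟨α u, u, rfl⟩
    have h6 : _ = α u := congrArg Subtype.val hu'
    rw [LinearMap.coe_restrict_apply, LinearMap.add_apply, Module.End.one_apply, hh.2.2.1,
      ← map_add] at h6
    have h7 := h2 u'
    rw [QuadraticMap.polarBilin_apply_apply, ← neg_eq_zero, ← A.skew, ← h6, A.skew, h7, neg_zero]
  refine ⟨hU₁, fun v hv => ?_⟩
  have h1 : β v = 0 := hU₁ _ (by rw [hh.2.2.2, hv, map_neg])
  exact hM v (hB v h1 (by rw [hv, neg_add_cancel]; exact zero_mem _)) hv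

/-- Every pair of isometries commuting with `α` and `β` lies in the neutral image after changing
signs of frame vectors. -/
theorem exists_signPair_mul_mem [FiniteDimensional ℂ U₁] [FiniteDimensional ℂ U₂]
    (hQ₁ : (QuadraticMap.polarBilin Q₁).Nondegenerate)
    (hQ₂ : (QuadraticMap.polarBilin Q₂).Nondegenerate)
    (hh : h ∈ isometryCentralizer Q₁ Q₂ α β) {ε : ℤˣ}
    (hε : h.1.val (A.fr₁.y none) = sg ε • A.fr₁.y none) :
    ∃ s, s.1 none = ε ∧ h * A.signPair s ∈ neutralImage Q₁ Q₂ α β := by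
  -- The signs are chosen independently on three pieces: the span of the `x i`, ker α / range β with
  -- basis `l j`, and ker β modulo that span with basis `l (some j)`. On `y none` the sign `ε`
  -- itself turns the eigenvalue into 1.
  obtain ⟨D, hD⟩ := exists_sign_no_eigenvalue (Matrix.of fun i j : Fin k =>
    A.fr₂.basis.repr (h.2.val (A.fr₂.x j)) (.inl i))
  obtain ⟨S, hS⟩ := exists_sign_no_eigenvalue (Matrix.of fun i j : Fin c =>
    A.fr₁.basis.repr (h.1.val (A.fr₁.l j)) (.inr (.inr i)))
  obtain ⟨T, hT⟩ := exists_sign_no_eigenvalue (Matrix.of fun i j : Fin d =>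
    A.fr₂.basis.repr (h.2.val (A.fr₂.l (some j))) (.inr (.inr (some i))))
  refine ⟨(fun o => o.elim ε D, S, T), rfl, ?_⟩
  set s : (Option (Fin k) → ℤˣ) × (Fin c → ℤˣ) × (Fin d → ℤˣ) := (fun o => o.elim ε D, S, T)
    with hs
  have hm : h * A.signPair s ∈ isometryCentralizer Q₁ Q₂ α β := mul_mem hh (A.signPair_mem s)
  have e1 : ∀ u, (h * A.signPair s).1.val u = h.1.val (A.fr₁.sign (s.1, s.2.1) u) := fun _ => rfl
  have e2 : ∀ u, (h * A.signPair s).2.val u =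
    h.2.val (A.fr₂.sign (s.1 ∘ some, fun o => o.elim (s.1 none) s.2.2) u) := fun _ => rfl
  have := A.no_eigenvalue hQ₁ hm ?_ ?_ ?_ ?_
  · exact mem_neutralImage_of_eigenvalue hQ₁ hQ₂ hm this.1 this.2
  · rw [e1, A.fr₁.sign_y, map_smul, hε, smul_smul]
    simp [hs]
  · intro w hw hw'
    obtain ⟨a, rfl⟩ := (Submodule.mem_span_range_iff_exists_fun ℂ).1 hw
    have : a = 0 := by
      refine hD a fun i => ?_
      have h1 := congrArg (fun z => A.fr₂.basis.repr z (.inl i)) hw'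
      simp only [e2, map_sum, map_smul, map_neg, WittFrame.sign_x, Finsupp.finsetSum_apply,
        Finsupp.smul_apply, Finsupp.neg_apply, smul_eq_mul] at h1
      rw [show ∑ j, a j * (A.fr₂.basis.repr (A.fr₂.x j)) (Sum.inl i) = a i by
        simp [WittFrame.x, Finsupp.single_apply]] at h1
      rw [← h1]
      refine Finset.sum_congr rfl fun j _ => ?_
      simp only [Matrix.of_apply, hs, Function.comp_apply, Option.elim_some]
      ring
    simp [this]
  · intro u hu hu'
    have hx0 : A.fr₁.basis.repr u (.inl none) = 0 :=
      A.repr_eq_zero (by rw [hu, map_zero])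
    have hx : ∀ i, A.fr₁.basis.repr u (.inl (some i)) = 0 := by
      intro i
      have h1 := congrArg (fun z => A.fr₂.basis.repr z (.inl i)) hu
      rw [A.α_apply, hx0, zero_smul, zero_add] at h1
      simpa [WittFrame.x, Finsupp.single_apply] using h1
    have hu2 := A.fr₁.sum_repr u
    simp only [Fintype.sum_option, hx0, hx, zero_smul, Finset.sum_const_zero, zero_add] at hu2
    rw [← Fintype.sum_option (f := fun i => A.fr₁.basis.repr u (.inr (.inl i)) • A.fr₁.y i)] at hu2
    set a : Fin c → ℂ := fun j => A.fr₁.basis.repr u (.inr (.inr j)) with ha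
    have hy : ∑ i, A.fr₁.basis.repr u (.inr (.inl i)) • A.fr₁.y i ∈ LinearMap.range β :=
      Submodule.sum_mem _ fun i _ => Submodule.smul_mem _ _ (A.y_mem_range i)
    have hy' : h.1.val (A.fr₁.sign (s.1, s.2.1)
        (∑ i, A.fr₁.basis.repr u (.inr (.inl i)) • A.fr₁.y i)) ∈ LinearMap.range β := by
      simp only [map_sum, map_smul, WittFrame.sign_y]
      exact Submodule.sum_mem _ fun i _ => Submodule.smul_mem _ _
        (Submodule.smul_mem _ _ (A.map_y_mem hh i))
    have ha0 : a = 0 := by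
      refine hS a fun i => ?_
      obtain ⟨w, hw⟩ := hu'
      obtain ⟨w', hw'⟩ := hy'
      have h1 := congrArg (fun z => A.fr₁.basis.repr z (.inr (.inr i))) hw
      simp only [A.repr_range, map_add, Finsupp.add_apply, e1] at h1
      rw [← hu2, map_add (A.fr₁.sign _), map_add h.1.val, ← hw', map_add, Finsupp.add_apply,
        A.repr_range, zero_add, hu2] at h1
      simp only [map_sum, map_smul, WittFrame.sign_l, Finsupp.finsetSum_apply,
        Finsupp.smul_apply, smul_eq_mul] at h1
      rw [eq_neg_iff_add_eq_zero, h1]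
      congr 1
      refine Finset.sum_congr rfl fun j _ => ?_
      simp only [Matrix.of_apply, hs, ha]
      ring
    rw [← hu2]
    refine add_mem hy ?_
    rw [show ∑ j, A.fr₁.basis.repr u (.inr (.inr j)) • A.fr₁.l j = 0 from
      Finset.sum_eq_zero fun j _ => by rw [show A.fr₁.basis.repr u (.inr (.inr j)) = 0 from
        congrFun ha0 j, zero_smul]]
    exact zero_mem _
  · intro v hv hv'
    have hl0 : A.fr₂.basis.repr v (.inr (.inr none)) = 0 := by
      have h1 := congrArg (fun z => A.fr₁.basis.repr z (.inr (.inl none))) hv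
      rw [A.β_apply] at h1
      simpa [WittFrame.y, Finsupp.single_apply] using h1
    have hy0 : ∀ i, A.fr₂.basis.repr v (.inr (.inl i)) = 0 := by
      intro i
      have h1 := congrArg (fun z => A.fr₁.basis.repr z (.inr (.inl (some i)))) hv
      rw [A.β_apply] at h1
      simpa [WittFrame.y, Finsupp.single_apply] using h1
    have hv2 := A.fr₂.sum_repr v
    simp only [Fintype.sum_option, hl0, hy0, zero_smul, Finset.sum_const_zero, zero_add] at hv2
    set a : Fin d → ℂ := fun j => A.fr₂.basis.repr v (.inr (.inr (some j))) with ha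
    have hx : ∑ i, A.fr₂.basis.repr v (.inl i) • A.fr₂.x i ∈
        Submodule.span ℂ (Set.range A.fr₂.x) :=
      Submodule.sum_mem _ fun i _ => Submodule.smul_mem _ _ (Submodule.subset_span ⟨i, rfl⟩)
    have hx' : h.2.val (A.fr₂.sign (s.1 ∘ some, fun o => o.elim (s.1 none) s.2.2)
        (∑ i, A.fr₂.basis.repr v (.inl i) • A.fr₂.x i)) ∈
        Submodule.span ℂ (Set.range A.fr₂.x) := by
      simp only [map_sum, map_smul, WittFrame.sign_x]
      exact Submodule.sum_mem _ fun i _ => Submodule.smul_mem _ _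
        (Submodule.smul_mem _ _ (A.map_x_mem hh i))
    have ha0 : a = 0 := by
      refine hT a fun i => ?_
      have h1 := A.repr_span hv' (some i)
      rw [e2, map_add, Finsupp.add_apply, ← hv2, map_add (A.fr₂.sign _), map_add h.2.val, map_add,
        Finsupp.add_apply, A.repr_span hx', zero_add, hv2] at h1
      simp only [map_sum, map_smul, WittFrame.sign_l, Finsupp.finsetSum_apply,
        Finsupp.smul_apply, smul_eq_mul, Option.elim_some] at h1
      rw [eq_neg_iff_add_eq_zero, ← h1]
      congr 1
      refine Finset.sum_congr rfl fun j _ => ?_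
      simp only [Matrix.of_apply, hs, ha]
      ring
    rw [← hv2]
    refine add_mem hx ?_
    rw [show ∑ j, A.fr₂.basis.repr v (.inr (.inr (some j))) • A.fr₂.l (some j) = 0 from
      Finset.sum_eq_zero fun j _ => by rw [show A.fr₂.basis.repr v (.inr (.inr (some j))) = 0 from
        congrFun ha0 j, zero_smul]]
    exact zero_mem _

end AdaptedFrame

/-! ### One-parameter tori in the centralizer -/

theorem mem_component_of_units {G : Type*} [TopologicalSpace G] [Group G] [IsTopologicalGroup G]
    {f : ℂˣ → G} (hf : Continuous f) (h1 : f 1 = 1) (z : ℂˣ) :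
    f z ∈ Subgroup.connectedComponentOfOne G := by
  -- The exponential maps the connected plane onto the punctured plane, so the family may be
  -- parametrized by ℂ.
  have hc : Continuous fun w : ℂ => Units.mk0 (Complex.exp w) (Complex.exp_ne_zero w) :=
    Units.continuous_iff.2 ⟨Complex.continuous_exp, by
      simp only [Units.val_inv_eq_inv_val, Units.val_mk0, ← Complex.exp_neg]
      fun_prop⟩
  have := mem_component_of_family (f := fun w : ℂ => f (Units.mk0 (Complex.exp w)
    (Complex.exp_ne_zero w))) (hf.comp hc) (x₀ := 0) (by
      simp only [Complex.exp_zero]; rw [← h1]; congr 1; exact Units.ext rfl) (Complex.log z)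
  rwa [show Units.mk0 (Complex.exp (Complex.log z)) (Complex.exp_ne_zero _) = z from
    Units.ext (Complex.exp_log z.ne_zero)] at this

section Tori

variable {U₁ U₂ : Type*} [AddCommGroup U₁] [Module ℂ U₁] [AddCommGroup U₂] [Module ℂ U₂]
  [FiniteDimensional ℂ U₁] [FiniteDimensional ℂ U₂]
  {Q₁ : QuadraticForm ℂ U₁} {Q₂ : QuadraticForm ℂ U₂} {α : U₁ →ₗ[ℂ] U₂} {β : U₂ →ₗ[ℂ] U₁}

/-- The torus of GL_k attached to the strings `x₁ ↦ x₂` and `-y₂ ↦ y₁`. Both spin factors must move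
with the same parameter, so `z = -1` yields the pair (-1, -1). -/
theorem torus_mem_component
    (skew : ∀ u v, QuadraticMap.polar Q₂ (α u) v = -QuadraticMap.polar Q₁ u (β v))
    {x₁ y₁ : U₁} {x₂ y₂ : U₂} (hx₁ : Q₁ x₁ = 0) (hy₁ : Q₁ y₁ = 0)
    (hxy₁ : QuadraticMap.polar Q₁ x₁ y₁ = 1) (hx₂ : Q₂ x₂ = 0) (hy₂ : Q₂ y₂ = 0)
    (hxy₂ : QuadraticMap.polar Q₂ x₂ y₂ = 1) (hαx : α x₁ = x₂) (hαy : α y₁ = 0)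
    (hβx : β x₂ = 0) (hβy : β y₂ = -y₁) (z : ℂˣ) :
    ∃ g : pairCentralizer Q₁ Q₂ α β, g ∈ Subgroup.connectedComponentOfOne _ ∧
      (g : spinGroup Q₁ × spinGroup Q₂) =
        (hyperbolicTorus Q₁ hx₁ hy₁ hxy₁ z, hyperbolicTorus Q₂ hx₂ hy₂ hxy₂ z) := by
  have hmem : ∀ z, (hyperbolicTorus Q₁ hx₁ hy₁ hxy₁ z, hyperbolicTorus Q₂ hx₂ hy₂ hxy₂ z) ∈
      pairCentralizer Q₁ Q₂ α β := by
    intro z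
    have skew' : ∀ u v, QuadraticMap.polar Q₁ (β v) u = -QuadraticMap.polar Q₂ v (α u) := by
      intro u v
      rw [QuadraticMap.polar_comm, QuadraticMap.polar_comm Q₂, skew, neg_neg]
    refine ⟨fun u => ?_, fun v => ?_⟩
    · rw [vectorRep_hyperbolicTorus, vectorRep_hyperbolicTorus, skew, skew, hβx, hβy]
      simp [hαx, hαy, QuadraticMap.polar_neg_right, QuadraticMap.polar_zero_right]
    · rw [vectorRep_hyperbolicTorus, vectorRep_hyperbolicTorus, skew', skew', hαx, hαy]
      simp [hβx, hβy, QuadraticMap.polar_zero_right]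
  refine ⟨⟨_, hmem z⟩, ?_, rfl⟩
  refine mem_component_of_units (G := pairCentralizer Q₁ Q₂ α β) (f := fun z => ⟨_, hmem z⟩) ?_ ?_ z
  · exact Continuous.subtype_mk ((continuous_hyperbolicTorus hx₁ hy₁ hxy₁).prodMk
      (continuous_hyperbolicTorus hx₂ hy₂ hxy₂)) _
  · exact Subtype.ext (Prod.ext (hyperbolicTorus_one hx₁ hy₁ hxy₁)
      (hyperbolicTorus_one hx₂ hy₂ hxy₂))

/-- A plane killed by `α` is orthogonal to range β, so its torus commutes with everything while the
other factor stays at 1. -/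
theorem torus_fst_mem_component
    (skew : ∀ u v, QuadraticMap.polar Q₂ (α u) v = -QuadraticMap.polar Q₁ u (β v))
    {x y : U₁} (hx : Q₁ x = 0) (hy : Q₁ y = 0)
    (hxy : QuadraticMap.polar Q₁ x y = 1) (hαx : α x = 0) (hαy : α y = 0) (z : ℂˣ) :
    ∃ g : pairCentralizer Q₁ Q₂ α β, g ∈ Subgroup.connectedComponentOfOne _ ∧
      (g : spinGroup Q₁ × spinGroup Q₂) = (hyperbolicTorus Q₁ hx hy hxy z, 1) := by
  have skew' : ∀ u v, QuadraticMap.polar Q₁ (β v) u = -QuadraticMap.polar Q₂ v (α u) := by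
    intro u v
    rw [QuadraticMap.polar_comm, QuadraticMap.polar_comm Q₂, skew, neg_neg]
  have hmem : ∀ z, (hyperbolicTorus Q₁ hx hy hxy z, (1 : spinGroup Q₂)) ∈
      pairCentralizer Q₁ Q₂ α β := by
    intro z
    refine ⟨fun u => ?_, fun v => ?_⟩
    · rw [vectorRep_hyperbolicTorus]
      simp [hαx, hαy]
    · rw [vectorRep_hyperbolicTorus, skew', skew', hαx, hαy]
      simp [QuadraticMap.polar_zero_right]
  refine ⟨⟨_, hmem z⟩, ?_, rfl⟩
  refine mem_component_of_units (G := pairCentralizer Q₁ Q₂ α β) (f := fun z => ⟨_, hmem z⟩) ?_ ?_ z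
  · exact Continuous.subtype_mk ((continuous_hyperbolicTorus hx hy hxy).prodMk
      continuous_const) _
  · exact Subtype.ext (Prod.ext (hyperbolicTorus_one hx hy hxy) rfl)

theorem torus_snd_mem_component
    (skew : ∀ u v, QuadraticMap.polar Q₂ (α u) v = -QuadraticMap.polar Q₁ u (β v))
    {x y : U₂} (hx : Q₂ x = 0) (hy : Q₂ y = 0)
    (hxy : QuadraticMap.polar Q₂ x y = 1) (hβx : β x = 0) (hβy : β y = 0) (z : ℂˣ) :
    ∃ g : pairCentralizer Q₁ Q₂ α β, g ∈ Subgroup.connectedComponentOfOne _ ∧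
      (g : spinGroup Q₁ × spinGroup Q₂) = (1, hyperbolicTorus Q₂ hx hy hxy z) := by
  have hmem : ∀ z, ((1 : spinGroup Q₁), hyperbolicTorus Q₂ hx hy hxy z) ∈
      pairCentralizer Q₁ Q₂ α β := by
    intro z
    refine ⟨fun u => ?_, fun v => ?_⟩
    · rw [vectorRep_hyperbolicTorus, skew, skew, hβx, hβy]
      simp [QuadraticMap.polar_zero_right]
    · rw [vectorRep_hyperbolicTorus]
      simp [hβx, hβy]
  refine ⟨⟨_, hmem z⟩, ?_, rfl⟩
  refine mem_component_of_units (G := pairCentralizer Q₁ Q₂ α β) (f := fun z => ⟨_, hmem z⟩) ?_ ?_ z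
  · exact Continuous.subtype_mk (continuous_const.prodMk
      (continuous_hyperbolicTorus hx hy hxy)) _
  · exact Subtype.ext (Prod.ext rfl (hyperbolicTorus_one hx hy hxy))

end Tori

/-! ### Which sign changes come from the spin group -/

/-- The imaginary unit as a unit of `ℂ`. -/
def unitI : ℂˣ := Units.mk0 Complex.I Complex.I_ne_zero

theorem vectorRep_hyperbolicTorus_I {V : Type*} [AddCommGroup V] [Module ℂ V]
    {Q : QuadraticForm ℂ V} {x y : V} (hx : Q x = 0) (hy : Q y = 0)
    (hxy : QuadraticMap.polar Q x y = 1) (v : V) :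
    vectorRep Q (hyperbolicTorus Q hx hy hxy unitI) v =
      v - ((2 * QuadraticMap.polar Q v y) • x + (2 * QuadraticMap.polar Q v x) • y) := by
  rw [vectorRep_hyperbolicTorus]
  have h1 : (unitI : ℂ) ^ 2 - 1 = -2 := by
    rw [unitI, Units.val_mk0, Complex.I_sq]; norm_num
  have h2 : ((unitI⁻¹ : ℂˣ) : ℂ) ^ 2 - 1 = -2 := by
    rw [unitI, Units.val_inv_eq_inv_val, Units.val_mk0, inv_pow, Complex.I_sq]; norm_num
  rw [h1, h2]
  module

namespace WittFrame

variable {V : Type*} [AddCommGroup V] [Module ℂ V] {Q : QuadraticForm ℂ V} {H L : Type*}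
  [DecidableEq H] (F : WittFrame Q H L)

theorem vectorRep_torus_I (i : H) :
    vectorRep Q (hyperbolicTorus Q (F.Q_x i) (F.Q_y i) (F.polar_x_y i) unitI) =
      F.sign (Pi.mulSingle i (-1), 1) := by
  refine F.ext_iff_basis (fun j => ?_) (fun j => ?_) (fun j => ?_)
  · rw [vectorRep_hyperbolicTorus_I, sign_x, F.polar_xy', show QuadraticMap.polar Q (F.x j) (F.x i)
      = 0 from F.polar_xx j i]
    by_cases h : j = i
    · subst h; simp; module
    · simp [h]
  · rw [vectorRep_hyperbolicTorus_I, sign_y, F.polar_yx', show QuadraticMap.polar Q (F.y j) (F.y i)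
      = 0 from F.polar_yy j i]
    by_cases h : i = j
    · subst h; simp; module
    · simp [h, Ne.symm h]
  · rw [vectorRep_hyperbolicTorus_I, sign_l, QuadraticMap.polar_comm,
      show QuadraticMap.polar Q (F.y i) (F.l j) = 0 from F.polar_yl i j, QuadraticMap.polar_comm,
      show QuadraticMap.polar Q (F.x i) (F.l j) = 0 from F.polar_xl i j]
    simp

theorem exists_hyperbolic_pair [DecidableEq L] {i j : L} (hij : i ≠ j) : ∃ a b a' b' : ℂ,
    ∃ (hx : Q (a • F.l i + b • F.l j) = 0) (hy : Q (a' • F.l i + b' • F.l j) = 0)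
      (hxy : QuadraticMap.polar Q (a • F.l i + b • F.l j) (a' • F.l i + b' • F.l j) = 1),
      vectorRep Q (hyperbolicTorus Q hx hy hxy unitI) =
        F.sign (1, Pi.mulSingle i (-1) * Pi.mulSingle j (-1)) := by
  obtain ⟨r, hr⟩ := IsAlgClosed.exists_pow_nat_eq ((2 * Q (F.l i))⁻¹) (n := 2) two_pos
  obtain ⟨s, hs⟩ := IsAlgClosed.exists_pow_nat_eq ((2 * Q (F.l j))⁻¹) (n := 2) two_pos
  have hi : Q (F.l i) ≠ 0 := F.polar_l_ne_zero i
  have hj : Q (F.l j) ≠ 0 := F.polar_l_ne_zero j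
  have hr' : r ^ 2 * Q (F.l i) = 1 / 2 := by rw [hr]; field_simp
  have hs' : s ^ 2 * Q (F.l j) = 1 / 2 := by rw [hs]; field_simp
  have hlij : QuadraticMap.polar Q (F.l i) (F.l j) = 0 := F.polar_ll i j hij
  have hlji : QuadraticMap.polar Q (F.l j) (F.l i) = 0 := F.polar_ll j i hij.symm
  have hI := Complex.I_mul_I
  have hQ : ∀ a b : ℂ, Q (a • F.l i + b • F.l j) = a * a * Q (F.l i) + b * b * Q (F.l j) := by
    intro a b
    rw [QuadraticMap.map_add Q, QuadraticMap.map_smul, QuadraticMap.map_smul,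
      QuadraticMap.polar_smul_left, QuadraticMap.polar_smul_right, hlij]
    simp
  have hP : ∀ a b a' b' : ℂ, QuadraticMap.polar Q (a • F.l i + b • F.l j)
      (a' • F.l i + b' • F.l j) = 2 * (a * a' * Q (F.l i)) + 2 * (b * b' * Q (F.l j)) := by
    intro a b a' b'
    simp only [QuadraticMap.polar_add_left, QuadraticMap.polar_add_right,
      QuadraticMap.polar_smul_left, QuadraticMap.polar_smul_right, hlij, hlji,
      QuadraticMap.polar_self, smul_eq_mul, nsmul_eq_mul]
    push_cast
    ring
  -- `r` and `s` scale the two vectors to norm 1/2, so their combinations with coefficients 1 and ±i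
  -- are isotropic; halving the first one makes the pairing equal to 1.
  refine ⟨r / 2, Complex.I * s / 2, r, -(Complex.I * s), ?_, ?_, ?_, ?_⟩
  · rw [hQ]; linear_combination hr' / 4 - hs' / 4 + s ^ 2 * Q (F.l j) / 4 * hI
  · rw [hQ]; linear_combination hr' - hs' + s ^ 2 * Q (F.l j) * hI
  · rw [hP]; linear_combination hr' + hs' - s ^ 2 * Q (F.l j) * hI
  · refine F.ext_iff_basis (fun m => ?_) (fun m => ?_) (fun m => ?_)
    · rw [vectorRep_hyperbolicTorus_I, sign_x]
      have h1 : ∀ n, QuadraticMap.polar Q (F.x m) (F.l n) = 0 := F.polar_xl m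
      simp [QuadraticMap.polar_add_right, QuadraticMap.polar_smul_right, h1]
    · rw [vectorRep_hyperbolicTorus_I, sign_y]
      have h1 : ∀ n, QuadraticMap.polar Q (F.y m) (F.l n) = 0 := F.polar_yl m
      simp [QuadraticMap.polar_add_right, QuadraticMap.polar_smul_right, h1]
    · rw [vectorRep_hyperbolicTorus_I, sign_l]
      simp only [QuadraticMap.polar_add_right, QuadraticMap.polar_smul_right, smul_eq_mul]
      by_cases hmi : m = i
      · subst hmi
        simp only [hlij, QuadraticMap.polar_self, Pi.mul_apply, Pi.mulSingle_eq_same,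
          Pi.mulSingle_eq_of_ne hij, mul_one, sg_neg_one, nsmul_eq_mul]
        push_cast
        match_scalars
        · linear_combination -4 * hr'
        · ring
      · by_cases hmj : m = j
        · subst hmj
          simp only [hlji, QuadraticMap.polar_self, Pi.mul_apply, Pi.mulSingle_eq_same,
            Pi.mulSingle_eq_of_ne hij.symm, one_mul, sg_neg_one, nsmul_eq_mul]
          push_cast
          match_scalars
          · linear_combination -4 * hs' + 4 * s ^ 2 * Q (F.l m) * hI
          · ring
        · have h1 : QuadraticMap.polar Q (F.l m) (F.l i) = 0 := F.polar_ll m i hmi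
          have h2 : QuadraticMap.polar Q (F.l m) (F.l j) = 0 := F.polar_ll m j hmj
          simp [h1, h2, Pi.mulSingle_eq_of_ne hmi, Pi.mulSingle_eq_of_ne hmj]

end WittFrame

/-- Modulo `Z` a sign at any index can be traded for one at `i₀`, so only the product of all signs
matters. -/
theorem exists_mul_mulSingle_mem {ι : Type*} [Fintype ι] [DecidableEq ι] (i₀ : ι)
    (Z : Subgroup (ι → ℤˣ)) (hZ : ∀ i, i ≠ i₀ → Pi.mulSingle i (-1) * Pi.mulSingle i₀ (-1) ∈ Z)
    (S : ι → ℤˣ) : ∃ σ : ℤˣ, S * Pi.mulSingle i₀ σ ∈ Z := by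
  refine ⟨∏ i, S i, ?_⟩
  have h1 : Pi.mulSingle i₀ (∏ i, S i) = ∏ i, (Pi.mulSingle i₀ (S i) : ι → ℤˣ) :=
    map_prod (MonoidHom.mulSingle (fun _ : ι => ℤˣ) i₀) _ _
  rw [h1, ← Finset.univ_prod_mulSingle S, ← Finset.prod_mul_distrib]
  refine prod_mem fun i _ => ?_
  rw [Finset.univ_prod_mulSingle]
  rcases Int.units_eq_one_or (S i) with h | h
  · rw [h]; simp
  · rw [h]
    by_cases hi : i = i₀
    · subst hi
      rw [← Pi.mulSingle_mul]
      simp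
    · exact hZ i hi

namespace WittFrame

variable {V : Type*} [AddCommGroup V] [Module ℂ V] {Q : QuadraticForm ℂ V} {H L : Type*}
  [DecidableEq H] (F : WittFrame Q H L)

theorem exists_vectorRep_sign [Fintype H] (s : H → ℤˣ) :
    ∃ x : spinGroup Q, vectorRep Q x = F.sign (s, 1) := by
  have h : (s, (1 : L → ℤˣ)) ∈ (MonoidHom.mrange (vectorRep Q)).comap F.sign := by
    have hs : (s, (1 : L → ℤˣ)) = ∏ i, (MonoidHom.inl (H → ℤˣ) (L → ℤˣ)) (Pi.mulSingle i (s i)) := by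
      rw [← map_prod, Finset.univ_prod_mulSingle]; rfl
    rw [hs]
    refine prod_mem fun i _ => ?_
    rcases Int.units_eq_one_or (s i) with h | h
    · rw [h, Pi.mulSingle_one, map_one]; exact one_mem _
    · rw [h]; exact ⟨_, F.vectorRep_torus_I i⟩
  exact h

theorem exists_vectorRep_sign_pair [Fintype H] [DecidableEq L] (s : H → ℤˣ) {i j : L}
    (hij : i ≠ j) : ∃ x : spinGroup Q,
      vectorRep Q x = F.sign (s, Pi.mulSingle i (-1) * Pi.mulSingle j (-1)) := by
  obtain ⟨x, hx⟩ := F.exists_vectorRep_sign s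
  obtain ⟨_, _, _, _, hx', hy', hxy', h⟩ := F.exists_hyperbolic_pair hij
  exact ⟨x * hyperbolicTorus Q hx' hy' hxy' unitI, by
    rw [map_mul, hx, h, ← map_mul, Prod.mk_mul_mk, one_mul, mul_one]⟩

theorem sign_mulSingle [DecidableEq L] (j : L) (v : V) : F.sign (1, Pi.mulSingle j (-1)) v =
    v - (QuadraticMap.polar Q (F.l j) v / Q (F.l j)) • F.l j := by
  have : F.sign (1, Pi.mulSingle j (-1)) = LinearMap.id -
      ((Q (F.l j))⁻¹ • QuadraticMap.polarBilin Q (F.l j)).smulRight (F.l j) := by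
    refine F.ext_iff_basis (fun i => ?_) (fun i => ?_) (fun i => ?_)
    · have : QuadraticMap.polar Q (F.l j) (F.x i) = 0 := by
        rw [QuadraticMap.polar_comm]; exact F.polar_xl i j
      simp [this]
    · have : QuadraticMap.polar Q (F.l j) (F.y i) = 0 := by
        rw [QuadraticMap.polar_comm]; exact F.polar_yl i j
      simp [this]
    · have hj : Q (F.l j) ≠ 0 := F.polar_l_ne_zero j
      by_cases h : i = j
      · subst h
        simp only [sign_l, Pi.mulSingle_eq_same, sg_neg_one, LinearMap.sub_apply,
          LinearMap.id_apply, LinearMap.smulRight_apply, LinearMap.smul_apply,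
          QuadraticMap.polarBilin_apply_apply, QuadraticMap.polar_self, smul_eq_mul, nsmul_eq_mul]
        match_scalars
        field_simp
        norm_num
      · have : QuadraticMap.polar Q (F.l j) (F.l i) = 0 := F.polar_ll j i (Ne.symm h)
        simp [this, Pi.mulSingle_eq_of_ne h]
  rw [this]
  simp [div_eq_inv_mul]

/-- The signs on hyperbolic pairs come from spin elements and can be divided out, which leaves a
reflection. This is the determinant condition in the form used below. -/
theorem vectorRep_ne_sign_mulSingle [Fintype H] [DecidableEq L] (s : H → ℤˣ) (j : L)
    (x : spinGroup Q) : vectorRep Q x ≠ F.sign (s, Pi.mulSingle j (-1)) := by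
  intro hx
  obtain ⟨y, hy⟩ := F.exists_vectorRep_sign s
  have h : vectorRep Q (y * x) = F.sign (1, Pi.mulSingle j (-1)) := by
    rw [map_mul, hx, hy, ← map_mul, Prod.mk_mul_mk, one_mul]
    congr 2
    funext i
    exact Int.units_mul_self (s i)
  refine vectorRep_ne_reflection (x := y * x) (F.polar_l_ne_zero j) ?_ fun v hv => ?_
  · rw [h]
    exact (F.sign_l _ _).trans (by simp [l])
  · rw [h, sign_mulSingle, l, hv]; simp

end WittFrame

/-! ### Components of the centralizer up to the kernel of the covering -/

namespace AdaptedFrame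

variable {U₁ U₂ : Type*} [AddCommGroup U₁] [Module ℂ U₁] [AddCommGroup U₂] [Module ℂ U₂]
  {Q₁ : QuadraticForm ℂ U₁} {Q₂ : QuadraticForm ℂ U₂} {α : U₁ →ₗ[ℂ] U₂} {β : U₂ →ₗ[ℂ] U₁}
  {k c d : ℕ} (A : AdaptedFrame Q₁ Q₂ α β k c d)

theorem elim_eq_mulSingle_none (ε : ℤˣ) :
    (fun o : Option (Fin d) => o.elim ε 1) = Pi.mulSingle none ε := by
  funext o; cases o <;> simp

theorem elim_eq_mulSingle_some (j : Fin d) (ε : ℤˣ) :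
    (fun o : Option (Fin d) => o.elim 1 (Pi.mulSingle j ε)) = Pi.mulSingle (some j) ε := by
  funext o
  cases o with
  | none => simp
  | some i => by_cases h : i = j <;> simp [h]

theorem mulSingle_some_comp (i : Fin k) (ε : ℤˣ) :
    (Pi.mulSingle (some i) ε : Option (Fin k) → ℤˣ) ∘ some = Pi.mulSingle i ε := by
  funext j; by_cases h : j = i <;> simp [h]

theorem mulSingle_none_comp (ε : ℤˣ) :
    (Pi.mulSingle none ε : Option (Fin k) → ℤˣ) ∘ some = 1 := by
  funext j; simp

theorem signPair_snd_mk (D : Option (Fin k) → ℤˣ) (S : Fin c → ℤˣ) (T : Fin d → ℤˣ) :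
    (A.signPair (D, S, T)).2.val = A.fr₂.sign (D ∘ some, fun o => o.elim (D none) T) := rfl

/-- Negating the string of length three alone is a reflection in `l none` on the second space.
Negating a row of length one there as well, which exists as `0 < d`, restores determinant one. -/
theorem exists_neg_y_none (hd : 0 < d) : ∃ g : pairCentralizer Q₁ Q₂ α β,
    vectorRep Q₁ g.1.1 (A.fr₁.y none) = sg (-1) • A.fr₁.y none := by
  obtain ⟨x, hx⟩ := A.fr₁.exists_vectorRep_sign (Pi.mulSingle none (-1))
  obtain ⟨y, hy⟩ := A.fr₂.exists_vectorRep_sign_pair 1 (i := none) (j := some ⟨0, hd⟩) (by simp)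
  have : unitsRep Q₁ Q₂ (x, y) =
      A.signPair (Pi.mulSingle none (-1), 1, Pi.mulSingle ⟨0, hd⟩ (-1)) := by
    refine Prod.ext (Units.ext hx) (Units.ext (hy.trans ?_))
    rw [signPair_snd_mk, mulSingle_none_comp]
    congr 2
    funext o
    cases o with
    | none => simp
    | some i => by_cases h : i = ⟨0, hd⟩ <;> simp [h]
  refine ⟨⟨(x, y), (unitsRep_mem_iff _).1 (by rw [this]; exact A.signPair_mem _)⟩, ?_⟩
  simp only [hx, A.fr₁.sign_y, Pi.mulSingle_eq_same]

variable [FiniteDimensional ℂ U₁] [FiniteDimensional ℂ U₂]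

theorem signPair_some_mem (i : Fin k) :
    A.signPair (Pi.mulSingle (some i) (-1), 1, 1) ∈ neutralImage Q₁ Q₂ α β := by
  obtain ⟨g, hg, hg'⟩ := torus_mem_component A.skew (A.fr₁.Q_x (some i)) (A.fr₁.Q_y (some i))
    (A.fr₁.polar_x_y (some i)) (A.fr₂.Q_x i) (A.fr₂.Q_y i) (A.fr₂.polar_x_y i) (A.α_x_some i)
    (A.α_y _) (A.β_x i) (A.β_y i) unitI
  refine mem_neutralImage.2 ⟨g, hg, ?_⟩
  rw [hg']
  refine Prod.ext (Units.ext ?_) (Units.ext ?_)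
  · exact A.fr₁.vectorRep_torus_I _
  · rw [signPair_snd_mk, mulSingle_some_comp, Pi.mulSingle_eq_of_ne (by simp), elim_eq_mulSingle_none,
      Pi.mulSingle_one]
    exact A.fr₂.vectorRep_torus_I _

theorem signPair_fst_mem {i j : Fin c} (hij : i ≠ j) :
    A.signPair (1, Pi.mulSingle i (-1) * Pi.mulSingle j (-1), 1) ∈ neutralImage Q₁ Q₂ α β := by
  obtain ⟨_, _, _, _, hx, hy, hxy, h⟩ := A.fr₁.exists_hyperbolic_pair hij
  obtain ⟨g, hg, hg'⟩ := torus_fst_mem_component A.skew hx hy hxy (by simp [A.α_l])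
    (by simp [A.α_l]) unitI
  refine mem_neutralImage.2 ⟨g, hg, ?_⟩
  rw [hg']
  refine Prod.ext (Units.ext h) (Units.ext ?_)
  rw [signPair_snd_mk, unitsRep_snd, map_one, Pi.one_apply, elim_eq_mulSingle_none, Pi.mulSingle_one]
  exact A.fr₂.sign.map_one.symm

theorem signPair_snd_mem {i j : Fin d} (hij : i ≠ j) :
    A.signPair (1, 1, Pi.mulSingle i (-1) * Pi.mulSingle j (-1)) ∈ neutralImage Q₁ Q₂ α β := by
  obtain ⟨_, _, _, _, hx, hy, hxy, h⟩ :=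
    A.fr₂.exists_hyperbolic_pair (i := some i) (j := some j) (by simpa using hij)
  obtain ⟨g, hg, hg'⟩ := torus_snd_mem_component A.skew hx hy hxy (by simp [A.β_l_some])
    (by simp [A.β_l_some]) unitI
  refine mem_neutralImage.2 ⟨g, hg, ?_⟩
  rw [hg']
  refine Prod.ext (Units.ext ?_) (Units.ext (h.trans ?_))
  · rw [unitsRep_fst, map_one]
    exact A.fr₁.sign.map_one.symm
  · rw [signPair_snd_mk]
    congr 2
    rw [← elim_eq_mulSingle_some, ← elim_eq_mulSingle_some]
    funext o
    cases o <;> simp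

/-- At most one flip survives, at index 0. The index is described by its value so that `n = 0` is
covered too. -/
theorem exists_flip_mem {n : ℕ} (Z : Subgroup (Fin n → ℤˣ))
    (hZ : ∀ i j, i ≠ j → Pi.mulSingle i (-1) * Pi.mulSingle j (-1) ∈ Z) (S : Fin n → ℤˣ) :
    ∃ σ : Fin n → ℤˣ, (σ = 1 ∨ ∃ j : Fin n, (j : ℕ) = 0 ∧ σ = Pi.mulSingle j (-1)) ∧ S * σ ∈ Z := by
  cases n with
  | zero =>
    refine ⟨1, .inl rfl, ?_⟩
    rw [Subsingleton.elim (S * 1) 1]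
    exact one_mem _
  | succ n =>
    obtain ⟨σ, hσ⟩ := exists_mul_mulSingle_mem 0 Z (fun i hi => hZ i 0 hi) S
    refine ⟨_, ?_, hσ⟩
    rcases Int.units_eq_one_or σ with h | h
    · left; rw [h, Pi.mulSingle_one]
    · right; exact ⟨0, rfl, by rw [h]⟩

/-- After the sign changes that reach `neutralImage`, the signs on strings of length two and all
pairs of signs on rows of length one within one space are absorbed by tori evaluated at `z = i`. -/
theorem exists_reduced_signPair (hQ₁ : (QuadraticMap.polarBilin Q₁).Nondegenerate)
    (hQ₂ : (QuadraticMap.polarBilin Q₂).Nondegenerate)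
    {h : (Module.End ℂ U₁)ˣ × (Module.End ℂ U₂)ˣ}
    (hh : h ∈ isometryCentralizer Q₁ Q₂ α β) {ε : ℤˣ}
    (hε : h.1.val (A.fr₁.y none) = sg ε • A.fr₁.y none) :
    ∃ (σ : Fin c → ℤˣ) (τ : Fin d → ℤˣ),
      (σ = 1 ∨ ∃ j : Fin c, (j : ℕ) = 0 ∧ σ = Pi.mulSingle j (-1)) ∧
      (τ = 1 ∨ ∃ j : Fin d, (j : ℕ) = 0 ∧ τ = Pi.mulSingle j (-1)) ∧
      h * A.signPair (Pi.mulSingle none ε, σ, τ) ∈ neutralImage Q₁ Q₂ α β := by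
  obtain ⟨⟨D, S, T⟩, rfl, hs⟩ := A.exists_signPair_mul_mem hQ₁ hQ₂ hh hε
  obtain ⟨σ, hσ, hσ'⟩ := exists_flip_mem ((neutralImage Q₁ Q₂ α β).comap
    (A.signPair.comp ((MonoidHom.inr _ _).comp (MonoidHom.inl _ _))))
    (fun i j hij => A.signPair_fst_mem hij) S
  obtain ⟨τ, hτ, hτ'⟩ := exists_flip_mem ((neutralImage Q₁ Q₂ α β).comap
    (A.signPair.comp ((MonoidHom.inr _ _).comp (MonoidHom.inr _ _))))
    (fun i j hij => A.signPair_snd_mem hij) T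
  refine ⟨σ, τ, hσ, hτ, ?_⟩
  have hD : Pi.mulSingle none (D none) * D ∈ (neutralImage Q₁ Q₂ α β).comap
      (A.signPair.comp (MonoidHom.inl _ _)) := by
    nth_rewrite 2 [← Finset.univ_prod_mulSingle D]
    rw [Fintype.prod_option, ← mul_assoc, ← Pi.mulSingle_mul, Int.units_mul_self,
      Pi.mulSingle_one, one_mul]
    refine prod_mem fun i _ => ?_
    rcases Int.units_eq_one_or (D (some i)) with h | h
    · rw [h, Pi.mulSingle_one]; exact one_mem _
    · rw [h]; exact A.signPair_some_mem i
  have h1 := mul_mem hs (mul_mem hD (mul_mem hσ' hτ'))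
  -- Sign vectors square to 1, so `D`, `S` and `T` cancel and only the reduced signs remain.
  have h2 : (D, S, T) * ((Pi.mulSingle none (D none) * D, 1, 1) * ((1, S * σ, 1) * (1, 1, T * τ)))
      = (Pi.mulSingle none (D none), σ, τ) := by
    have hsq : ∀ {ι : Type} (f : ι → ℤˣ), f * f = 1 := fun f => funext fun i => Int.units_mul_self _
    simp only [Prod.mk_mul_mk, one_mul, mul_one]
    rw [mul_left_comm, hsq, ← mul_assoc, hsq, ← mul_assoc, hsq, mul_one, one_mul, one_mul]
  rw [← h2, map_mul, map_mul, map_mul, ← mul_assoc]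
  exact h1

/-- The reduced sign change is the action of a spin pair, hence is not a reflection on either space.
This forces `σ = 1`, and `τ` is a flip exactly when `ε = -1`; without rows of length one in the
second space `ε = -1` is impossible. -/
theorem mem_neutralImage_and_eq_one (hQ₁ : (QuadraticMap.polarBilin Q₁).Nondegenerate)
    (hQ₂ : (QuadraticMap.polarBilin Q₂).Nondegenerate) (g : pairCentralizer Q₁ Q₂ α β) {ε : ℤˣ}
    (hε : vectorRep Q₁ g.1.1 (A.fr₁.y none) = sg ε • A.fr₁.y none) :
    (ε = 1 → unitsRep Q₁ Q₂ g ∈ neutralImage Q₁ Q₂ α β) ∧ (d = 0 → ε = 1) ∧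
      ∀ j : Fin d, (j : ℕ) = 0 → unitsRep Q₁ Q₂ g *
        A.signPair (Pi.mulSingle none ε, 1, Pi.mulSingle j ε) ∈ neutralImage Q₁ Q₂ α β := by
  obtain ⟨σ, τ, hσ, hτ, hm⟩ := A.exists_reduced_signPair hQ₁ hQ₂ ((unitsRep_mem_iff g.1).2 g.2) hε
  obtain ⟨g₀, -, hg₀⟩ := mem_neutralImage.1 hm
  have hg : unitsRep Q₁ Q₂ (g⁻¹ * g₀ : pairCentralizer Q₁ Q₂ α β) =
      A.signPair (Pi.mulSingle none ε, σ, τ) := by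
    rw [Subgroup.coe_mul, map_mul, hg₀, Subgroup.coe_inv, map_inv, inv_mul_cancel_left]
  generalize (g⁻¹ * g₀ : pairCentralizer Q₁ Q₂ α β) = g' at hg
  have hg1 : vectorRep Q₁ g'.1.1 = A.fr₁.sign (Pi.mulSingle none ε, σ) :=
    congrArg (fun z => z.1.val) hg
  have hg2 : vectorRep Q₂ g'.1.2 = A.fr₂.sign (1, fun o => o.elim ε τ) := by
    have := congrArg (fun z => z.2.val) hg
    rwa [signPair_snd_mk, mulSingle_none_comp, Pi.mulSingle_eq_same] at this
  have hσ1 : σ = 1 := by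
    rcases hσ with h | ⟨j, -, rfl⟩
    · exact h
    · exact absurd hg1 (A.fr₁.vectorRep_ne_sign_mulSingle _ _ _)
  refine ⟨fun h1 => ?_, fun hd => ?_, fun j hj => ?_⟩
  · subst h1
    have hτ1 : τ = 1 := by
      rcases hτ with h | ⟨j, -, rfl⟩
      · exact h
      · rw [elim_eq_mulSingle_some] at hg2
        exact absurd hg2 (A.fr₂.vectorRep_ne_sign_mulSingle _ _ _)
    rw [hσ1, hτ1, Pi.mulSingle_one] at hm
    rw [← mul_one (unitsRep Q₁ Q₂ g), ← A.signPair.map_one]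
    exact hm
  · subst hd
    rcases Int.units_eq_one_or ε with h | h
    · exact h
    · rw [Subsingleton.elim τ 1, elim_eq_mulSingle_none, h] at hg2
      exact absurd hg2 (A.fr₂.vectorRep_ne_sign_mulSingle _ _ _)
  · rw [hσ1] at hm
    convert hm
    rcases hτ with h | ⟨i, hi, rfl⟩
    · rcases Int.units_eq_one_or ε with h1 | h1
      · rw [h, h1, Pi.mulSingle_one]
      · rw [h, elim_eq_mulSingle_none, h1] at hg2
        exact absurd hg2 (A.fr₂.vectorRep_ne_sign_mulSingle _ _ _)
    · rcases Int.units_eq_one_or ε with h1 | h1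
      · rw [h1, elim_eq_mulSingle_some] at hg2
        exact absurd hg2 (A.fr₂.vectorRep_ne_sign_mulSingle _ _ _)
      · rw [h1, show i = j from Fin.ext (hi.trans hj.symm)]

/-- Every hyperbolic torus takes the value -1 at `z = -1`; a pair of strings of length two moves
both factors at once. -/
theorem neg_one_neg_one_mem (A : AdaptedFrame Q₁ Q₂ α β k c d) (hk : 0 < k) {z₁ : spinGroup Q₁} {z₂ : spinGroup Q₂}
    (hz₁ : (z₁ : CliffordAlgebra Q₁) = -1) (hz₂ : (z₂ : CliffordAlgebra Q₂) = -1) :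
    ∃ g : pairCentralizer Q₁ Q₂ α β, g ∈ Subgroup.connectedComponentOfOne _ ∧
      (g : spinGroup Q₁ × spinGroup Q₂) = (z₁, z₂) := by
  set i : Fin k := ⟨0, hk⟩
  obtain ⟨g, hg, hg'⟩ := torus_mem_component A.skew (A.fr₁.Q_x (some i)) (A.fr₁.Q_y (some i))
    (A.fr₁.polar_x_y (some i)) (A.fr₂.Q_x i) (A.fr₂.Q_y i) (A.fr₂.polar_x_y i) (A.α_x_some i)
    (A.α_y _) (A.β_x i) (A.β_y i) (-1)
  refine ⟨g, hg, hg'.trans (Prod.ext (Subtype.ext ?_) (Subtype.ext ?_))⟩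
  · rw [coe_hyperbolicTorus_neg_one, hz₁]
  · rw [coe_hyperbolicTorus_neg_one, hz₂]

theorem neg_one_one_mem (A : AdaptedFrame Q₁ Q₂ α β k c d) (hc : 2 ≤ c) {z₁ : spinGroup Q₁}
    (hz₁ : (z₁ : CliffordAlgebra Q₁) = -1) :
    ∃ g : pairCentralizer Q₁ Q₂ α β, g ∈ Subgroup.connectedComponentOfOne _ ∧
      (g : spinGroup Q₁ × spinGroup Q₂) = (z₁, 1) := by
  obtain ⟨_, _, _, _, hx, hy, hxy, -⟩ := A.fr₁.exists_hyperbolic_pair (i := ⟨0, by lia⟩)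
    (j := ⟨1, by lia⟩) (by simp)
  obtain ⟨g, hg, hg'⟩ := torus_fst_mem_component A.skew hx hy hxy (by simp [A.α_l])
    (by simp [A.α_l]) (-1)
  refine ⟨g, hg, hg'.trans (Prod.ext (Subtype.ext ?_) rfl)⟩
  rw [coe_hyperbolicTorus_neg_one, hz₁]

theorem one_neg_one_mem (A : AdaptedFrame Q₁ Q₂ α β k c d) (hd : 2 ≤ d) {z₂ : spinGroup Q₂}
    (hz₂ : (z₂ : CliffordAlgebra Q₂) = -1) :
    ∃ g : pairCentralizer Q₁ Q₂ α β, g ∈ Subgroup.connectedComponentOfOne _ ∧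
      (g : spinGroup Q₁ × spinGroup Q₂) = (1, z₂) := by
  obtain ⟨_, _, _, _, hx, hy, hxy, -⟩ := A.fr₂.exists_hyperbolic_pair (i := some ⟨0, by lia⟩)
    (j := some ⟨1, by lia⟩) (by simp)
  obtain ⟨g, hg, hg'⟩ := torus_snd_mem_component A.skew hx hy hxy (by simp [A.β_l_some])
    (by simp [A.β_l_some]) (-1)
  refine ⟨g, hg, hg'.trans (Prod.ext rfl (Subtype.ext ?_))⟩
  rw [coe_hyperbolicTorus_neg_one, hz₂]

end AdaptedFrame

/-! ### Clifford products of isotropic vectors -/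

section IsotropicProducts

variable {V : Type*} [AddCommGroup V] [Module ℂ V] {Q : QuadraticForm ℂ V}

theorem involute_contractLeft (v : V) (u : CliffordAlgebra Q) :
    involute (contractLeft (QuadraticMap.polarBilin Q v) u) =
      -contractLeft (QuadraticMap.polarBilin Q v) (involute u) := by
  rw [← ι_mul_sub_involute_mul_ι, ← ι_mul_sub_involute_mul_ι, map_sub, map_mul, map_mul, involute_ι,
    involute_involute]
  noncomm_ring

theorem ι_mul_ι_of_polar_eq_zero {v w : V} (h : QuadraticMap.polar Q v w = 0) :
    ι Q v * ι Q w = -(ι Q w * ι Q v) := by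
  rw [eq_neg_iff_add_eq_zero, ι_mul_ι_add_swap, h, map_zero]

variable {I : Type*} {a b : I → V}

/-- The product of a list of vectors in the Clifford algebra. -/
def vecProd (Q : QuadraticForm ℂ V) (a : I → V) (L : List I) : CliffordAlgebra Q :=
  (L.map fun i => ι Q (a i)).prod

@[simp] theorem vecProd_nil : vecProd Q a [] = 1 := rfl

@[simp] theorem vecProd_cons (i : I) (L : List I) :
    vecProd Q a (i :: L) = ι Q (a i) * vecProd Q a L := by simp [vecProd]

theorem vecProd_mul_ι {w : V} {L : List I} (hw : ∀ i ∈ L, QuadraticMap.polar Q (a i) w = 0) :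
    vecProd Q a L * ι Q w = (-1) ^ L.length * (ι Q w * vecProd Q a L) := by
  induction L with
  | nil => simp
  | cons i L ih =>
    rw [vecProd_cons, mul_assoc, ih fun j hj => hw j (List.mem_cons_of_mem _ hj), List.length_cons,
      pow_succ]
    have h1 := ι_mul_ι_of_polar_eq_zero (hw i List.mem_cons_self)
    have h2 : Commute (ι Q (a i)) ((-1) ^ L.length) :=
      ((Commute.neg_one_right _).pow_right _)
    rw [← mul_assoc, h2.eq, mul_assoc, ← mul_assoc (ι Q (a i)), h1]
    noncomm_ring

theorem involute_vecProd (L : List I) :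
    involute (vecProd Q a L) = (-1) ^ L.length * vecProd Q a L := by
  induction L with
  | nil => simp
  | cons i L ih =>
    rw [vecProd_cons, map_mul, ih, involute_ι, List.length_cons, pow_succ]
    have h2 : Commute (ι Q (a i)) ((-1) ^ L.length) :=
      ((Commute.neg_one_right _).pow_right _)
    rw [neg_mul, ← mul_assoc, h2.eq]
    noncomm_ring

theorem ι_sq_eq_zero (haa : ∀ i j, QuadraticMap.polar Q (a i) (a j) = 0) (i : I) :
    ι Q (a i) * ι Q (a i) = 0 := by
  have := haa i i
  rw [QuadraticMap.polar_self, two_smul, ← two_mul] at this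
  rw [ι_sq_scalar, (mul_eq_zero.1 this).resolve_left two_ne_zero, map_zero]

theorem ι_mul_vecProd (haa : ∀ i j, QuadraticMap.polar Q (a i) (a j) = 0) {i : I} {L : List I}
    (hi : i ∈ L) : ι Q (a i) * vecProd Q a L = 0 := by
  induction L with
  | nil => simp at hi
  | cons j L ih =>
    rw [vecProd_cons]
    rcases List.mem_cons.1 hi with rfl | h
    · rw [← mul_assoc, ι_sq_eq_zero haa, zero_mul]
    · rw [← mul_assoc, ι_mul_ι_of_polar_eq_zero (haa i j), neg_mul, mul_assoc, ih h, mul_zero,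
        neg_zero]

/-- Mutually orthogonal vectors anticommute, so reversal only changes the sign; which sign does not
matter later. -/
theorem exists_reverse_vecProd (haa : ∀ i j, QuadraticMap.polar Q (a i) (a j) = 0) (L : List I) :
    ∃ n : ℕ, reverse (vecProd Q a L) = (-1) ^ n * vecProd Q a L := by
  induction L with
  | nil => exact ⟨0, by simp⟩
  | cons i L ih =>
    obtain ⟨n, hn⟩ := ih
    refine ⟨n + L.length, ?_⟩
    rw [vecProd_cons, reverse.map_mul, hn, reverse_ι, mul_assoc, vecProd_mul_ι fun j _ => haa j i,
      pow_add]
    noncomm_ring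

theorem mul_vecProd_mul_star (x : spinGroup Q) (a : I → V) (L : List I) :
    (x : CliffordAlgebra Q) * vecProd Q a L * star (x : CliffordAlgebra Q) =
      vecProd Q (fun i => vectorRep Q x (a i)) L := by
  induction L with
  | nil => simp [spinGroup.mul_star_self_of_mem x.2]
  | cons i L ih =>
    rw [vecProd_cons, vecProd_cons, ← ih, ι_vectorRep]
    have := spinGroup.star_mul_self_of_mem x.2
    calc _ = (x : CliffordAlgebra Q) * ι Q (a i) * 1 * vecProd Q a L * star (x : CliffordAlgebra Q) := by
          noncomm_ring
      _ = _ := by rw [← this]; noncomm_ring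

variable [DecidableEq I]

theorem contractLeft_vecProd
    (hab : ∀ i j, QuadraticMap.polar Q (a i) (b j) = if i = j then 1 else 0) {i : I} {L : List I}
    (hi : i ∉ L) : contractLeft (QuadraticMap.polarBilin Q (b i)) (vecProd Q a L) = 0 := by
  induction L with
  | nil => simp
  | cons j L ih =>
    rw [List.mem_cons, not_or] at hi
    rw [vecProd_cons, contractLeft_ι_mul, ih hi.2, QuadraticMap.polarBilin_apply_apply,
      QuadraticMap.polar_comm, hab, if_neg (Ne.symm hi.1)]
    simp

/-- Contraction with the dual vectors strips off the factors one by one until 1 is left. -/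
theorem vecProd_ne_zero
    (hab : ∀ i j, QuadraticMap.polar Q (a i) (b j) = if i = j then 1 else 0) {L : List I}
    (hL : L.Nodup) : vecProd Q a L ≠ 0 := by
  induction L with
  | nil => rw [vecProd_nil]; exact one_ne_zero
  | cons j L ih =>
    rw [List.nodup_cons] at hL
    intro h
    apply ih hL.2
    have h2 := congrArg (contractLeft (QuadraticMap.polarBilin Q (b j))) h
    rwa [map_zero, vecProd_cons, contractLeft_ι_mul, contractLeft_vecProd hab hL.1,
      QuadraticMap.polarBilin_apply_apply, QuadraticMap.polar_comm, hab, if_pos rfl, one_smul,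
      mul_zero, sub_zero] at h2

/-- An element annihilated by isotropic vectors is divisible by their product. -/
theorem exists_eq_vecProd_mul
    (hab : ∀ i j, QuadraticMap.polar Q (a i) (b j) = if i = j then 1 else 0) {L : List I}
    (hL : L.Nodup) {u : CliffordAlgebra Q} (hu : ∀ i ∈ L, ι Q (a i) * u = 0) :
    ∃ t, u = vecProd Q a L * t ∧
      (∀ v, contractLeft (QuadraticMap.polarBilin Q v) u = 0 →
        contractLeft (QuadraticMap.polarBilin Q v) t = 0) ∧
      (∀ i ∈ L, contractLeft (QuadraticMap.polarBilin Q (b i)) t = 0) ∧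
      (involute u = (-1) ^ L.length * u → involute t = t) := by
  induction L generalizing u with
  | nil => exact ⟨u, by simp, fun _ h => h, by simp, by simp⟩
  | cons i L ih =>
    rw [List.nodup_cons] at hL
    have hc : ∀ j, contractLeft (QuadraticMap.polarBilin Q (b i)) (ι Q (a j) * u) =
        (if j = i then (1 : ℂ) else 0) • u -
          ι Q (a j) * contractLeft (QuadraticMap.polarBilin Q (b i)) u := by
      intro j
      rw [contractLeft_ι_mul, QuadraticMap.polarBilin_apply_apply, QuadraticMap.polar_comm, hab]
    -- Contracting `ι (a i) * u = 0` with `b i` shows that `u` is `ι (a i)` times its own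
    -- contraction, to which the induction hypothesis applies.
    obtain ⟨t, ht, ht1, ht2, ht3⟩ :=
      ih hL.2 (u := contractLeft (QuadraticMap.polarBilin Q (b i)) u) (by
        intro j hj
        have h1 := hc j
        rw [hu j (List.mem_cons_of_mem _ hj), map_zero, if_neg (by rintro rfl; exact hL.1 hj),
          zero_smul, zero_sub, eq_comm, neg_eq_zero] at h1
        exact h1)
    refine ⟨t, ?_, fun v hv => ht1 v ?_, ?_, fun hp => ht3 ?_⟩
    · have h1 := hc i
      rw [hu i List.mem_cons_self, map_zero, if_pos rfl, one_smul, ht, eq_comm, sub_eq_zero] at h1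
      rw [vecProd_cons, mul_assoc, ← h1]
    · rw [contractLeft_comm, hv, map_zero, neg_zero]
    · intro j hj
      rcases List.mem_cons.1 hj with rfl | hj
      · exact ht1 _ (contractLeft_contractLeft _ _)
      · exact ht2 j hj
    · have h3 : ∀ (m : ℕ) (y : CliffordAlgebra Q), (-1) ^ m * y = ((-1 : ℂ) ^ m) • y := by
        intro m y
        rw [Algebra.smul_def, map_pow, map_neg, map_one]
      rw [involute_contractLeft, hp, h3, map_smul, h3, List.length_cons, pow_succ]
      simp

end IsotropicProducts

/-! ### Spin elements preserving a maximal isotropic subspace -/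

section MaximalIsotropic

variable {V : Type*} [AddCommGroup V] [Module ℂ V] [FiniteDimensional ℂ V] {Q : QuadraticForm ℂ V}
  {n : ℕ} {a b : Fin n → V} {f : V}

/-- Elements of the spin group that preserve a maximal isotropic subspace multiply its top product
by a scalar. -/
theorem exists_mul_vecProd_eq (hQ : (QuadraticMap.polarBilin Q).Nondegenerate)
    (haa : ∀ i j, QuadraticMap.polar Q (a i) (a j) = 0)
    (hab : ∀ i j, QuadraticMap.polar Q (a i) (b j) = if i = j then 1 else 0)
    (hspan : Submodule.span ℂ (Set.range a ∪ Set.range b ∪ {f}) = ⊤) {x : spinGroup Q}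
    (hx : ∀ i, vectorRep Q x⁻¹ (a i) ∈ Submodule.span ℂ (Set.range a)) :
    ∃ μ : ℂ, (x : CliffordAlgebra Q) * vecProd Q a (List.finRange n) =
      μ • vecProd Q a (List.finRange n) := by
  set ω := vecProd Q a (List.finRange n) with hω
  have hw : ∀ w ∈ Submodule.span ℂ (Set.range a), ι Q w * ω = 0 := by
    intro w hw
    have : Submodule.span ℂ (Set.range a) ≤
        LinearMap.ker ((LinearMap.mulRight ℂ ω) ∘ₗ ι Q) := by
      rw [Submodule.span_le]
      rintro _ ⟨i, rfl⟩
      exact ι_mul_vecProd haa (List.mem_finRange i)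
    exact this hw
  have hax : ∀ i, ι Q (a i) * ((x : CliffordAlgebra Q) * ω) = 0 := by
    intro i
    have h1 := ι_vectorRep_mul x (vectorRep Q x⁻¹ (a i))
    rw [← Module.End.mul_apply, ← map_mul, mul_inv_cancel, map_one, Module.End.one_apply] at h1
    rw [← mul_assoc, h1, mul_assoc, hw _ (hx i), mul_zero]
  have hinv : involute ((x : CliffordAlgebra Q) * ω) =
      (-1) ^ (List.finRange n).length * ((x : CliffordAlgebra Q) * ω) := by
    rw [map_mul, spinGroup.involute_eq x.2, involute_vecProd, ← mul_assoc, ← mul_assoc,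
      ((Commute.neg_one_right (x : CliffordAlgebra Q)).pow_right _).eq]
  -- `x * ω` is annihilated by every `a i`, hence equals `ω * t`. It remains to see that `t` is a
  -- scalar, that is, killed by the contractions with all `a i`, all `b i` and `f`.
  obtain ⟨t, ht, ht1, ht2, ht3⟩ := exists_eq_vecProd_mul hab (List.nodup_finRange n)
    (u := (x : CliffordAlgebra Q) * ω) fun i _ => hax i
  have hC : ∀ (t : CliffordAlgebra Q), (∀ i, contractLeft (QuadraticMap.polarBilin Q (a i)) t = 0) →
      (∀ i, contractLeft (QuadraticMap.polarBilin Q (b i)) t = 0) →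
      contractLeft (QuadraticMap.polarBilin Q f) t = 0 →
      ∃ r : ℂ, t = algebraMap ℂ _ r := by
    intro t h1 h2 h3
    refine scalar_of_contractLeft_eq_zero hQ fun v => ?_
    have : Submodule.span ℂ (Set.range a ∪ Set.range b ∪ {f}) ≤ LinearMap.ker
        ((contractLeft (Q := Q)).flip t ∘ₗ QuadraticMap.polarBilin Q) := by
      rw [Submodule.span_le]
      rintro _ ((⟨i, rfl⟩ | ⟨i, rfl⟩) | rfl)
      exacts [h1 i, h2 i, h3]
    rw [hspan] at this
    exact this (Submodule.mem_top (x := v))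
  have hta : ∀ i, contractLeft (QuadraticMap.polarBilin Q (a i)) t = 0 := by
    intro i
    apply ht1
    rw [← ι_mul_sub_involute_mul_ι, hax, hinv, mul_assoc, mul_assoc,
      vecProd_mul_ι fun j _ => haa j i, ι_mul_vecProd haa (List.mem_finRange i)]
    simp
  have htb : ∀ i, contractLeft (QuadraticMap.polarBilin Q (b i)) t = 0 :=
    fun i => ht2 i (List.mem_finRange i)
  have hteven := ht3 hinv
  -- This contraction is killed by all contractions, so it is a scalar; but it is odd because `t` is
  -- even, hence it vanishes.
  have htf : contractLeft (QuadraticMap.polarBilin Q f) t = 0 := by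
    obtain ⟨r, hr⟩ := hC (contractLeft (QuadraticMap.polarBilin Q f) t)
      (fun i => by rw [contractLeft_comm, hta, map_zero, neg_zero])
      (fun i => by rw [contractLeft_comm, htb, map_zero, neg_zero])
      (contractLeft_contractLeft _ _)
    have h1 := involute_contractLeft f t
    rw [hteven, hr, AlgHom.commutes, ← map_neg] at h1
    have h2 := self_eq_neg.1 (algebraMap_clifford_injective Q h1)
    rw [hr, h2, map_zero]
  obtain ⟨r, hr⟩ := hC t hta htb htf
  refine ⟨r, ?_⟩
  rw [ht, hr, Algebra.smul_def, Algebra.commutes]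

/-- The `a i` span a totally isotropic subspace, so their products factor through the exterior
algebra of ℂⁿ. There the ordered product is alternating of top degree and scales by the determinant.
-/
theorem vecProd_finRange_map {M : Matrix (Fin n) (Fin n) ℂ} {a' : Fin n → V}
    (haa : ∀ i j, QuadraticMap.polar Q (a i) (a j) = 0)
    (ha' : ∀ j, a' j = ∑ i, M i j • a i) :
    vecProd Q a' (List.finRange n) = M.det • vecProd Q a (List.finRange n) := by
  let T : (Fin n → ℂ) →ₗ[ℂ] V := Fintype.linearCombination ℂ a
  have hT : ∀ w, ι Q (T w) * ι Q (T w) = 0 := by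
    intro w
    have : QuadraticMap.polar Q (T w) (T w) = 0 := by
      have : (QuadraticMap.polarBilin Q).compl₁₂ T T = 0 := by
        refine (Pi.basisFun ℂ (Fin n)).ext fun i => (Pi.basisFun ℂ (Fin n)).ext fun j => ?_
        simp [T, haa]
      exact LinearMap.congr_fun (LinearMap.congr_fun this w) w
    rw [QuadraticMap.polar_self, two_smul, ← two_mul] at this
    rw [ι_sq_scalar, (mul_eq_zero.1 this).resolve_left two_ne_zero, map_zero]
  let F : (Fin n → ℂ) [⋀^Fin n]→ₗ[ℂ] CliffordAlgebra Q :=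
    (ExteriorAlgebra.lift ℂ ⟨ι Q ∘ₗ T, hT⟩).toLinearMap.compAlternatingMap
      (ExteriorAlgebra.ιMulti ℂ n)
  have hF : ∀ v, F v = vecProd Q (fun i => T (v i)) (List.finRange n) := by
    intro v
    simp only [F, LinearMap.compAlternatingMap_apply, ExteriorAlgebra.ιMulti_apply,
      AlgHom.toLinearMap_apply, map_list_prod, vecProd, List.ofFn_eq_map, List.map_map]
    congr 1
    refine List.map_congr_left fun i _ => ?_
    simp
  have h1 : F (fun j i => M i j) = M.det • F (Pi.basisFun ℂ (Fin n)) := by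
    rw [← sub_eq_zero, ← Module.forall_dual_apply_eq_zero_iff ℂ]
    intro l
    have h2 := (l.compAlternatingMap F).eq_smul_basis_det (Pi.basisFun ℂ (Fin n))
    have h3 := congrArg (fun z => z (fun j i => M i j)) h2
    simp only [LinearMap.compAlternatingMap_apply, AlternatingMap.smul_apply,
      Pi.basisFun_det_apply, smul_eq_mul] at h3
    rw [map_sub, map_smul, h3, smul_eq_mul, ← Matrix.det_transpose M]
    rw [sub_eq_zero, mul_comm]
    rfl
  rw [hF, hF] at h1
  have h4 : (fun j => T (fun i => M i j)) = a' := by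
    funext j; rw [ha']; simp [T, Fintype.linearCombination_apply]
  have h5 : (fun i => T (Pi.basisFun ℂ (Fin n) i)) = a := by
    funext j; simp [T]
  rwa [h4, h5] at h1

/-- The scalar by which an element of the spin group acts on the top product of a maximal isotropic
subspace is a square root of the determinant. -/
theorem sq_eq_det (haa : ∀ i j, QuadraticMap.polar Q (a i) (a j) = 0)
    (hab : ∀ i j, QuadraticMap.polar Q (a i) (b j) = if i = j then 1 else 0) {x : spinGroup Q}
    {M : Matrix (Fin n) (Fin n) ℂ} (hM : ∀ j, vectorRep Q x (a j) = ∑ i, M i j • a i) {μ : ℂ}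
    (hμ : (x : CliffordAlgebra Q) * vecProd Q a (List.finRange n) =
      μ • vecProd Q a (List.finRange n)) : μ ^ 2 = M.det := by
  set ω := vecProd Q a (List.finRange n) with hω
  have hω0 : ω ≠ 0 := vecProd_ne_zero hab (List.nodup_finRange n)
  obtain ⟨m, hm⟩ := exists_reverse_vecProd haa (List.finRange n)
  rw [← hω] at hm
  -- Reversal turns the left eigenvalue equation into a right one with the same `μ`. Conjugation by
  -- `x` thus multiplies `ω` by `μ²`, and by functoriality by the determinant.
  have h1 : ω * star (x : CliffordAlgebra Q) = μ • ω := by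
    have h2 := congrArg reverse hμ
    rw [reverse.map_mul, map_smul, hm, ← star_eq_reverse_of_mem_spinGroup x.2, mul_assoc,
      ← mul_smul_comm] at h2
    have h3 : ((-1 : CliffordAlgebra Q) ^ m) * (-1) ^ m = 1 := by
      rw [← pow_add, ← two_mul, pow_mul, neg_one_sq, one_pow]
    have h4 := congrArg (fun z => (-1) ^ m * z) h2
    simpa only [← mul_assoc, h3, one_mul] using h4
  have h5 := mul_vecProd_mul_star x a (List.finRange n)
  rw [vecProd_finRange_map haa hM, ← hω, hμ, smul_mul_assoc, h1, smul_smul, ← pow_two] at h5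
  exact smul_left_injective ℂ hω0 h5

end MaximalIsotropic

/-! ### The spinor character -/

/-- A continuous multiplicative function with values `±1` is a sign character that is trivial on the
identity component. -/
theorem exists_sign_hom {G : Type*} [TopologicalSpace G] [Group G] [IsTopologicalGroup G] {f : G → ℂ}
    (hf : Continuous f) (hmul : ∀ g h, f (g * h) = f g * f h) (hsq : ∀ g, f g * f g = 1) :
    ∃ φ : G →* ℤˣ, (∀ g, sg (φ g) = f g) ∧
      ∀ g ∈ Subgroup.connectedComponentOfOne G, φ g = 1 := by
  have h1 : f 1 = 1 := by
    have h2 := hmul 1 1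
    rw [mul_one, hsq] at h2
    exact h2
  have hcases : ∀ g, f g = 1 ∨ f g = -1 := fun g => mul_self_eq_one_iff.1 (hsq g)
  have hs : ∀ g, ∃ u : ℤˣ, sg u = f g := fun g => by
    rcases hcases g with h | h
    · exact ⟨1, by simp [h]⟩
    · exact ⟨-1, by simp [h]⟩
  choose φ hφ using hs
  have hinj : Function.Injective sg := fun u v h => Units.ext (Int.cast_injective (α := ℂ) h)
  refine ⟨⟨⟨φ, hinj (by rw [hφ, h1, sg_one])⟩, fun g h => hinj (by
    simp only [sg_mul, hφ, hmul])⟩, hφ, fun g hg => hinj ?_⟩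
  refine (hφ g).trans ?_
  rw [sg_one, ← h1]
  exact (isPreconnected_connectedComponent (x := (1 : G))).constant_of_mapsTo
    (T := {1, -1}) (Set.toFinite _).isDiscrete hf.continuousOn (fun g _ => hcases g) hg
    mem_connectedComponent

theorem exists_functional_vecProd {V : Type*} [AddCommGroup V] [Module ℂ V] {Q : QuadraticForm ℂ V}
    {n : ℕ} {a b : Fin n → V}
    (hab : ∀ i j, QuadraticMap.polar Q (a i) (b j) = if i = j then 1 else 0) :
    ∃ l : CliffordAlgebra Q →ₗ[ℂ] ℂ, l (vecProd Q a (List.finRange n)) = 1 := by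
  have h := vecProd_ne_zero hab (List.nodup_finRange n)
  obtain ⟨l, hl⟩ : ∃ l : Module.Dual ℂ (CliffordAlgebra Q), l (vecProd Q a (List.finRange n)) ≠ 0 := by
    by_contra! hc
    exact h ((Module.forall_dual_apply_eq_zero_iff ℂ _).1 hc)
  exact ⟨(l (vecProd Q a (List.finRange n)))⁻¹ • l, by simp [hl]⟩

section SpinorCharacter

variable {U₁ U₂ : Type*} [AddCommGroup U₁] [Module ℂ U₁] [AddCommGroup U₂] [Module ℂ U₂]
  [FiniteDimensional ℂ U₁] [FiniteDimensional ℂ U₂]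
  {Q₁ : QuadraticForm ℂ U₁} {Q₂ : QuadraticForm ℂ U₂}

/-- A group of pairs that acts on two maximal isotropic subspaces with inverse determinants has a
sign character that is nontrivial at `(-1, 1)`. -/
theorem exists_spinor_character (hQ₁ : (QuadraticMap.polarBilin Q₁).Nondegenerate)
    (hQ₂ : (QuadraticMap.polarBilin Q₂).Nondegenerate)
    (P : Subgroup (spinGroup Q₁ × spinGroup Q₂)) {n₁ n₂ : ℕ} {a₁ b₁ : Fin n₁ → U₁}
    {a₂ b₂ : Fin n₂ → U₂} {f₁ : U₁} {f₂ : U₂}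
    (haa₁ : ∀ i j, QuadraticMap.polar Q₁ (a₁ i) (a₁ j) = 0)
    (hab₁ : ∀ i j, QuadraticMap.polar Q₁ (a₁ i) (b₁ j) = if i = j then 1 else 0)
    (hspan₁ : Submodule.span ℂ (Set.range a₁ ∪ Set.range b₁ ∪ {f₁}) = ⊤)
    (haa₂ : ∀ i j, QuadraticMap.polar Q₂ (a₂ i) (a₂ j) = 0)
    (hab₂ : ∀ i j, QuadraticMap.polar Q₂ (a₂ i) (b₂ j) = if i = j then 1 else 0)
    (hspan₂ : Submodule.span ℂ (Set.range a₂ ∪ Set.range b₂ ∪ {f₂}) = ⊤)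
    (hP : ∀ g : P, ∃ (M₁ : Matrix (Fin n₁) (Fin n₁) ℂ) (M₂ : Matrix (Fin n₂) (Fin n₂) ℂ),
      (∀ j, vectorRep Q₁ g.1.1 (a₁ j) = ∑ i, M₁ i j • a₁ i) ∧
      (∀ j, vectorRep Q₂ g.1.2 (a₂ j) = ∑ i, M₂ i j • a₂ i) ∧ M₁.det * M₂.det = 1) :
    ∃ φ : P →* ℤˣ, (∀ g ∈ Subgroup.connectedComponentOfOne P, φ g = 1) ∧
      ∀ g : P, (g.1.1 : CliffordAlgebra Q₁) = -1 → g.1.2 = 1 → φ g = -1 := by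
  have hμ₁ : ∀ g : P, ∃ μ : ℂ, (g.1.1 : CliffordAlgebra Q₁) * vecProd Q₁ a₁ (List.finRange n₁) =
      μ • vecProd Q₁ a₁ (List.finRange n₁) := fun g =>
    exists_mul_vecProd_eq hQ₁ haa₁ hab₁ hspan₁ fun j => by
      obtain ⟨M₁, -, h, -⟩ := hP g⁻¹
      rw [← Prod.fst_inv, ← Subgroup.coe_inv, h]
      exact Submodule.sum_mem _ fun i _ => Submodule.smul_mem _ _ (Submodule.subset_span ⟨i, rfl⟩)
  have hμ₂ : ∀ g : P, ∃ μ : ℂ, (g.1.2 : CliffordAlgebra Q₂) * vecProd Q₂ a₂ (List.finRange n₂) =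
      μ • vecProd Q₂ a₂ (List.finRange n₂) := fun g =>
    exists_mul_vecProd_eq hQ₂ haa₂ hab₂ hspan₂ fun j => by
      obtain ⟨-, M₂, -, h, -⟩ := hP g⁻¹
      rw [← Prod.snd_inv, ← Subgroup.coe_inv, h]
      exact Submodule.sum_mem _ fun i _ => Submodule.smul_mem _ _ (Submodule.subset_span ⟨i, rfl⟩)
  choose μ₁ hμ₁ using hμ₁
  choose μ₂ hμ₂ using hμ₂
  obtain ⟨l₁, hl₁⟩ := exists_functional_vecProd hab₁
  obtain ⟨l₂, hl₂⟩ := exists_functional_vecProd hab₂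
  set ω₁ := vecProd Q₁ a₁ (List.finRange n₁)
  set ω₂ := vecProd Q₂ a₂ (List.finRange n₂)
  -- Evaluating a functional normalized on `ω₁` expresses the eigenvalue linearly in the spin
  -- element, which gives continuity and the values at ±1.
  have e₁ : ∀ g : P, μ₁ g = l₁ ((g.1.1 : CliffordAlgebra Q₁) * ω₁) := fun g => by
    rw [hμ₁, map_smul, hl₁, smul_eq_mul, mul_one]
  have e₂ : ∀ g : P, μ₂ g = l₂ ((g.1.2 : CliffordAlgebra Q₂) * ω₂) := fun g => by
    rw [hμ₂, map_smul, hl₂, smul_eq_mul, mul_one]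
  have c₁ : Continuous μ₁ := by
    rw [show μ₁ = fun g => l₁ ((g.1.1 : CliffordAlgebra Q₁) * ω₁) from funext e₁]
    exact (continuous_clifford_functional (l₁ ∘ₗ LinearMap.mulRight ℂ ω₁)).comp
      (continuous_subtype_val.comp (continuous_fst.comp continuous_subtype_val))
  have c₂ : Continuous μ₂ := by
    rw [show μ₂ = fun g => l₂ ((g.1.2 : CliffordAlgebra Q₂) * ω₂) from funext e₂]
    exact (continuous_clifford_functional (l₂ ∘ₗ LinearMap.mulRight ℂ ω₂)).comp
      (continuous_subtype_val.comp (continuous_snd.comp continuous_subtype_val))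
  have m₁ : ∀ g h, μ₁ (g * h) = μ₁ g * μ₁ h := fun g h => by
    rw [e₁, Subgroup.coe_mul, Prod.fst_mul, Submonoid.coe_mul, mul_assoc, hμ₁, mul_smul_comm, hμ₁,
      smul_smul, map_smul, hl₁, smul_eq_mul, mul_one, mul_comm]
  have m₂ : ∀ g h, μ₂ (g * h) = μ₂ g * μ₂ h := fun g h => by
    rw [e₂, Subgroup.coe_mul, Prod.snd_mul, Submonoid.coe_mul, mul_assoc, hμ₂, mul_smul_comm, hμ₂,
      smul_smul, map_smul, hl₂, smul_eq_mul, mul_one, mul_comm]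
  obtain ⟨φ, hφ, hφ0⟩ := exists_sign_hom (f := fun g => μ₁ g * μ₂ g) (c₁.fun_mul c₂)
    (fun g h => by simp only [m₁, m₂]; ring) (fun g => by
      obtain ⟨M₁, M₂, h₁, h₂, hd⟩ := hP g
      have s₁ := sq_eq_det haa₁ hab₁ h₁ (hμ₁ g)
      have s₂ := sq_eq_det haa₂ hab₂ h₂ (hμ₂ g)
      rw [← hd, ← s₁, ← s₂]
      ring)
  refine ⟨φ, hφ0, fun g h1 h2 => ?_⟩
  have h3 := hφ g
  rw [e₁, e₂, h1, h2, neg_one_mul, map_neg, hl₁, OneMemClass.coe_one, one_mul, hl₂, mul_one,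
    ← sg_neg_one] at h3
  exact Units.ext (Int.cast_injective (α := ℂ) h3)

end SpinorCharacter

section Border

/-- A square matrix enlarged by a first row and a first column that vanishes below the corner. -/
def border {n : ℕ} (e : ℂ) (r : Fin n → ℂ) (N : Matrix (Fin n) (Fin n) ℂ) :
    Matrix (Fin (n + 1)) (Fin (n + 1)) ℂ :=
  Matrix.of (Fin.cons (Fin.cons e r) fun i => Fin.cons 0 (N i))

theorem det_border {n : ℕ} (e : ℂ) (r : Fin n → ℂ) (N : Matrix (Fin n) (Fin n) ℂ) :
    (border e r N).det = e * N.det := by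
  rw [Matrix.det_succ_column_zero, Fin.sum_univ_succ, Finset.sum_eq_zero]
  · have : (border e r N).submatrix (Fin.succAbove 0) Fin.succ = N := by
      ext i j; simp [border]
    rw [this]
    simp [border]
  · intro i _
    simp [border]

end Border

/-! ### Determinants on the invariant isotropic subspaces -/

namespace AdaptedFrame

variable {U₁ U₂ : Type*} [AddCommGroup U₁] [Module ℂ U₁] [AddCommGroup U₂] [Module ℂ U₂]
  {Q₁ : QuadraticForm ℂ U₁} {Q₂ : QuadraticForm ℂ U₂} {α : U₁ →ₗ[ℂ] U₂} {β : U₂ →ₗ[ℂ] U₁}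
  {k c d : ℕ} (A : AdaptedFrame Q₁ Q₂ α β k c d)
  {h : (Module.End ℂ U₁)ˣ × (Module.End ℂ U₂)ˣ}

theorem eq_sum_of_mem_range {u : U₁} (hu : u ∈ LinearMap.range β) :
    u = ∑ o, A.fr₁.basis.repr u (.inr (.inl o)) • A.fr₁.y o := by
  obtain ⟨w, rfl⟩ := hu
  nth_rewrite 1 [← A.fr₁.sum_repr (β w)]
  have h1 : ∀ i, A.fr₁.basis.repr (β w) (.inl i) = 0 := by
    intro i
    rw [A.β_apply]
    simp [WittFrame.y]
  simp [h1, A.repr_range]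

theorem eq_sum_of_mem_span {w : U₂} (hw : w ∈ Submodule.span ℂ (Set.range A.fr₂.x)) :
    w = ∑ i, A.fr₂.basis.repr w (.inl i) • A.fr₂.x i := by
  have h1 : ∀ i, A.fr₂.basis.repr w (.inr (.inl i)) = 0 := by
    intro i
    have : Submodule.span ℂ (Set.range A.fr₂.x) ≤
        LinearMap.ker (A.fr₂.basis.coord (.inr (.inl i))) := by
      rw [Submodule.span_le]
      rintro _ ⟨i, rfl⟩
      simp [WittFrame.x]
    exact this hw
  nth_rewrite 1 [← A.fr₂.sum_repr w]
  simp [h1, A.repr_span hw]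

/-- The matrix of the action on the span of the vectors `x i` of the second space. -/
def matX (h : (Module.End ℂ U₁)ˣ × (Module.End ℂ U₂)ˣ) : Matrix (Fin k) (Fin k) ℂ :=
  Matrix.of fun i j => A.fr₂.basis.repr (h.2.val (A.fr₂.x j)) (.inl i)

/-- The matrix of the action on the span of the vectors `y (some i)` of the first space, modulo
`y none`. -/
def matY (h : (Module.End ℂ U₁)ˣ × (Module.End ℂ U₂)ˣ) : Matrix (Fin k) (Fin k) ℂ :=
  Matrix.of fun i j =>
    A.fr₁.basis.repr (h.1.val (A.fr₁.y (some j))) (.inr (.inl (some i)))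

theorem map_x_eq (hh : h ∈ isometryCentralizer Q₁ Q₂ α β) (j : Fin k) :
    h.2.val (A.fr₂.x j) = ∑ i, A.matX h i j • A.fr₂.x i :=
  A.eq_sum_of_mem_span (A.map_x_mem hh j)

theorem map_y_eq (hh : h ∈ isometryCentralizer Q₁ Q₂ α β) (j : Fin k) :
    h.1.val (A.fr₁.y (some j)) =
      A.fr₁.basis.repr (h.1.val (A.fr₁.y (some j))) (.inr (.inl none)) • A.fr₁.y none +
        ∑ i, A.matY h i j • A.fr₁.y (some i) := by
  conv_lhs => rw [A.eq_sum_of_mem_range (A.map_y_mem hh (some j)), Fintype.sum_option]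
  rfl

/-- By skewness the pairing of the `x i` with the `y j` in the second space equals that of the `y
(some j)` with the `x (some i)` in the first, so invariance of the form makes the two actions
contragredient. -/
theorem det_matX_mul_det_matY (hh : h ∈ isometryCentralizer Q₁ Q₂ α β) :
    (A.matX h).det * (A.matY h).det = 1 := by
  have : (A.matX h).transpose * A.matY h = 1 := by
    ext i j
    have h1 : QuadraticMap.polar Q₂ (h.2.val (A.fr₂.x i)) (h.2.val (A.fr₂.y j)) =
        QuadraticMap.polar Q₂ (A.fr₂.x i) (A.fr₂.y j) := by
      rw [QuadraticMap.polar, ← map_add, hh.2.1, hh.2.1, hh.2.1, QuadraticMap.polar]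
    rw [A.fr₂.polar_xy', A.map_x_eq hh] at h1
    rw [Matrix.one_apply, ← h1, Matrix.mul_apply, ← QuadraticMap.polarBilin_apply_apply,
      map_sum, LinearMap.sum_apply]
    refine Finset.sum_congr rfl fun l _ => ?_
    rw [map_smul, LinearMap.smul_apply, QuadraticMap.polarBilin_apply_apply, smul_eq_mul,
      Matrix.transpose_apply, ← A.α_x_some, A.skew, ← hh.2.2.2, A.β_y, map_neg,
      QuadraticMap.polar_neg_right, neg_neg, QuadraticMap.polar_comm, ← A.fr₁.repr_y]
    rfl
  have h2 := congrArg Matrix.det this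
  rwa [Matrix.det_mul, Matrix.det_transpose, Matrix.det_one] at h2

theorem map_cons_y (hh : h ∈ isometryCentralizer Q₁ Q₂ α β) {e : ℂ}
    (he : h.1.val (A.fr₁.y none) = e • A.fr₁.y none) (j : Fin (k + 1)) :
    h.1.val ((Fin.cons (A.fr₁.y none) fun i => A.fr₁.y (some i) : Fin (k + 1) → U₁) j) =
      ∑ i, border e
        (fun j => A.fr₁.basis.repr (h.1.val (A.fr₁.y (some j))) (.inr (.inl none))) (A.matY h) i j •
        (Fin.cons (A.fr₁.y none) fun i => A.fr₁.y (some i) : Fin (k + 1) → U₁) i := by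
  rw [Fin.sum_univ_succ]
  refine Fin.cases ?_ (fun j => ?_) j
  · simp [border, he]
  · simp only [Fin.cons_succ, border, Matrix.of_apply, Fin.cons_zero]
    exact A.map_y_eq hh j

end AdaptedFrame

/-! ### The spinor characters for a single row of length one -/

namespace AdaptedFrame

variable {U₁ U₂ : Type*} [AddCommGroup U₁] [Module ℂ U₁] [AddCommGroup U₂] [Module ℂ U₂]
  {Q₁ : QuadraticForm ℂ U₁} {Q₂ : QuadraticForm ℂ U₂} {α : U₁ →ₗ[ℂ] U₂} {β : U₂ →ₗ[ℂ] U₁}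
  {k c d : ℕ}

theorem polar_cons_y (A : AdaptedFrame Q₁ Q₂ α β k c d) (i j : Fin (k + 1)) :
    QuadraticMap.polar Q₁
      ((Fin.cons (A.fr₁.y none) fun i => A.fr₁.y (some i) : Fin (k + 1) → U₁) i)
      ((Fin.cons (A.fr₁.y none) fun i => A.fr₁.y (some i) : Fin (k + 1) → U₁) j) = 0 := by
  have h : ∀ i j, QuadraticMap.polar Q₁ (A.fr₁.y i) (A.fr₁.y j) = 0 := A.fr₁.polar_yy
  refine Fin.cases ?_ (fun i => ?_) i <;> refine Fin.cases ?_ (fun j => ?_) j <;> simp [h]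

theorem polar_cons_y_cons_x (A : AdaptedFrame Q₁ Q₂ α β k c d) (i j : Fin (k + 1)) :
    QuadraticMap.polar Q₁
      ((Fin.cons (A.fr₁.y none) fun i => A.fr₁.y (some i) : Fin (k + 1) → U₁) i)
      ((Fin.cons (A.fr₁.x none) fun i => A.fr₁.x (some i) : Fin (k + 1) → U₁) j) =
        if i = j then 1 else 0 := by
  refine Fin.cases ?_ (fun i => ?_) i <;> refine Fin.cases ?_ (fun j => ?_) j <;>
    simp [A.fr₁.polar_yx', Fin.succ_ne_zero, eq_comm]

theorem span_cons_y_cons_x (A : AdaptedFrame Q₁ Q₂ α β k c d) {f : U₁}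
    (hf : ∀ j, A.fr₁.l j ∈ Submodule.span ℂ {f}) :
    Submodule.span ℂ
      (Set.range (Fin.cons (A.fr₁.y none) fun i => A.fr₁.y (some i) : Fin (k + 1) → U₁) ∪
      Set.range (Fin.cons (A.fr₁.x none) fun i => A.fr₁.x (some i) : Fin (k + 1) → U₁) ∪ {f}) =
      ⊤ := by
  rw [eq_top_iff, ← A.fr₁.basis.span_eq, Submodule.span_le]
  rintro _ ⟨(i | i | j), rfl⟩
  · refine Submodule.subset_span (.inl (.inr ?_))
    cases i with
    | none => exact ⟨0, rfl⟩
    | some i => exact ⟨i.succ, rfl⟩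
  · refine Submodule.subset_span (.inl (.inl ?_))
    cases i with
    | none => exact ⟨0, rfl⟩
    | some i => exact ⟨i.succ, rfl⟩
  · exact Submodule.span_mono Set.subset_union_right (hf j)

theorem map_l_some (A : AdaptedFrame Q₁ Q₂ α β k c 1)
    {h : (Module.End ℂ U₁)ˣ × (Module.End ℂ U₂)ˣ} (hh : h ∈ isometryCentralizer Q₁ Q₂ α β) :
    h.2.val (A.fr₂.l (some 0)) =
      ∑ i, A.fr₂.basis.repr (h.2.val (A.fr₂.l (some 0))) (.inl i) • A.fr₂.x i +
        A.fr₂.basis.repr (h.2.val (A.fr₂.l (some 0))) (.inr (.inr (some 0))) •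
          A.fr₂.l (some 0) := by
  set v := h.2.val (A.fr₂.l (some 0)) with hvdef
  have hv : β v = 0 := by rw [hvdef, ← hh.2.2.2, A.β_l_some, map_zero]
  have hl0 : A.fr₂.basis.repr v (.inr (.inr none)) = 0 := by
    have h1 := congrArg (fun z => A.fr₁.basis.repr z (.inr (.inl none))) hv
    rw [A.β_apply] at h1
    simpa [WittFrame.y, Finsupp.single_apply] using h1
  have hy0 : ∀ i, A.fr₂.basis.repr v (.inr (.inl i)) = 0 := by
    intro i
    have h1 := congrArg (fun z => A.fr₁.basis.repr z (.inr (.inl (some i)))) hv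
    rw [A.β_apply] at h1
    simpa [WittFrame.y, Finsupp.single_apply] using h1
  have hv2 := A.fr₂.sum_repr v
  simp only [Fintype.sum_option, hl0, hy0, zero_smul, Finset.sum_const_zero, zero_add,
    Fin.sum_univ_one] at hv2
  exact hv2.symm

/-- `l none` is the image of `x none` under `α`, so its coefficient is that of `x none`, which
equals the eigenvalue on `y none`. -/
theorem map_l_none (A : AdaptedFrame Q₁ Q₂ α β k c d)
    {h : (Module.End ℂ U₁)ˣ × (Module.End ℂ U₂)ˣ} (hh : h ∈ isometryCentralizer Q₁ Q₂ α β) {e : ℂ}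
    (he : h.1.val (A.fr₁.y none) = e • A.fr₁.y none) :
    ∃ p : Fin k → ℂ, h.2.val (A.fr₂.l none) = ∑ i, p i • A.fr₂.x i + e • A.fr₂.l none := by
  have h1 := A.map_y_none hh
  rw [he] at h1
  have h2 := smul_left_injective ℂ (A.y_ne_zero none) h1
  refine ⟨fun i => A.fr₁.basis.repr (h.1.val (A.fr₁.x none)) (.inl (some i)), ?_⟩
  rw [← A.α_x_none, hh.2.2.1, A.α_apply, ← h2, A.α_x_none, add_comm]

variable [FiniteDimensional ℂ U₁] [FiniteDimensional ℂ U₂]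

/-- The spinor character for one additional vector in the first space. -/
theorem exists_character_fst (A : AdaptedFrame Q₁ Q₂ α β k 1 0)
    (hQ₁ : (QuadraticMap.polarBilin Q₁).Nondegenerate)
    (hQ₂ : (QuadraticMap.polarBilin Q₂).Nondegenerate) :
    ∃ φ : pairCentralizer Q₁ Q₂ α β →* ℤˣ,
      (∀ g ∈ Subgroup.connectedComponentOfOne (pairCentralizer Q₁ Q₂ α β), φ g = 1) ∧
      ∀ g : pairCentralizer Q₁ Q₂ α β, (g.1.1 : CliffordAlgebra Q₁) = -1 → g.1.2 = 1 →
        φ g = -1 := by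
  refine exists_spinor_character hQ₁ hQ₂ (pairCentralizer Q₁ Q₂ α β)
    (a₂ := A.fr₂.x) (b₂ := A.fr₂.y) (f₁ := A.fr₁.l 0) (f₂ := A.fr₂.l none)
    A.polar_cons_y A.polar_cons_y_cons_x
    (A.span_cons_y_cons_x fun j => by
      rw [Subsingleton.elim j 0]; exact Submodule.mem_span_singleton_self _)
    A.fr₂.polar_xx A.fr₂.polar_xy' ?_ fun g => ?_
  · rw [eq_top_iff, ← A.fr₂.basis.span_eq, Submodule.span_le]
    rintro _ ⟨(i | i | j), rfl⟩
    · exact Submodule.subset_span (.inl (.inl ⟨i, rfl⟩))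
    · exact Submodule.subset_span (.inl (.inr ⟨i, rfl⟩))
    · rw [Subsingleton.elim j none]
      exact Submodule.subset_span (.inr rfl)
  · have hh := (unitsRep_mem_iff g.1).2 g.2
    obtain ⟨ε, hε⟩ := A.exists_sign_y_none hh
    -- Only `y none` enlarges an isotropic span here, so its sign would enter the product of
    -- determinants just once; for `d = 0` this sign is 1.
    have h1 := (A.mem_neutralImage_and_eq_one hQ₁ hQ₂ g hε).2.1 rfl
    refine ⟨_, A.matX (unitsRep Q₁ Q₂ g), A.map_cons_y hh hε, A.map_x_eq hh, ?_⟩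
    rw [det_border, h1, sg_one, one_mul, mul_comm]
    exact A.det_matX_mul_det_matY hh

/-- The coefficient `F` of `l (some 0)` is a continuous character with values ±1, hence 1 on the
identity component. Up to that component `g` acts as the simultaneous change of sign of the long
string and of `l (some 0)` by `ε`, so `F g = ε`. -/
theorem map_l_some_eq (A : AdaptedFrame Q₁ Q₂ α β k c 1)
    (hQ₁ : (QuadraticMap.polarBilin Q₁).Nondegenerate)
    (hQ₂ : (QuadraticMap.polarBilin Q₂).Nondegenerate) (g : pairCentralizer Q₁ Q₂ α β) {ε : ℤˣ}
    (hε : vectorRep Q₁ g.1.1 (A.fr₁.y none) = sg ε • A.fr₁.y none) :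
    ∃ p : Fin k → ℂ, vectorRep Q₂ g.1.2 (A.fr₂.l (some 0)) =
      ∑ i, p i • A.fr₂.x i + sg ε • A.fr₂.l (some 0) := by
  set F : pairCentralizer Q₁ Q₂ α β → ℂ := fun g =>
    A.fr₂.basis.repr (vectorRep Q₂ g.1.2 (A.fr₂.l (some 0))) (.inr (.inr (some 0))) with hF
  have hdec : ∀ g : pairCentralizer Q₁ Q₂ α β, ∃ p : Fin k → ℂ,
      vectorRep Q₂ g.1.2 (A.fr₂.l (some 0)) = ∑ i, p i • A.fr₂.x i + F g • A.fr₂.l (some 0) :=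
    fun g => ⟨_, A.map_l_some ((unitsRep_mem_iff g.1).2 g.2)⟩
  have hspan : ∀ p : Fin k → ℂ, ∑ i, p i • A.fr₂.x i ∈ Submodule.span ℂ (Set.range A.fr₂.x) :=
    fun p => Submodule.sum_mem _ fun i _ => Submodule.smul_mem _ _ (Submodule.subset_span ⟨i, rfl⟩)
  have hl : A.fr₂.basis.repr (A.fr₂.l (some 0)) (.inr (.inr (some 0))) = 1 := by
    simp [WittFrame.l]
  have hcont : Continuous F := (continuous_vectorRep_functional
    (A.fr₂.basis.coord (.inr (.inr (some 0)))) (A.fr₂.l (some 0))).comp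
      (continuous_snd.comp continuous_subtype_val)
  have hmul : ∀ g h, F (g * h) = F g * F h := by
    intro g h
    obtain ⟨p, hp⟩ := hdec h
    have h1 : vectorRep Q₂ (g * h).1.2 (A.fr₂.l (some 0)) =
        ∑ i, p i • vectorRep Q₂ g.1.2 (A.fr₂.x i) +
          F h • vectorRep Q₂ g.1.2 (A.fr₂.l (some 0)) := by
      rw [Subgroup.coe_mul, Prod.snd_mul, map_mul, Module.End.mul_apply, hp]
      simp
    have h2 : ∑ i, p i • vectorRep Q₂ g.1.2 (A.fr₂.x i) ∈
        Submodule.span ℂ (Set.range A.fr₂.x) :=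
      Submodule.sum_mem _ fun i _ => Submodule.smul_mem _ _
        (A.map_x_mem ((unitsRep_mem_iff g.1).2 g.2) i)
    simp only [hF] at h1 ⊢
    rw [h1, map_add, Finsupp.add_apply, A.repr_span h2, zero_add, map_smul, Finsupp.smul_apply,
      smul_eq_mul, mul_comm]
  have hsq : ∀ g, F g * F g = 1 := by
    intro g
    obtain ⟨p, hp⟩ := hdec g
    have h1 := polar_isometry (Q₁ := Q₂) (Q₂ := Q₁) (α := β) (β := α)
      (h := (unitsRep Q₁ Q₂ g).swap) ⟨vectorRep_isometry g.1.2, vectorRep_isometry g.1.1,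
        g.2.2, g.2.1⟩ (A.fr₂.l (some 0)) (A.fr₂.l (some 0))
    have h2 : vectorRep Q₂ g.1.2 (A.fr₂.l (some 0)) =
        ∑ i, p i • A.fr₂.x i + F g • A.fr₂.l (some 0) := hp
    set X := ∑ i, p i • A.fr₂.x i with hX
    have hXx : ∀ j, QuadraticMap.polar Q₂ X (A.fr₂.x j) = 0 := fun j => by
      rw [← A.fr₂.repr_y]
      simp [hX, WittFrame.x]
    have hXX : QuadraticMap.polar Q₂ X X = 0 := by
      nth_rewrite 2 [hX]
      rw [← QuadraticMap.polarBilin_apply_apply, map_sum]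
      refine Finset.sum_eq_zero fun j _ => ?_
      rw [map_smul, QuadraticMap.polarBilin_apply_apply, hXx, smul_zero]
    have hXl : QuadraticMap.polar Q₂ (A.fr₂.l (some 0)) X = 0 := by
      rw [← QuadraticMap.polarBilin_apply_apply, hX, map_sum]
      refine Finset.sum_eq_zero fun j _ => ?_
      rw [map_smul, QuadraticMap.polarBilin_apply_apply, QuadraticMap.polar_comm,
        show QuadraticMap.polar Q₂ (A.fr₂.x j) (A.fr₂.l (some 0)) = 0 from A.fr₂.polar_xl _ _,
        smul_zero]
    have h3 : QuadraticMap.polar Q₂ (A.fr₂.l (some 0)) (A.fr₂.l (some 0)) ≠ 0 := by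
      rw [QuadraticMap.polar_self, two_smul, ← two_mul]
      exact mul_ne_zero two_ne_zero (A.fr₂.polar_l_ne_zero _)
    have h4 : QuadraticMap.polar Q₂ (X + F g • A.fr₂.l (some 0)) (X + F g • A.fr₂.l (some 0)) =
        QuadraticMap.polar Q₂ (A.fr₂.l (some 0)) (A.fr₂.l (some 0)) := by
      rw [← h2]; exact h1
    rw [QuadraticMap.polar_add_left, QuadraticMap.polar_add_right, QuadraticMap.polar_add_right,
      hXX, QuadraticMap.polar_smul_left, QuadraticMap.polar_smul_left,
      QuadraticMap.polar_smul_right, QuadraticMap.polar_smul_right, hXl,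
      QuadraticMap.polar_comm Q₂ X, hXl] at h4
    refine mul_right_cancel₀ h3 ?_
    rw [one_mul]
    refine Eq.trans ?_ h4
    simp only [smul_eq_mul]
    ring
  obtain ⟨φ, hφ, hφ0⟩ := exists_sign_hom hcont hmul hsq
  obtain ⟨g₀, hg₀, hg₀'⟩ := mem_neutralImage.1
    ((A.mem_neutralImage_and_eq_one hQ₁ hQ₂ g hε).2.2 0 rfl)
  obtain ⟨p, hp⟩ := hdec g
  refine ⟨p, ?_⟩
  have h1 : F g₀ = sg ε * F g := by
    have h2 : vectorRep Q₂ g₀.1.2 (A.fr₂.l (some 0)) =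
        sg ε • vectorRep Q₂ g.1.2 (A.fr₂.l (some 0)) := by
      have := congrArg (fun z => z.2.val (A.fr₂.l (some 0))) hg₀'
      simp only [unitsRep_snd, Prod.snd_mul, Units.val_mul, Module.End.mul_apply, signPair_snd_mk,
        WittFrame.sign_l, Option.elim_some, Pi.mulSingle_eq_same, map_smul] at this
      exact this
    simp only [hF]
    rw [h2, map_smul, Finsupp.smul_apply, smul_eq_mul]
  rw [← hφ g₀, hφ0 g₀ hg₀, sg_one] at h1
  have h2 : F g = sg ε := by
    calc F g = sg ε * sg ε * F g := by rw [sg_mul_self, one_mul]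
      _ = sg ε := by rw [mul_assoc, ← h1, mul_one]
  rw [hp, h2]

/-- The spinor character for one additional vector in the second space. -/
theorem exists_character_snd (A : AdaptedFrame Q₁ Q₂ α β k 0 1)
    (hQ₁ : (QuadraticMap.polarBilin Q₁).Nondegenerate)
    (hQ₂ : (QuadraticMap.polarBilin Q₂).Nondegenerate) :
    ∃ φ : pairCentralizer Q₁ Q₂ α β →* ℤˣ,
      (∀ g ∈ Subgroup.connectedComponentOfOne (pairCentralizer Q₁ Q₂ α β), φ g = 1) ∧
      ∀ g : pairCentralizer Q₁ Q₂ α β, (g.1.1 : CliffordAlgebra Q₁) = -1 → g.1.2 = 1 →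
        φ g = -1 := by
  -- The second space has dimension `2k + 2`, so the span of the `x i` is not maximal isotropic. It
  -- is enlarged by an isotropic combination `n` of `l none` and `l (some 0)`; modulo the `x i`,
  -- both are scaled by the same `ε`, and hence so is `n`.
  obtain ⟨r, s, r', s', hx, hy, hxy, -⟩ :=
    A.fr₂.exists_hyperbolic_pair (i := none) (j := some 0) (by simp)
  set n := r • A.fr₂.l none + s • A.fr₂.l (some 0) with hn
  set n' := r' • A.fr₂.l none + s' • A.fr₂.l (some 0) with hn'
  have hxl : ∀ i j, QuadraticMap.polar Q₂ (A.fr₂.x i) (A.fr₂.l j) = 0 := A.fr₂.polar_xl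
  have hyl : ∀ i j, QuadraticMap.polar Q₂ (A.fr₂.y i) (A.fr₂.l j) = 0 := A.fr₂.polar_yl
  have hxx : ∀ i j, QuadraticMap.polar Q₂ (A.fr₂.x i) (A.fr₂.x j) = 0 := A.fr₂.polar_xx
  have hyy : ∀ i j, QuadraticMap.polar Q₂ (A.fr₂.y i) (A.fr₂.y j) = 0 := A.fr₂.polar_yy
  have hxn : ∀ i, QuadraticMap.polar Q₂ (A.fr₂.x i) n = 0 := fun i => by
    simp [hn, QuadraticMap.polar_add_right, QuadraticMap.polar_smul_right, hxl]
  have hxn' : ∀ i, QuadraticMap.polar Q₂ (A.fr₂.x i) n' = 0 := fun i => by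
    simp [hn', QuadraticMap.polar_add_right, QuadraticMap.polar_smul_right, hxl]
  have hyn : ∀ i, QuadraticMap.polar Q₂ (A.fr₂.y i) n = 0 := fun i => by
    simp [hn, QuadraticMap.polar_add_right, QuadraticMap.polar_smul_right, hyl]
  have hyn' : ∀ i, QuadraticMap.polar Q₂ (A.fr₂.y i) n' = 0 := fun i => by
    simp [hn', QuadraticMap.polar_add_right, QuadraticMap.polar_smul_right, hyl]
  have haa : ∀ i j, QuadraticMap.polar Q₂ ((Fin.cons n A.fr₂.x : Fin (k + 1) → U₂) i)
      ((Fin.cons n A.fr₂.x : Fin (k + 1) → U₂) j) = 0 := by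
    intro i j
    refine Fin.cases ?_ (fun i => ?_) i <;> refine Fin.cases ?_ (fun j => ?_) j <;>
      simp [hxx, hxn, QuadraticMap.polar_comm Q₂ n, QuadraticMap.polar_self, hx]
  have hbb : ∀ i j, QuadraticMap.polar Q₂ ((Fin.cons n' A.fr₂.y : Fin (k + 1) → U₂) i)
      ((Fin.cons n' A.fr₂.y : Fin (k + 1) → U₂) j) = 0 := by
    intro i j
    refine Fin.cases ?_ (fun i => ?_) i <;> refine Fin.cases ?_ (fun j => ?_) j <;>
      simp [hyy, hyn', QuadraticMap.polar_comm Q₂ n', QuadraticMap.polar_self, hy]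
  have hab : ∀ i j, QuadraticMap.polar Q₂ ((Fin.cons n A.fr₂.x : Fin (k + 1) → U₂) i)
      ((Fin.cons n' A.fr₂.y : Fin (k + 1) → U₂) j) = if i = j then 1 else 0 := by
    intro i j
    refine Fin.cases ?_ (fun i => ?_) i <;> refine Fin.cases ?_ (fun j => ?_) j
    · simpa using hxy
    · rw [QuadraticMap.polar_comm]
      simp [hyn, (Fin.succ_ne_zero _).symm]
    · simp [hxn', Fin.succ_ne_zero]
    · simp [A.fr₂.polar_xy']
  refine exists_spinor_character hQ₁ hQ₂ (pairCentralizer Q₁ Q₂ α β) (f₁ := 0) (f₂ := 0)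
    A.polar_cons_y A.polar_cons_y_cons_x (A.span_cons_y_cons_x fun j => j.elim0)
    haa hab ?_ fun g => ?_
  · have hli : LinearIndependent ℂ (Sum.elim (Fin.cons n A.fr₂.x : Fin (k + 1) → U₂)
        (Fin.cons n' A.fr₂.y : Fin (k + 1) → U₂)) := by
      refine linearIndependent_of_dual (Q := Q₂) (v' := Sum.elim
        (Fin.cons n' A.fr₂.y : Fin (k + 1) → U₂) (Fin.cons n A.fr₂.x : Fin (k + 1) → U₂)) ?_
      rintro (i | i) (j | j)
      · simpa using hab i j
      · simpa using haa i j
      · simpa using hbb i j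
      · rw [QuadraticMap.polar_comm]
        simpa [eq_comm] using hab j i
    have := hli.span_eq_top_of_card_eq_finrank' (by
      rw [Module.finrank_eq_card_basis A.fr₂.basis]
      simp
      ring)
    rw [Set.Sum.elim_range] at this
    rw [eq_top_iff, ← this]
    exact Submodule.span_mono Set.subset_union_left
  · have hh := (unitsRep_mem_iff g.1).2 g.2
    obtain ⟨ε, hε⟩ := A.exists_sign_y_none hh
    obtain ⟨p, hp⟩ := A.map_l_none hh hε
    obtain ⟨q, hq⟩ := A.map_l_some_eq hQ₁ hQ₂ g hε
    refine ⟨_, (border (sg ε) (fun i => r * p i + s * q i)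
      (A.matX (unitsRep Q₁ Q₂ g)).transpose).transpose, A.map_cons_y hh hε, fun j => ?_, ?_⟩
    · rw [Fin.sum_univ_succ]
      refine Fin.cases ?_ (fun j => ?_) j
      · have hp' : vectorRep Q₂ g.1.2 (A.fr₂.l none) =
          ∑ i, p i • A.fr₂.x i + sg ε • A.fr₂.l none := hp
        simp only [Fin.cons_zero, Fin.cons_succ, border, Matrix.of_apply, Matrix.transpose_apply]
        rw [hn, map_add, map_smul, map_smul, hp', hq]
        simp only [smul_add, Finset.smul_sum, smul_smul, add_smul, Finset.sum_add_distrib]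
        module
      · simp only [Fin.cons_zero, Fin.cons_succ, border, Matrix.of_apply, Matrix.transpose_apply,
          zero_smul, zero_add]
        exact A.map_x_eq hh j
    -- The sign `ε` occurs once in each determinant, from `y none` and from `n`, and cancels in the
    -- product.
    · rw [Matrix.det_transpose, det_border, det_border, Matrix.det_transpose]
      have := A.det_matX_mul_det_matY hh
      have h2 := sg_mul_self ε
      linear_combination this + (A.matY (unitsRep Q₁ Q₂ g)).det *
        (A.matX (unitsRep Q₁ Q₂ g)).det * h2

end AdaptedFrame

/-! ### Component groups of the centralizer -/

theorem nonempty_componentGroup_mulEquiv {G F : Type*} [TopologicalSpace G] [Group G]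
    [IsTopologicalGroup G] [Group F] (φ : G →* F) (hφ : Function.Surjective φ)
    (h : ∀ g, φ g = 1 ↔ g ∈ Subgroup.connectedComponentOfOne G) :
    Nonempty (ComponentGroup G ≃* F) := by
  have hker : Subgroup.connectedComponentOfOne G = φ.ker := by
    ext g; exact (h g).symm
  exact ⟨(QuotientGroup.quotientMulEquivOfEq hker).trans
    (QuotientGroup.quotientKerEquivOfSurjective φ hφ)⟩

theorem nonempty_units_int_mulEquiv : Nonempty (ℤˣ ≃* Z2) :=
  ⟨mulEquivOfPrimeCardEq (p := 2) (by simp) (by simp)⟩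

namespace AdaptedFrame

variable {U₁ U₂ : Type*} [AddCommGroup U₁] [Module ℂ U₁] [AddCommGroup U₂] [Module ℂ U₂]
  {Q₁ : QuadraticForm ℂ U₁} {Q₂ : QuadraticForm ℂ U₂} {α : U₁ →ₗ[ℂ] U₂} {β : U₂ →ₗ[ℂ] U₁}
  {k c d : ℕ}

theorem mem_pairCentralizer_of_neg_one {z : spinGroup Q₁} (hz : (z : CliffordAlgebra Q₁) = -1) :
    (z, (1 : spinGroup Q₂)) ∈ pairCentralizer Q₁ Q₂ α β := by
  have h : ∀ v, vectorRep Q₁ z v = v := fun v =>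
    vectorRep_eq_of_mul (by rw [hz]; simp)
  exact ⟨fun u => by simp [h], fun v => by simp [h]⟩

theorem exists_neg_one (A : AdaptedFrame Q₁ Q₂ α β k c d) :
    ∃ z : pairCentralizer Q₁ Q₂ α β, (z.1.1 : CliffordAlgebra Q₁) = -1 ∧ z.1.2 = 1 := by
  have h : ((hyperbolicTorus Q₁ (A.fr₁.Q_x none) (A.fr₁.Q_y none) (A.fr₁.polar_x_y none) (-1) :
      spinGroup Q₁) : CliffordAlgebra Q₁) = -1 := coe_hyperbolicTorus_neg_one _ _ _
  exact ⟨⟨_, mem_pairCentralizer_of_neg_one h⟩, h, rfl⟩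

variable [FiniteDimensional ℂ U₁] [FiniteDimensional ℂ U₂]

/-- The sign by which the centralizer acts on the last vector of the string of length three. -/
theorem exists_sign_character (A : AdaptedFrame Q₁ Q₂ α β k c d) :
    ∃ φ : pairCentralizer Q₁ Q₂ α β →* ℤˣ,
      (∀ g ∈ Subgroup.connectedComponentOfOne (pairCentralizer Q₁ Q₂ α β), φ g = 1) ∧
      ∀ (g : pairCentralizer Q₁ Q₂ α β) (ε : ℤˣ),
        φ g = ε ↔ vectorRep Q₁ g.1.1 (A.fr₁.y none) = sg ε • A.fr₁.y none := by
  set F : pairCentralizer Q₁ Q₂ α β → ℂ := fun g =>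
    A.fr₁.basis.repr (vectorRep Q₁ g.1.1 (A.fr₁.y none)) (.inr (.inl none)) with hF
  have hy : A.fr₁.basis.repr (A.fr₁.y none) (.inr (.inl none)) = 1 := by simp [WittFrame.y]
  have h1 : ∀ (g : pairCentralizer Q₁ Q₂ α β) (e : ℂ),
      vectorRep Q₁ g.1.1 (A.fr₁.y none) = e • A.fr₁.y none → F g = e := by
    intro g e he
    simp only [hF]
    rw [he, map_smul, Finsupp.smul_apply, hy, smul_eq_mul, mul_one]
  have h2 : ∀ g : pairCentralizer Q₁ Q₂ α β, ∃ ε : ℤˣ,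
      vectorRep Q₁ g.1.1 (A.fr₁.y none) = sg ε • A.fr₁.y none :=
    fun g => A.exists_sign_y_none ((unitsRep_mem_iff g.1).2 g.2)
  obtain ⟨φ, hφ, hφ0⟩ := exists_sign_hom (f := F)
    ((continuous_vectorRep_functional (A.fr₁.basis.coord (.inr (.inl none))) (A.fr₁.y none)).comp
      (continuous_fst.comp continuous_subtype_val)) (fun g h => by
        obtain ⟨ε, hε⟩ := h2 g
        obtain ⟨η, hη⟩ := h2 h
        rw [h1 g _ hε, h1 h _ hη]
        apply h1
        rw [Subgroup.coe_mul, Prod.fst_mul, map_mul, Module.End.mul_apply, hη, map_smul, hε,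
          smul_smul, mul_comm]) (fun g => by
        obtain ⟨ε, hε⟩ := h2 g
        rw [h1 g _ hε, sg_mul_self])
  have hinj : Function.Injective sg := fun u v h => Units.ext (Int.cast_injective (α := ℂ) h)
  refine ⟨φ, hφ0, fun g ε => ⟨?_, fun h => hinj ?_⟩⟩
  · rintro rfl
    obtain ⟨η, hη⟩ := h2 g
    rw [hφ, h1 g _ hη, hη]
  · rw [hφ, h1 g _ h]

/-- If the sign is trivial, `g` agrees with an element of the identity component up to the kernel
{±1}² of the covering. As (-1, -1) lies in that component, only the class of (-1, 1) remains. -/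
theorem mem_component_or (A : AdaptedFrame Q₁ Q₂ α β k c d) (hk : 0 < k)
    (hQ₁ : (QuadraticMap.polarBilin Q₁).Nondegenerate)
    (hQ₂ : (QuadraticMap.polarBilin Q₂).Nondegenerate) (g : pairCentralizer Q₁ Q₂ α β)
    (hg : vectorRep Q₁ g.1.1 (A.fr₁.y none) = sg 1 • A.fr₁.y none) :
    g ∈ Subgroup.connectedComponentOfOne (pairCentralizer Q₁ Q₂ α β) ∨
      ∃ g₀ ∈ Subgroup.connectedComponentOfOne (pairCentralizer Q₁ Q₂ α β),
        ((g₀⁻¹ * g).1.1 : CliffordAlgebra Q₁) = -1 ∧ (g₀⁻¹ * g).1.2 = 1 := by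
  obtain ⟨g₀, hg₀, he⟩ :=
    mem_neutralImage.1 ((A.mem_neutralImage_and_eq_one hQ₁ hQ₂ g hg).1 rfl)
  have hs : unitsRep Q₁ Q₂ (g₀⁻¹ * g : pairCentralizer Q₁ Q₂ α β) = 1 := by
    rw [Subgroup.coe_mul, map_mul, Subgroup.coe_inv, map_inv, he, inv_mul_cancel]
  set s := g₀⁻¹ * g with hsdef
  have hgs : g = g₀ * s := by rw [hsdef, mul_inv_cancel_left]
  obtain ⟨z, hz₁, hz₂⟩ := A.exists_neg_one
  have hk' : Nonempty (Fin k) := ⟨⟨0, hk⟩⟩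
  have hz₂' : ((hyperbolicTorus Q₂ (A.fr₂.Q_x ⟨0, hk⟩) (A.fr₂.Q_y ⟨0, hk⟩)
    (A.fr₂.polar_x_y ⟨0, hk⟩) (-1) : spinGroup Q₂) : CliffordAlgebra Q₂) = -1 :=
    coe_hyperbolicTorus_neg_one _ _ _
  obtain ⟨w, hw, hw'⟩ := A.neg_one_neg_one_mem hk hz₁ hz₂'
  have hneg₁ : ∀ x : spinGroup Q₁, (x : CliffordAlgebra Q₁) = -1 → x = z.1.1 :=
    fun x hx => Subtype.ext (hx.trans hz₁.symm)
  rcases vectorRep_eq_one hQ₁ (x := s.1.1) (congrArg (fun z => z.1.val) hs) with h1 | h1 <;>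
    rcases vectorRep_eq_one hQ₂ (x := s.1.2) (congrArg (fun z => z.2.val) hs) with h2 | h2
  · left
    rw [hgs, show s = 1 from Subtype.ext (Prod.ext (Subtype.ext h1) (Subtype.ext h2)), mul_one]
    exact hg₀
  · right
    -- The kernel element (1, -1) is turned into (-1, 1) by the factor `w = (-1, -1)`.
    refine ⟨g₀ * w, mul_mem hg₀ hw, ?_⟩
    have h3 : (g₀ * w)⁻¹ * g = w⁻¹ * s := by rw [mul_inv_rev, mul_assoc, hsdef]
    have h4 : w.1.2 * s.1.2⁻¹ = 1 := by
      rw [mul_inv_eq_one, hw']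
      exact Subtype.ext (hz₂'.trans h2.symm)
    have h5 : s.1.1 = 1 := Subtype.ext h1
    rw [h3]
    constructor
    · rw [Subgroup.coe_mul, Prod.fst_mul, h5, mul_one, Subgroup.coe_inv, Prod.fst_inv, hw']
      have h6 : (z.1.1)⁻¹ = z.1.1 := by
        rw [inv_eq_iff_mul_eq_one]
        exact Subtype.ext (by rw [Submonoid.coe_mul, hz₁]; simp)
      rw [h6, hz₁]
    · rw [Subgroup.coe_mul, Prod.snd_mul, Subgroup.coe_inv, Prod.snd_inv, ← mul_inv_eq_one.1 h4,
        inv_mul_cancel]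
  · right
    exact ⟨g₀, hg₀, h1, Subtype.ext h2⟩
  · left
    rw [hgs]
    refine mul_mem hg₀ ?_
    rwa [show s = w from Subtype.ext (Prod.ext
      ((hneg₁ _ h1).trans (congrArg Prod.fst hw').symm)
      ((Subtype.ext (h2.trans hz₂'.symm)).trans (congrArg Prod.snd hw').symm))]

/-- For `2 ≤ c` a torus on two rows of length one reaches (-1, 1). For `2 ≤ d` it reaches (1, -1),
and (-1, 1) is the quotient of (-1, -1) by it. -/
theorem mem_component_of_two_le (A : AdaptedFrame Q₁ Q₂ α β k c d) (hk : 0 < k)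
    (hcd : 2 ≤ c ∨ 2 ≤ d) (s : pairCentralizer Q₁ Q₂ α β)
    (h1 : (s.1.1 : CliffordAlgebra Q₁) = -1) (h2 : s.1.2 = 1) :
    s ∈ Subgroup.connectedComponentOfOne (pairCentralizer Q₁ Q₂ α β) := by
  rcases hcd with h | h
  · obtain ⟨g, hg, hg'⟩ := A.neg_one_one_mem h h1
    have h3 : (s : spinGroup Q₁ × spinGroup Q₂) = (s.1.1, 1) := Prod.ext rfl h2
    rwa [show s = g from Subtype.ext (h3.trans hg'.symm)]
  · have hz : ((hyperbolicTorus Q₂ (A.fr₂.Q_x ⟨0, hk⟩) (A.fr₂.Q_y ⟨0, hk⟩)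
      (A.fr₂.polar_x_y ⟨0, hk⟩) (-1) : spinGroup Q₂) : CliffordAlgebra Q₂) = -1 :=
      coe_hyperbolicTorus_neg_one _ _ _
    obtain ⟨g, hg, hg'⟩ := A.one_neg_one_mem h hz
    obtain ⟨w, hw, hw'⟩ := A.neg_one_neg_one_mem hk h1 hz
    have h3 : s = w * g⁻¹ := by
      refine Subtype.ext ?_
      rw [Subgroup.coe_mul, Subgroup.coe_inv, hg', hw']
      exact Prod.ext (by simp) (by simp [h2])
    rw [h3]
    exact mul_mem hw (inv_mem hg)

theorem mem_component_of_sign (A : AdaptedFrame Q₁ Q₂ α β k c d) (hk : 0 < k)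
    (hQ₁ : (QuadraticMap.polarBilin Q₁).Nondegenerate)
    (hQ₂ : (QuadraticMap.polarBilin Q₂).Nondegenerate) (hcd : 2 ≤ c ∨ 2 ≤ d)
    (g : pairCentralizer Q₁ Q₂ α β)
    (hg : vectorRep Q₁ g.1.1 (A.fr₁.y none) = sg 1 • A.fr₁.y none) :
    g ∈ Subgroup.connectedComponentOfOne (pairCentralizer Q₁ Q₂ α β) := by
  rcases A.mem_component_or hk hQ₁ hQ₂ g hg with h | ⟨g₀, hg₀, h1, h2⟩
  · exact h
  · rw [← mul_inv_cancel_left g₀ g]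
    exact mul_mem hg₀ (A.mem_component_of_two_le hk hcd _ h1 h2)

theorem subsingleton_componentGroup (A : AdaptedFrame Q₁ Q₂ α β k c 0) (hk : 0 < k)
    (hQ₁ : (QuadraticMap.polarBilin Q₁).Nondegenerate)
    (hQ₂ : (QuadraticMap.polarBilin Q₂).Nondegenerate) (hc : 2 ≤ c) :
    Subsingleton (ComponentGroup (pairCentralizer Q₁ Q₂ α β)) := by
  rw [QuotientGroup.subsingleton_iff, eq_top_iff]
  intro g _
  obtain ⟨ε, hε⟩ := A.exists_sign_y_none ((unitsRep_mem_iff g.1).2 g.2)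
  have h1 := (A.mem_neutralImage_and_eq_one hQ₁ hQ₂ g hε).2.1 rfl
  subst h1
  exact A.mem_component_of_sign hk hQ₁ hQ₂ (.inl hc) g hε

theorem componentGroup_of_two_le (A : AdaptedFrame Q₁ Q₂ α β k c d) (hk : 0 < k)
    (hQ₁ : (QuadraticMap.polarBilin Q₁).Nondegenerate)
    (hQ₂ : (QuadraticMap.polarBilin Q₂).Nondegenerate) (hd : 0 < d) (hcd : 2 ≤ c ∨ 2 ≤ d) :
    Nonempty (ComponentGroup (pairCentralizer Q₁ Q₂ α β) ≃* Z2) := by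
  obtain ⟨φ, hφ0, hφ⟩ := A.exists_sign_character
  obtain ⟨g, hg⟩ := A.exists_neg_y_none hd
  obtain ⟨i⟩ := nonempty_componentGroup_mulEquiv φ (fun u => by
    rcases Int.units_eq_one_or u with rfl | rfl
    · exact ⟨1, map_one φ⟩
    · exact ⟨g, (hφ g _).2 hg⟩) fun g => ⟨fun h =>
      A.mem_component_of_sign hk hQ₁ hQ₂ hcd g ((hφ g 1).1 h), hφ0 g⟩
  obtain ⟨j⟩ := nonempty_units_int_mulEquiv
  exact ⟨i.trans j⟩

theorem componentGroup_one_zero (A : AdaptedFrame Q₁ Q₂ α β k 1 0) (hk : 0 < k)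
    (hQ₁ : (QuadraticMap.polarBilin Q₁).Nondegenerate)
    (hQ₂ : (QuadraticMap.polarBilin Q₂).Nondegenerate) :
    Nonempty (ComponentGroup (pairCentralizer Q₁ Q₂ α β) ≃* Z2) := by
  obtain ⟨φ, hφ0, hφ⟩ := A.exists_character_fst hQ₁ hQ₂
  obtain ⟨z, hz₁, hz₂⟩ := A.exists_neg_one
  obtain ⟨i⟩ := nonempty_componentGroup_mulEquiv φ (fun u => by
    rcases Int.units_eq_one_or u with rfl | rfl
    · exact ⟨1, map_one φ⟩
    · exact ⟨z, hφ z hz₁ hz₂⟩) fun g => ⟨fun h => by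
      obtain ⟨ε, hε⟩ := A.exists_sign_y_none ((unitsRep_mem_iff g.1).2 g.2)
      have h1 := (A.mem_neutralImage_and_eq_one hQ₁ hQ₂ g hε).2.1 rfl
      subst h1
      rcases A.mem_component_or hk hQ₁ hQ₂ g hε with h | ⟨g₀, hg₀, h1, h2⟩
      · exact h
      · have h3 := hφ _ h1 h2
        rw [map_mul, map_inv, hφ0 _ hg₀, h] at h3
        simp at h3, hφ0 g⟩
  obtain ⟨j⟩ := nonempty_units_int_mulEquiv
  exact ⟨i.trans j⟩

/-- The sign character and the spinor character are independent, since `z = (-1, 1)` is seen by the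
second only. Together they separate the components. -/
theorem componentGroup_zero_one (A : AdaptedFrame Q₁ Q₂ α β k 0 1) (hk : 0 < k)
    (hQ₁ : (QuadraticMap.polarBilin Q₁).Nondegenerate)
    (hQ₂ : (QuadraticMap.polarBilin Q₂).Nondegenerate) :
    Nonempty (ComponentGroup (pairCentralizer Q₁ Q₂ α β) ≃* Z2 × Z2) := by
  obtain ⟨φ, hφ0, hφ⟩ := A.exists_character_snd hQ₁ hQ₂
  obtain ⟨ψ, hψ0, hψ⟩ := A.exists_sign_character
  obtain ⟨z, hz₁, hz₂⟩ := A.exists_neg_one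
  obtain ⟨g, hg⟩ := A.exists_neg_y_none one_pos
  have hψz : ψ z = 1 := (hψ z 1).2 (by
    rw [vectorRep_eq_of_mul (w := A.fr₁.y none) (by rw [hz₁]; simp), sg_one, one_smul])
  have hφz := hφ z hz₁ hz₂
  obtain ⟨i⟩ := nonempty_componentGroup_mulEquiv (ψ.prod φ) (fun u => by
    obtain ⟨u, v⟩ := u
    have h1 : ∃ h, ψ h = u := by
      rcases Int.units_eq_one_or u with rfl | rfl
      · exact ⟨1, map_one ψ⟩
      · exact ⟨g, (hψ g _).2 hg⟩
    obtain ⟨h, rfl⟩ := h1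
    rcases eq_or_ne (φ h) v with h2 | h2
    · exact ⟨h, Prod.ext rfl h2⟩
    · refine ⟨h * z, Prod.ext ?_ ?_⟩
      · change ψ (h * z) = ψ h
        rw [map_mul, hψz, mul_one]
      · change φ (h * z) = v
        rw [map_mul, hφz]
        rcases Int.units_eq_one_or (φ h) with h3 | h3 <;>
          rcases Int.units_eq_one_or v with h4 | h4 <;> simp_all) fun g => ⟨fun h => by
      rw [MonoidHom.prod_apply, Prod.mk_eq_one] at h
      rcases A.mem_component_or hk hQ₁ hQ₂ g ((hψ g 1).1 h.1) with h | ⟨g₀, hg₀, h1, h2⟩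
      · exact h
      · have h3 := hφ _ h1 h2
        rw [map_mul, map_inv, hφ0 _ hg₀, h.2] at h3
        simp at h3, fun h => Prod.ext (hψ0 g h) (hφ0 g h)⟩
  obtain ⟨j⟩ := nonempty_units_int_mulEquiv
  exact ⟨i.trans (j.prodCongr j)⟩

end AdaptedFrame

/-! ### Constructing frames -/

section FrameConstruction

variable {V : Type*} [AddCommGroup V] [Module ℂ V] {Q : QuadraticForm ℂ V}

theorem exists_wittFrame {H L : Type*} [Fintype H] [Fintype L] [DecidableEq H] [DecidableEq L]
    {x y : H → V} {l : L → V} (hxx : ∀ i j, QuadraticMap.polar Q (x i) (x j) = 0)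
    (hyy : ∀ i j, QuadraticMap.polar Q (y i) (y j) = 0)
    (hxy : ∀ i j, QuadraticMap.polar Q (x i) (y j) = if i = j then 1 else 0)
    (hxl : ∀ i j, QuadraticMap.polar Q (x i) (l j) = 0)
    (hyl : ∀ i j, QuadraticMap.polar Q (y i) (l j) = 0)
    (hll : ∀ i j, i ≠ j → QuadraticMap.polar Q (l i) (l j) = 0) (hl : ∀ i, Q (l i) ≠ 0)
    [FiniteDimensional ℂ V]
    (hcard : Fintype.card (H ⊕ H ⊕ L) = Module.finrank ℂ V) :
    ∃ F : WittFrame Q H L, F.x = x ∧ F.y = y ∧ F.l = l := by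
  have hlx : ∀ i j, QuadraticMap.polar Q (l i) (x j) = 0 := fun i j => by
    rw [QuadraticMap.polar_comm, hxl]
  have hly : ∀ i j, QuadraticMap.polar Q (l i) (y j) = 0 := fun i j => by
    rw [QuadraticMap.polar_comm, hyl]
  have hli : LinearIndependent ℂ (Sum.elim x (Sum.elim y l)) := by
    refine linearIndependent_of_dual (Q := Q)
      (v' := Sum.elim y (Sum.elim x fun j => (2 * Q (l j))⁻¹ • l j)) ?_
    rintro (i | i | i) (j | j | j)
    · simpa using hxy i j
    · simpa using hxx i j
    · simp [QuadraticMap.polar_smul_right, hxl]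
    · simpa using hyy i j
    · simp [QuadraticMap.polar_comm Q (y i), hxy, eq_comm]
    · simp [QuadraticMap.polar_smul_right, hyl]
    · simpa using hly i j
    · simpa using hlx i j
    · by_cases h : i = j
      · subst h
        have := hl i
        simp only [Sum.elim_inr, QuadraticMap.polar_smul_right, QuadraticMap.polar_self,
          smul_eq_mul, nsmul_eq_mul, if_true]
        push_cast
        field_simp
      · simp [QuadraticMap.polar_smul_right, hll i j h, h]
  have hsp := (hli.span_eq_top_of_card_eq_finrank' hcard).ge
  have hb := Module.Basis.coe_mk hli hsp
  refine ⟨{ basis := Module.Basis.mk hli hsp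
            polar_xx := ?_, polar_yy := ?_, polar_xy := ?_, polar_xl := ?_, polar_yl := ?_,
            polar_ll := ?_, polar_l_ne_zero := ?_ }, ?_, ?_, ?_⟩
  · rw [hb]; exact hxx
  · rw [hb]; exact hyy
  · rw [hb]; exact hxy
  · rw [hb]; exact hxl
  · rw [hb]; exact hyl
  · rw [hb]; exact hll
  · rw [hb]; exact hl
  · funext i; rw [WittFrame.x, hb]; rfl
  · funext i; rw [WittFrame.y, hb]; rfl
  · funext i; rw [WittFrame.l, hb]; rfl

/-- Each `v i` is corrected by half of its row of the Gram matrix. The two correction terms cancel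
the pairing of `v i` with `v j`, and pairings with the `w j` are unaffected because these are
mutually orthogonal. -/
theorem isotropic_correction {I : Type*} [Fintype I] [DecidableEq I] {v w : I → V}
    (hvw : ∀ i j, QuadraticMap.polar Q (v i) (w j) = if i = j then 1 else 0)
    (hww : ∀ i j, QuadraticMap.polar Q (w i) (w j) = 0) (i j : I) :
    QuadraticMap.polar Q (v i - ∑ l, (QuadraticMap.polar Q (v i) (v l) / 2) • w l)
      (v j - ∑ l, (QuadraticMap.polar Q (v j) (v l) / 2) • w l) = 0 ∧
    QuadraticMap.polar Q (v i - ∑ l, (QuadraticMap.polar Q (v i) (v l) / 2) • w l) (w j) =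
      if i = j then 1 else 0 := by
  have h1 : ∀ (p : I → ℂ) j, QuadraticMap.polar Q (∑ l, p l • w l) (w j) = 0 := fun p j => by
    rw [← QuadraticMap.polarBilin_apply_apply]
    simp [hww]
  have h2 : ∀ (p : I → ℂ) j, QuadraticMap.polar Q (∑ l, p l • w l) (v j) = p j := fun p j => by
    rw [← QuadraticMap.polarBilin_apply_apply]
    simp [QuadraticMap.polar_comm Q (w _), hvw]
  have h3 : ∀ j (u : V) (p : I → ℂ), (∀ l, QuadraticMap.polar Q u (w l) = if j = l then 1 else 0) →
      QuadraticMap.polar Q u (∑ l, p l • w l) = p j := fun j u p hu => by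
    rw [← QuadraticMap.polarBilin_apply_apply]
    simp [hu]
  have h4 : ∀ j, QuadraticMap.polar Q
      (v i - ∑ l, (QuadraticMap.polar Q (v i) (v l) / 2) • w l) (w j) = if i = j then 1 else 0 := by
    intro j
    rw [QuadraticMap.polar_sub_left, hvw, h1, sub_zero]
  refine ⟨?_, h4 j⟩
  rw [QuadraticMap.polar_sub_right, h3 i _ _ h4, QuadraticMap.polar_sub_left, h2,
    QuadraticMap.polar_comm Q (v j)]
  ring

end FrameConstruction

/-! ### From Jordan strings to an adapted frame -/

section JordanData

variable {U₁ U₂ : Type*} [AddCommGroup U₁] [Module ℂ U₁] [AddCommGroup U₂] [Module ℂ U₂]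
  {Q₁ : QuadraticForm ℂ U₁} {Q₂ : QuadraticForm ℂ U₂} {α : U₁ →ₗ[ℂ] U₂} {β : U₂ →ₗ[ℂ] U₁}
  {k c d : ℕ}

theorem exists_dual_family [FiniteDimensional ℂ U₂] (hQ : (QuadraticMap.polarBilin Q₂).Nondegenerate) {I : Type*}
    [DecidableEq I] {q : I → U₂} (hq : LinearIndependent ℂ q) :
    ∃ y : I → U₂, ∀ i j, QuadraticMap.polar Q₂ (q i) (y j) = if i = j then 1 else 0 := by
  have h : ∀ j, ∃ y, ∀ i, QuadraticMap.polar Q₂ (q i) y = if i = j then 1 else 0 := by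
    intro j
    obtain ⟨g, hg⟩ := LinearMap.exists_extend ((Finsupp.lapply j : (I →₀ ℂ) →ₗ[ℂ] ℂ) ∘ₗ hq.repr)
    obtain ⟨y, hy⟩ := polarBilin_surjective hQ g
    refine ⟨y, fun i => ?_⟩
    rw [QuadraticMap.polar_comm, ← QuadraticMap.polarBilin_apply_apply, hy]
    have h1 := LinearMap.congr_fun hg ⟨q i, Submodule.subset_span ⟨i, rfl⟩⟩
    have h2 : hq.repr ⟨q i, Submodule.subset_span ⟨i, rfl⟩⟩ = Finsupp.single i 1 :=
      hq.repr_eq_single i _ rfl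
    simp only [LinearMap.comp_apply, Submodule.subtype_apply] at h1
    rw [h1]
    erw [h2]
    by_cases hij : i = j
    · subst hij; simp
    · simp [hij]
  choose y hy using h
  exact ⟨y, fun i j => hy j i⟩

/-- The string of length three can be normalized. -/
theorem exists_normalized_string (hQ₁ : (QuadraticMap.polarBilin Q₁).Nondegenerate)
    (skew : ∀ u v, QuadraticMap.polar Q₂ (α u) v = -QuadraticMap.polar Q₁ u (β v))
    {a₀ : U₁} (hαβ : ∀ v, α (β v) = 0) (ha₀ : β (α a₀) ≠ 0)
    (hβα : ∀ u, ∃ r : ℂ, β (α u) = r • β (α a₀)) :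
    ∃ t s : ℂ, t ≠ 0 ∧ Q₁ (t • a₀ + s • β (α a₀)) = 0 ∧
      QuadraticMap.polar Q₁ (t • a₀ + s • β (α a₀)) (β (α (t • a₀ + s • β (α a₀)))) = 1 := by
  have hcc : QuadraticMap.polar Q₁ (β (α a₀)) (β (α a₀)) = 0 := by
    rw [← neg_eq_zero, ← skew, hαβ, QuadraticMap.polar_zero_left]
  have hQc : Q₁ (β (α a₀)) = 0 := by
    rw [QuadraticMap.polar_self, two_smul, ← two_mul] at hcc
    exact (mul_eq_zero.1 hcc).resolve_left two_ne_zero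
  -- `β ∘ α` is self-adjoint with image the line through `β (α a₀)`, so otherwise this vector would
  -- be orthogonal to everything.
  have hp : QuadraticMap.polar Q₁ a₀ (β (α a₀)) ≠ 0 := by
    intro h
    refine ha₀ (hQ₁.2 _ fun u => ?_)
    obtain ⟨r, hr⟩ := hβα u
    rw [QuadraticMap.polarBilin_apply_apply, ← neg_eq_zero, ← skew, QuadraticMap.polar_comm, skew,
      hr, QuadraticMap.polar_smul_right, h, smul_zero, neg_zero]
  set p := QuadraticMap.polar Q₁ a₀ (β (α a₀)) with hpdef
  obtain ⟨t, ht⟩ := IsAlgClosed.exists_pow_nat_eq p⁻¹ (n := 2) two_pos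
  have ht' : t ^ 2 * p = 1 := by rw [ht, inv_mul_cancel₀ hp]
  have ht0 : t ≠ 0 := by rintro rfl; simp at ht'
  -- `t² p = 1` normalizes the pairing of the two ends, and `s` solves `t² Q₁ a₀ + t s p = 0`, which
  -- makes the first vector isotropic.
  refine ⟨t, -(t * Q₁ a₀) / p, ht0, ?_, ?_⟩
  · rw [QuadraticMap.map_add Q₁, QuadraticMap.map_smul, QuadraticMap.map_smul, hQc,
      QuadraticMap.polar_smul_left, QuadraticMap.polar_smul_right, ← hpdef]
    simp only [smul_eq_mul]
    field_simp
    ring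
  · rw [map_add, map_add, map_smul, map_smul, map_smul, hαβ, smul_zero, map_zero, add_zero,
      QuadraticMap.polar_smul_right, QuadraticMap.polar_add_left, QuadraticMap.polar_smul_left,
      QuadraticMap.polar_smul_left, hcc, ← hpdef, smul_zero, add_zero, smul_eq_mul, smul_eq_mul]
    linear_combination ht'

/-- The vectors `b = α a` and `q i = α (p i)` are kept. Isotropic duals of the `q i` orthogonal to
`b` are built in the second space and carried to the first by `-β`; the `p i` are then corrected
only by elements of ker α, so their images do not change. Orthonormal completions supply the rows of
length one, and skewness shows that `α` and `β` kill them. -/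
theorem exists_adaptedFrame [FiniteDimensional ℂ U₁] [FiniteDimensional ℂ U₂]
    (hQ₁ : (QuadraticMap.polarBilin Q₁).Nondegenerate)
    (hQ₂ : (QuadraticMap.polarBilin Q₂).Nondegenerate)
    (skew : ∀ u v, QuadraticMap.polar Q₂ (α u) v = -QuadraticMap.polar Q₁ u (β v))
    {a₀ : U₁} {p : Fin k → U₁} (hαβ : ∀ v, α (β v) = 0) (ha₀ : β (α a₀) ≠ 0)
    (hp : ∀ i, β (α (p i)) = 0)
    (hspan : ∀ u, ∃ (r : ℂ) (w : Fin k → ℂ), α u = r • α a₀ + ∑ i, w i • α (p i))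
    (hli : LinearIndependent ℂ fun i => α (p i))
    (h₁ : Module.finrank ℂ U₁ = 2 + 2 * k + c) (h₂ : Module.finrank ℂ U₂ = 1 + 2 * k + d) :
    Nonempty (AdaptedFrame Q₁ Q₂ α β k c d) := by
  have skew' : ∀ u v, QuadraticMap.polar Q₁ u (β v) = -QuadraticMap.polar Q₂ (α u) v :=
    fun u v => by rw [skew, neg_neg]
  obtain ⟨t, s, ht, hQa, hac⟩ := exists_normalized_string (Q₂ := Q₂) hQ₁ skew hαβ ha₀ (fun u => by
    obtain ⟨r, w, h⟩ := hspan u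
    exact ⟨r, by simp [h, hp]⟩)
  set a := t • a₀ + s • β (α a₀) with ha
  have hαa : α a = t • α a₀ := by rw [ha]; simp [hαβ]
  set b := α a with hb
  set cc := β b with hcc
  set q : Fin k → U₂ := fun i => α (p i) with hq
  have hspan' : ∀ u, ∃ (r : ℂ) (w : Fin k → ℂ), α u = r • b + ∑ i, w i • q i := fun u => by
    obtain ⟨r, w, h⟩ := hspan u
    refine ⟨r / t, w, ?_⟩
    rw [h, hαa, smul_smul, div_mul_cancel₀ _ ht]
  have hβq : ∀ i, β (q i) = 0 := hp
  have hbb : QuadraticMap.polar Q₂ b b = -1 := by rw [hb, skew, hac]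
  have hqb : ∀ i, QuadraticMap.polar Q₂ (q i) b = 0 := fun i => by
    rw [QuadraticMap.polar_comm, skew, hβq, QuadraticMap.polar_zero_right, neg_zero]
  have hqq : ∀ i j, QuadraticMap.polar Q₂ (q i) (q j) = 0 := fun i j => by
    rw [skew, hβq, QuadraticMap.polar_zero_right, neg_zero]
  obtain ⟨y₀, hy₀⟩ := exists_dual_family hQ₂ hli
  -- the vectors dual to the `q i`, orthogonal to `b`, then isotropic
  set y₁ : Fin k → U₂ := fun i => y₀ i + QuadraticMap.polar Q₂ b (y₀ i) • b with hy₁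
  have hy₁q : ∀ i j, QuadraticMap.polar Q₂ (y₁ i) (q j) = if i = j then 1 else 0 := fun i j => by
    rw [QuadraticMap.polar_comm]
    simp [hy₁, QuadraticMap.polar_add_right, QuadraticMap.polar_smul_right, hqb, q, hy₀, eq_comm]
  have hy₁b : ∀ i, QuadraticMap.polar Q₂ (y₁ i) b = 0 := fun i => by
    simp [hy₁, QuadraticMap.polar_add_left, QuadraticMap.polar_smul_left, hbb,
      QuadraticMap.polar_comm Q₂ b]
  set y₂ : Fin k → U₂ := fun i =>
    y₁ i - ∑ l, (QuadraticMap.polar Q₂ (y₁ i) (y₁ l) / 2) • q l with hy₂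
  have hy₂y₂ : ∀ i j, QuadraticMap.polar Q₂ (y₂ i) (y₂ j) = 0 := fun i j =>
    (isotropic_correction hy₁q hqq i j).1
  have hy₂q : ∀ i j, QuadraticMap.polar Q₂ (y₂ i) (q j) = if i = j then 1 else 0 := fun i j =>
    (isotropic_correction hy₁q hqq i j).2
  have hqy₂ : ∀ i j, QuadraticMap.polar Q₂ (q i) (y₂ j) = if i = j then 1 else 0 := fun i j => by
    rw [QuadraticMap.polar_comm, hy₂q]; simp [eq_comm]
  have hy₂b : ∀ i, QuadraticMap.polar Q₂ (y₂ i) b = 0 := fun i => by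
    have : QuadraticMap.polar Q₂ b (∑ l, (QuadraticMap.polar Q₂ (y₁ i) (y₁ l) / 2) • q l) = 0 := by
      rw [← QuadraticMap.polarBilin_apply_apply]
      simp [QuadraticMap.polar_comm Q₂ b, hqb]
    rw [hy₂, QuadraticMap.polar_sub_left, hy₁b, QuadraticMap.polar_comm, this, sub_zero]
  -- the corresponding vectors of the first space
  set y : Fin k → U₁ := fun i => -β (y₂ i) with hy
  have hyu : ∀ u i, QuadraticMap.polar Q₁ u (y i) = QuadraticMap.polar Q₂ (α u) (y₂ i) :=
    fun u i => by rw [hy, QuadraticMap.polar_neg_right, ← skew]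
  have hαy : ∀ i, α (y i) = 0 := fun i => by simp [hy, hαβ]
  have hαc : α cc = 0 := hαβ _
  have hyy : ∀ i j, QuadraticMap.polar Q₁ (y i) (y j) = 0 := fun i j => by
    rw [hyu, hαy, QuadraticMap.polar_zero_left]
  have hcy : ∀ i, QuadraticMap.polar Q₁ cc (y i) = 0 := fun i => by
    rw [hyu, hαc, QuadraticMap.polar_zero_left]
  have hay : ∀ i, QuadraticMap.polar Q₁ a (y i) = 0 := fun i => by
    rw [hyu, QuadraticMap.polar_comm, hy₂b]
  have hcc0 : QuadraticMap.polar Q₁ cc cc = 0 := by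
    rw [hcc, skew', hαβ, QuadraticMap.polar_zero_left, neg_zero]
  have haa : QuadraticMap.polar Q₁ a a = 0 := by rw [QuadraticMap.polar_self, hQa, smul_zero]
  set x₁ : Fin k → U₁ := fun i => p i - QuadraticMap.polar Q₁ (p i) a • cc with hx₁
  have hαx₁ : ∀ i, α (x₁ i) = q i := fun i => by simp [hx₁, hαc, hq]
  have hx₁y : ∀ i j, QuadraticMap.polar Q₁ (x₁ i) (y j) = if i = j then 1 else 0 := fun i j => by
    rw [hyu, hαx₁, hqy₂]
  have hca : QuadraticMap.polar Q₁ cc a = 1 := by rw [QuadraticMap.polar_comm, hac]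
  have hx₁a : ∀ i, QuadraticMap.polar Q₁ (x₁ i) a = 0 := fun i => by
    simp [hx₁, QuadraticMap.polar_sub_left, QuadraticMap.polar_smul_left, hca]
  set x : Fin k → U₁ := fun i =>
    x₁ i - ∑ l, (QuadraticMap.polar Q₁ (x₁ i) (x₁ l) / 2) • y l with hx
  have hxx : ∀ i j, QuadraticMap.polar Q₁ (x i) (x j) = 0 := fun i j =>
    (isotropic_correction hx₁y hyy i j).1
  have hxy : ∀ i j, QuadraticMap.polar Q₁ (x i) (y j) = if i = j then 1 else 0 := fun i j =>
    (isotropic_correction hx₁y hyy i j).2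
  have hαx : ∀ i, α (x i) = q i := fun i => by simp [hx, hαx₁, hαy]
  have hax : ∀ i, QuadraticMap.polar Q₁ a (x i) = 0 := fun i => by
    have : QuadraticMap.polar Q₁ a (∑ l, (QuadraticMap.polar Q₁ (x₁ i) (x₁ l) / 2) • y l) = 0 := by
      rw [← QuadraticMap.polarBilin_apply_apply]
      simp [hay]
    rw [hx, QuadraticMap.polar_sub_right, this, QuadraticMap.polar_comm, hx₁a, sub_zero]
  have hxc : ∀ i, QuadraticMap.polar Q₁ (x i) cc = 0 := fun i => by
    rw [hcc, skew', hαx, hqb, neg_zero]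
  -- completion to frames
  let X : Option (Fin k) → U₁ := fun o => o.elim a x
  let Y : Option (Fin k) → U₁ := fun o => o.elim cc y
  have hXX : ∀ i j, QuadraticMap.polar Q₁ (X i) (X j) = 0 := by
    rintro (_ | i) (_ | j)
    · exact haa
    · exact hax j
    · exact (QuadraticMap.polar_comm _ _ _).trans (hax i)
    · exact hxx i j
  have hYY : ∀ i j, QuadraticMap.polar Q₁ (Y i) (Y j) = 0 := by
    rintro (_ | i) (_ | j)
    · exact hcc0
    · exact hcy j
    · exact (QuadraticMap.polar_comm _ _ _).trans (hcy i)
    · exact hyy i j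
  have hXY : ∀ i j, QuadraticMap.polar Q₁ (X i) (Y j) = if i = j then 1 else 0 := by
    rintro (_ | i) (_ | j)
    · exact hac.trans (if_pos rfl).symm
    · exact (hay j).trans (if_neg (by simp)).symm
    · exact (hxc i).trans (if_neg (by simp)).symm
    · exact (hxy i j).trans (by simp)
  obtain ⟨f, hf1, hf2, hf3⟩ := exists_orthonormal_completion hQ₁ (v := Sum.elim X Y)
    (v' := Sum.elim Y X) (by
      rintro (i | i) (j | j)
      · simpa using hXY i j
      · simpa using hXX i j
      · simpa using hYY i j
      · rw [QuadraticMap.polar_comm]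
        simpa [eq_comm] using hXY j i) (by
      rintro w hw (i | i)
      · exact hw (.inr i)
      · exact hw (.inl i)) c (by simp [h₁]; lia)
  obtain ⟨F₁, hFx, hFy, hFl⟩ := exists_wittFrame hXX hYY hXY (fun i j => hf2 (.inl i) j)
    (fun i j => hf2 (.inr i) j) hf3 (fun i => by rw [hf1]; exact one_ne_zero)
    (by simp [h₁]; lia)
  obtain ⟨g, hg1, hg2, hg3⟩ := exists_orthonormal_completion hQ₂
    (v := Sum.elim (Sum.elim q y₂) fun _ : Unit => b)
    (v' := Sum.elim (Sum.elim y₂ q) fun _ : Unit => -b) (by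
      rintro ((i | i) | i) ((j | j) | j)
      · simpa using hqy₂ i j
      · simpa using hqq i j
      · simp [QuadraticMap.polar_neg_right, hqb]
      · simpa using hy₂y₂ i j
      · simpa using hy₂q i j
      · simp [QuadraticMap.polar_neg_right, hy₂b]
      · simp [QuadraticMap.polar_comm Q₂ b, hy₂b]
      · simp [QuadraticMap.polar_comm Q₂ b, hqb]
      · simp [QuadraticMap.polar_neg_right, hbb]) (by
      rintro w hw ((i | i) | i)
      · exact hw (.inl (.inr i))
      · exact hw (.inl (.inl i))
      · have := hw (.inr i)
        simp only [Sum.elim_inr] at this ⊢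
        rw [QuadraticMap.polar_neg_left, this, neg_zero]) d (by simp [h₂]; lia)
  let G : Option (Fin d) → U₂ := fun o => o.elim b g
  have hQb : Q₂ b ≠ 0 := by
    intro h
    rw [QuadraticMap.polar_self, h, smul_zero] at hbb
    exact one_ne_zero (neg_eq_zero.1 hbb.symm)
  obtain ⟨F₂, hGx, hGy, hGl⟩ := exists_wittFrame (l := G) hqq hy₂y₂ hqy₂ (by
      rintro i (_ | j)
      · exact hqb i
      · exact hg2 (.inl (.inl i)) j) (by
      rintro i (_ | j)
      · exact hy₂b i
      · exact hg2 (.inl (.inr i)) j) (by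
      rintro (_ | i) (_ | j) hij
      · exact absurd rfl hij
      · exact hg2 (.inr ()) j
      · exact (QuadraticMap.polar_comm _ _ _).trans (hg2 (.inr ()) i)
      · exact hg3 i j (by rintro rfl; exact hij rfl)) (by
      rintro (_ | i)
      · exact hQb
      · change Q₂ (g i) ≠ 0
        rw [hg1]; exact one_ne_zero) (by simp [h₂]; lia)
  refine ⟨{ fr₁ := F₁, fr₂ := F₂, skew := skew, α_x_none := ?_, α_x_some := ?_, α_y := ?_,
            α_l := ?_, β_x := ?_, β_y := ?_, β_l_none := ?_, β_l_some := ?_ }⟩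
  · rw [hFx, hGl]; rfl
  · intro i; rw [hFx, hGx]; exact hαx i
  · rw [hFy]
    rintro (_ | i)
    · exact hαc
    · exact hαy i
  · intro j
    rw [hFl]
    -- The coefficients of `α (f j)` along `b` and the `q i` are its pairings with `b` (up to sign)
    -- and with the `y₂ i`. By skewness these are pairings of `f j` with `cc` and the `y i`, which
    -- vanish.
    obtain ⟨r, w, hrw⟩ := hspan' (f j)
    have hr : r = 0 := by
      have h1 : QuadraticMap.polar Q₁ (f j) cc = 0 :=
        (QuadraticMap.polar_comm _ _ _).trans (hf2 (.inr none) j)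
      rw [hcc, skew', hrw, neg_eq_zero, QuadraticMap.polar_comm,
        ← QuadraticMap.polarBilin_apply_apply, map_add, map_sum] at h1
      simp only [map_smul] at h1
      simpa [QuadraticMap.polar_comm Q₂ b, hqb, hbb] using h1
    have hw : ∀ i, w i = 0 := by
      intro i
      have h1 : QuadraticMap.polar Q₁ (f j) (y i) = 0 :=
        (QuadraticMap.polar_comm _ _ _).trans (hf2 (.inr (some i)) j)
      rw [hyu, hrw, QuadraticMap.polar_comm, ← QuadraticMap.polarBilin_apply_apply, map_add, map_sum] at h1
      simp only [map_smul] at h1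
      simpa [hy₂b, hy₂q] using h1
    rw [hrw, hr]
    simp [hw]
  · intro i; rw [hGx]; exact hβq i
  · intro i
    rw [hGy, hFy]
    simp [Y, hy]
  · rw [hGl, hFy]; rfl
  · intro j
    rw [hGl]
    refine hQ₁.2 _ fun u => ?_
    obtain ⟨r, w, hrw⟩ := hspan' u
    have h1 : QuadraticMap.polar Q₂ (g j) b = 0 :=
      (QuadraticMap.polar_comm _ _ _).trans (hg2 (.inr ()) j)
    have h2 : ∀ i, QuadraticMap.polar Q₂ (g j) (q i) = 0 := fun i =>
      (QuadraticMap.polar_comm _ _ _).trans (hg2 (.inl (.inl i)) j)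
    change QuadraticMap.polar Q₁ u (β (g j)) = 0
    rw [skew', hrw, neg_eq_zero, QuadraticMap.polar_comm, ← QuadraticMap.polarBilin_apply_apply,
      map_add, map_sum]
    simp only [map_smul]
    simp [h1, h2]

end JordanData

/-! ### From signed diagrams to adapted frames -/

section SignedDiagrams

variable {Vp Vm : Type*} [AddCommGroup Vp] [Module ℂ Vp] [AddCommGroup Vm] [Module ℂ Vm]
  {U₁ U₂ : Type*} [AddCommGroup U₁] [Module ℂ U₁] [AddCommGroup U₂] [Module ℂ U₂]
  [FiniteDimensional ℂ U₁] [FiniteDimensional ℂ U₂]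
  {Q₁ : QuadraticForm ℂ U₁} {Q₂ : QuadraticForm ℂ U₂} {α : U₁ →ₗ[ℂ] U₂} {β : U₂ →ₗ[ℂ] U₁}

theorem units_int_ne_neg (s : ℤˣ) : s ≠ -s := by
  rcases Int.units_eq_one_or s with rfl | rfl <;> decide

/-- The two summands enter through abstract inclusions and projections, so one argument serves both
signs of the row of length three. -/
theorem exists_adaptedFrame_of_basis (hQ₁ : (QuadraticMap.polarBilin Q₁).Nondegenerate)
    (hQ₂ : (QuadraticMap.polarBilin Q₂).Nondegenerate)
    (skew : ∀ u v, QuadraticMap.polar Q₂ (α u) v = -QuadraticMap.polar Q₁ u (β v))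
    {e : Module.End ℂ (Vp × Vm)} {s : ℤˣ} {i₁ : U₁ →ₗ[ℂ] Vp × Vm} {i₂ : U₂ →ₗ[ℂ] Vp × Vm}
    {π₁ : Vp × Vm →ₗ[ℂ] U₁} {π₂ : Vp × Vm →ₗ[ℂ] U₂} (hπ₁ : ∀ u, π₁ (i₁ u) = u)
    (hπ₂ : ∀ v, π₂ (i₂ v) = v)
    (h₁ : ∀ v ∈ signedPart Vp Vm s, i₁ (π₁ v) = v ∧ π₂ v = 0)
    (h₂ : ∀ v ∈ signedPart Vp Vm (-s), i₂ (π₂ v) = v ∧ π₁ v = 0)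
    (hα : ∀ u, e (i₁ u) = i₂ (α u)) (hβ : ∀ v, e (i₂ v) = i₁ (β v))
    {D : SignedDiagram} (hD3 : D (s, 3) = 1) (hD2 : D (-s, 2) = D (s, 2))
    (hD : ∀ row, D row ≠ 0 → row.2 ≠ 0 →
      row = (s, 3) ∨ row = (s, 2) ∨ row = (-s, 2) ∨ row = (s, 1) ∨ row = (-s, 1))
    (he : HasSignedDiagram e D) :
    Nonempty (AdaptedFrame Q₁ Q₂ α β (D (s, 2)) (D (s, 1)) (D (-s, 1))) := by
  obtain ⟨b, hb1, hb2⟩ := he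
  have hs := units_int_ne_neg s
  have hs' : -s ≠ s := hs.symm
  have hinj₁ : Function.Injective i₁ := Function.LeftInverse.injective hπ₁
  have hinj₂ : Function.Injective i₂ := Function.LeftInverse.injective hπ₂
  have key₁ : ∀ x, (i₁ (π₁ (b x)) = b x ∧ π₂ (b x) = 0) ∨ (i₂ (π₂ (b x)) = b x ∧ π₁ (b x) = 0) := by
    rintro ⟨row, i, j⟩
    have h := hb1 row i j
    rcases eq_or_ne (row.1 * (-1) ^ (j : ℕ)) s with h3 | h3
    · rw [h3] at h; exact .inl (h₁ _ h)
    · rw [Int.units_ne_iff_eq_neg.1 h3] at h; exact .inr (h₂ _ h)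
  let i₀ : Fin (D (s, 3)) := ⟨0, by rw [hD3]; exact one_pos⟩
  have hi₀ : ∀ i : Fin (D (s, 3)), i = i₀ := fun i => Fin.ext (by
    have := i.2; simp only [i₀]; lia)
  -- the signs of the vectors of the basis
  have a0 : i₁ (π₁ (b ⟨(s, 3), i₀, ⟨0, by simp⟩⟩)) = b ⟨(s, 3), i₀, ⟨0, by simp⟩⟩ ∧
      π₂ (b ⟨(s, 3), i₀, ⟨0, by simp⟩⟩) = 0 := h₁ _ (by simpa using hb1 (s, 3) i₀ ⟨0, by simp⟩)
  have a1 : i₂ (π₂ (b ⟨(s, 3), i₀, ⟨1, by simp⟩⟩)) = b ⟨(s, 3), i₀, ⟨1, by simp⟩⟩ ∧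
      π₁ (b ⟨(s, 3), i₀, ⟨1, by simp⟩⟩) = 0 := h₂ _ (by simpa using hb1 (s, 3) i₀ ⟨1, by simp⟩)
  have a2 : i₁ (π₁ (b ⟨(s, 3), i₀, ⟨2, by simp⟩⟩)) = b ⟨(s, 3), i₀, ⟨2, by simp⟩⟩ ∧
      π₂ (b ⟨(s, 3), i₀, ⟨2, by simp⟩⟩) = 0 := h₁ _ (by simpa using hb1 (s, 3) i₀ ⟨2, by simp⟩)
  have p0 : ∀ i, i₁ (π₁ (b ⟨(s, 2), i, ⟨0, by simp⟩⟩)) = b ⟨(s, 2), i, ⟨0, by simp⟩⟩ ∧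
      π₂ (b ⟨(s, 2), i, ⟨0, by simp⟩⟩) = 0 := fun i =>
    h₁ _ (by simpa using hb1 (s, 2) i ⟨0, by simp⟩)
  have p1 : ∀ i, i₂ (π₂ (b ⟨(s, 2), i, ⟨1, by simp⟩⟩)) = b ⟨(s, 2), i, ⟨1, by simp⟩⟩ ∧
      π₁ (b ⟨(s, 2), i, ⟨1, by simp⟩⟩) = 0 := fun i =>
    h₂ _ (by simpa using hb1 (s, 2) i ⟨1, by simp⟩)
  have q0 : ∀ i, i₂ (π₂ (b ⟨(-s, 2), i, ⟨0, by simp⟩⟩)) = b ⟨(-s, 2), i, ⟨0, by simp⟩⟩ ∧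
      π₁ (b ⟨(-s, 2), i, ⟨0, by simp⟩⟩) = 0 := fun i =>
    h₂ _ (by simpa using hb1 (-s, 2) i ⟨0, by simp⟩)
  have q1 : ∀ i, i₁ (π₁ (b ⟨(-s, 2), i, ⟨1, by simp⟩⟩)) = b ⟨(-s, 2), i, ⟨1, by simp⟩⟩ ∧
      π₂ (b ⟨(-s, 2), i, ⟨1, by simp⟩⟩) = 0 := fun i =>
    h₁ _ (by simpa using hb1 (-s, 2) i ⟨1, by simp⟩)
  have l0 : ∀ i, i₁ (π₁ (b ⟨(s, 1), i, ⟨0, by simp⟩⟩)) = b ⟨(s, 1), i, ⟨0, by simp⟩⟩ ∧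
      π₂ (b ⟨(s, 1), i, ⟨0, by simp⟩⟩) = 0 := fun i =>
    h₁ _ (by simpa using hb1 (s, 1) i ⟨0, by simp⟩)
  have m0 : ∀ i, i₂ (π₂ (b ⟨(-s, 1), i, ⟨0, by simp⟩⟩)) = b ⟨(-s, 1), i, ⟨0, by simp⟩⟩ ∧
      π₁ (b ⟨(-s, 1), i, ⟨0, by simp⟩⟩) = 0 := fun i =>
    h₂ _ (by simpa using hb1 (-s, 1) i ⟨0, by simp⟩)
  -- every vector of the basis is one of these
  have hcases : ∀ P : (Σ row : ℤˣ × ℕ, Fin (D row) × Fin row.2) → Prop,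
      P ⟨(s, 3), i₀, ⟨0, by simp⟩⟩ → P ⟨(s, 3), i₀, ⟨1, by simp⟩⟩ → P ⟨(s, 3), i₀, ⟨2, by simp⟩⟩ →
      (∀ i, P ⟨(s, 2), i, ⟨0, by simp⟩⟩) → (∀ i, P ⟨(s, 2), i, ⟨1, by simp⟩⟩) →
      (∀ i, P ⟨(-s, 2), i, ⟨0, by simp⟩⟩) → (∀ i, P ⟨(-s, 2), i, ⟨1, by simp⟩⟩) →
      (∀ i, P ⟨(s, 1), i, ⟨0, by simp⟩⟩) → (∀ i, P ⟨(-s, 1), i, ⟨0, by simp⟩⟩) → ∀ x, P x := by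
    rintro P H1 H2 H3 H4 H5 H6 H7 H8 H9 ⟨row, i, ⟨j, hj⟩⟩
    rcases hD row (by have := i.2; lia) (by lia) with rfl | rfl | rfl | rfl | rfl
    · rw [hi₀ i]
      have hj' : j < 3 := hj
      interval_cases j
      exacts [H1, H2, H3]
    · have hj' : j < 2 := hj
      interval_cases j
      exacts [H4 i, H5 i]
    · have hj' : j < 2 := hj
      interval_cases j
      exacts [H6 i, H7 i]
    · have hj' : j < 1 := hj
      interval_cases j
      exact H8 i
    · have hj' : j < 1 := hj
      interval_cases j
      exact H9 i
  have hspan₁ : Submodule.span ℂ (Set.range fun x => π₁ (b x)) = ⊤ := by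
    rw [show (fun x => π₁ (b x)) = π₁ ∘ b from rfl, Set.range_comp, Submodule.span_image, b.span_eq,
      Submodule.map_top, LinearMap.range_eq_top]
    exact Function.RightInverse.surjective hπ₁
  have hspan₂ : Submodule.span ℂ (Set.range fun x => π₂ (b x)) = ⊤ := by
    rw [show (fun x => π₂ (b x)) = π₂ ∘ b from rfl, Set.range_comp, Submodule.span_image, b.span_eq,
      Submodule.map_top, LinearMap.range_eq_top]
    exact Function.RightInverse.surjective hπ₂
  have hle₁ : ∀ S : Submodule ℂ U₁, (∀ x, π₁ (b x) ∈ S) → ∀ u, u ∈ S := by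
    intro S hS u
    have : Submodule.span ℂ (Set.range fun x => π₁ (b x)) ≤ S :=
      Submodule.span_le.2 (by rintro _ ⟨x, rfl⟩; exact hS x)
    rw [hspan₁] at this
    exact this Submodule.mem_top
  have hle₂ : ∀ S : Submodule ℂ U₂, (∀ x, π₂ (b x) ∈ S) → ∀ u, u ∈ S := by
    intro S hS u
    have : Submodule.span ℂ (Set.range fun x => π₂ (b x)) ≤ S :=
      Submodule.span_le.2 (by rintro _ ⟨x, rfl⟩; exact hS x)
    rw [hspan₂] at this
    exact this Submodule.mem_top
  -- the action of `α` and `β`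
  have eα : ∀ x, i₁ (π₁ (b x)) = b x → i₂ (α (π₁ (b x))) = e (b x) := fun x hx => by
    rw [← hα, hx]
  have eβ : ∀ x, i₂ (π₂ (b x)) = b x → i₁ (β (π₂ (b x))) = e (b x) := fun x hx => by
    rw [← hβ, hx]
  have αa0 : i₂ (α (π₁ (b ⟨(s, 3), i₀, ⟨0, by simp⟩⟩))) = b ⟨(s, 3), i₀, ⟨1, by simp⟩⟩ := by
    rw [eα _ a0.1, hb2]; simp
  have βa1 : i₁ (β (π₂ (b ⟨(s, 3), i₀, ⟨1, by simp⟩⟩))) = b ⟨(s, 3), i₀, ⟨2, by simp⟩⟩ := by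
    rw [eβ _ a1.1, hb2]; simp
  have αa2 : α (π₁ (b ⟨(s, 3), i₀, ⟨2, by simp⟩⟩)) = 0 := hinj₂ (by
    rw [eα _ a2.1, hb2]; simp)
  have αp0 : ∀ i, i₂ (α (π₁ (b ⟨(s, 2), i, ⟨0, by simp⟩⟩))) = b ⟨(s, 2), i, ⟨1, by simp⟩⟩ :=
    fun i => by rw [eα _ (p0 i).1, hb2]; simp
  have βp1 : ∀ i, β (π₂ (b ⟨(s, 2), i, ⟨1, by simp⟩⟩)) = 0 := fun i => hinj₁ (by
    rw [eβ _ (p1 i).1, hb2]; simp)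
  have βq0 : ∀ i, i₁ (β (π₂ (b ⟨(-s, 2), i, ⟨0, by simp⟩⟩))) = b ⟨(-s, 2), i, ⟨1, by simp⟩⟩ :=
    fun i => by rw [eβ _ (q0 i).1, hb2]; simp
  have αq1 : ∀ i, α (π₁ (b ⟨(-s, 2), i, ⟨1, by simp⟩⟩)) = 0 := fun i => hinj₂ (by
    rw [eα _ (q1 i).1, hb2]; simp)
  have αl0 : ∀ i, α (π₁ (b ⟨(s, 1), i, ⟨0, by simp⟩⟩)) = 0 := fun i => hinj₂ (by
    rw [eα _ (l0 i).1, hb2]; simp)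
  have βm0 : ∀ i, β (π₂ (b ⟨(-s, 1), i, ⟨0, by simp⟩⟩)) = 0 := fun i => hinj₁ (by
    rw [eβ _ (m0 i).1, hb2]; simp)
  have αa0' : α (π₁ (b ⟨(s, 3), i₀, ⟨0, by simp⟩⟩)) = π₂ (b ⟨(s, 3), i₀, ⟨1, by simp⟩⟩) :=
    hinj₂ (αa0.trans a1.1.symm)
  have βa1' : β (π₂ (b ⟨(s, 3), i₀, ⟨1, by simp⟩⟩)) = π₁ (b ⟨(s, 3), i₀, ⟨2, by simp⟩⟩) :=
    hinj₁ (βa1.trans a2.1.symm)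
  have αp0' : ∀ i, α (π₁ (b ⟨(s, 2), i, ⟨0, by simp⟩⟩)) = π₂ (b ⟨(s, 2), i, ⟨1, by simp⟩⟩) :=
    fun i => hinj₂ ((αp0 i).trans (p1 i).1.symm)
  have βq0' : ∀ i, β (π₂ (b ⟨(-s, 2), i, ⟨0, by simp⟩⟩)) = π₁ (b ⟨(-s, 2), i, ⟨1, by simp⟩⟩) :=
    fun i => hinj₁ ((βq0 i).trans (q1 i).1.symm)
  -- dimensions
  have hdim₁ : Module.finrank ℂ U₁ = 2 + 2 * D (s, 2) + D (s, 1) := by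
    let J : Fin 2 ⊕ Fin (D (s, 2)) ⊕ Fin (D (-s, 2)) ⊕ Fin (D (s, 1)) →
        Σ row : ℤˣ × ℕ, Fin (D row) × Fin row.2 :=
      -- The row of length three meets the first space in positions 0 and 2; each row of length two
      -- meets it once, in position 0 or 1 according to its sign.
      Sum.elim (fun j => ⟨(s, 3), i₀, ⟨2 * j, by have := j.2; simp; lia⟩⟩)
        (Sum.elim (fun i => ⟨(s, 2), i, ⟨0, by simp⟩⟩)
        (Sum.elim (fun i => ⟨(-s, 2), i, ⟨1, by simp⟩⟩) fun i => ⟨(s, 1), i, ⟨0, by simp⟩⟩))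
    have hJ : Function.Injective J := by
      rintro (i | i | i | i) (j | j | j | j) h <;>
        simp [J, hs, hs', Fin.ext_iff] at h ⊢ <;> lia
    have hJ₁ : ∀ i, i₁ (π₁ (b (J i))) = b (J i) := by
      rintro (i | i | i | i)
      · fin_cases i
        exacts [a0.1, a2.1]
      · exact (p0 i).1
      · exact (q1 i).1
      · exact (l0 i).1
    have hli : LinearIndependent ℂ fun i => π₁ (b (J i)) := by
      refine LinearIndependent.of_comp i₁ ?_
      rw [show i₁ ∘ (fun i => π₁ (b (J i))) = b ∘ J from funext hJ₁]
      exact b.linearIndependent.comp J hJ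
    have hsp : ∀ u, u ∈ Submodule.span ℂ (Set.range fun i => π₁ (b (J i))) := by
      refine hle₁ _ (hcases _ ?_ ?_ ?_ ?_ ?_ ?_ ?_ ?_ ?_)
      · exact Submodule.subset_span ⟨.inl 0, rfl⟩
      · rw [a1.2]; exact zero_mem _
      · exact Submodule.subset_span ⟨.inl 1, rfl⟩
      · exact fun i => Submodule.subset_span ⟨.inr (.inl i), rfl⟩
      · intro i; rw [(p1 i).2]; exact zero_mem _
      · intro i; rw [(q0 i).2]; exact zero_mem _
      · exact fun i => Submodule.subset_span ⟨.inr (.inr (.inl i)), rfl⟩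
      · exact fun i => Submodule.subset_span ⟨.inr (.inr (.inr i)), rfl⟩
      · intro i; rw [(m0 i).2]; exact zero_mem _
    rw [Module.finrank_eq_card_basis (Module.Basis.mk hli fun u _ => hsp u)]
    simp [hD2]
    ring
  have hdim₂ : Module.finrank ℂ U₂ = 1 + 2 * D (s, 2) + D (-s, 1) := by
    let J : Fin 1 ⊕ Fin (D (s, 2)) ⊕ Fin (D (-s, 2)) ⊕ Fin (D (-s, 1)) →
        Σ row : ℤˣ × ℕ, Fin (D row) × Fin row.2 :=
      Sum.elim (fun _ => ⟨(s, 3), i₀, ⟨1, by simp⟩⟩)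
        (Sum.elim (fun i => ⟨(s, 2), i, ⟨1, by simp⟩⟩)
        (Sum.elim (fun i => ⟨(-s, 2), i, ⟨0, by simp⟩⟩) fun i => ⟨(-s, 1), i, ⟨0, by simp⟩⟩))
    have hJ : Function.Injective J := by
      rintro (i | i | i | i) (j | j | j | j) h <;>
        simp [J, hs, hs', Fin.ext_iff] at h ⊢ <;> lia
    have hJ₁ : ∀ i, i₂ (π₂ (b (J i))) = b (J i) := by
      rintro (i | i | i | i)
      · exact a1.1
      · exact (p1 i).1
      · exact (q0 i).1
      · exact (m0 i).1
    have hli : LinearIndependent ℂ fun i => π₂ (b (J i)) := by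
      refine LinearIndependent.of_comp i₂ ?_
      rw [show i₂ ∘ (fun i => π₂ (b (J i))) = b ∘ J from funext hJ₁]
      exact b.linearIndependent.comp J hJ
    have hsp : ∀ u, u ∈ Submodule.span ℂ (Set.range fun i => π₂ (b (J i))) := by
      refine hle₂ _ (hcases _ ?_ ?_ ?_ ?_ ?_ ?_ ?_ ?_ ?_)
      · rw [a0.2]; exact zero_mem _
      · exact Submodule.subset_span ⟨.inl 0, rfl⟩
      · rw [a2.2]; exact zero_mem _
      · intro i; rw [(p0 i).2]; exact zero_mem _
      · exact fun i => Submodule.subset_span ⟨.inr (.inl i), rfl⟩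
      · exact fun i => Submodule.subset_span ⟨.inr (.inr (.inl i)), rfl⟩
      · intro i; rw [(q1 i).2]; exact zero_mem _
      · intro i; rw [(l0 i).2]; exact zero_mem _
      · exact fun i => Submodule.subset_span ⟨.inr (.inr (.inr i)), rfl⟩
    rw [Module.finrank_eq_card_basis (Module.Basis.mk hli fun u _ => hsp u)]
    simp [hD2]
    ring
  refine exists_adaptedFrame hQ₁ hQ₂ skew (a₀ := π₁ (b ⟨(s, 3), i₀, ⟨0, by simp⟩⟩))
    (p := fun i => π₁ (b ⟨(s, 2), i, ⟨0, by simp⟩⟩)) ?_ ?_ ?_ ?_ ?_ hdim₁ hdim₂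
  · intro v
    have := hle₂ (LinearMap.ker (α ∘ₗ β)) (hcases _ ?_ ?_ ?_ ?_ ?_ ?_ ?_ ?_ ?_) v
    · exact this
    · rw [a0.2]; exact zero_mem _
    · change α (β _) = 0
      rw [βa1', αa2]
    · rw [a2.2]; exact zero_mem _
    · intro i; rw [(p0 i).2]; exact zero_mem _
    · intro i
      change α (β _) = 0
      rw [βp1, map_zero]
    · intro i
      change α (β _) = 0
      rw [βq0', αq1]
    · intro i; rw [(q1 i).2]; exact zero_mem _
    · intro i; rw [(l0 i).2]; exact zero_mem _
    · intro i
      change α (β _) = 0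
      rw [βm0, map_zero]
  · intro h
    rw [αa0', βa1'] at h
    have h2 := a2.1
    rw [h, map_zero] at h2
    exact b.ne_zero _ h2.symm
  · intro i
    rw [αp0', βp1]
  · intro u
    have := hle₁ ((Submodule.span ℂ {α (π₁ (b ⟨(s, 3), i₀, ⟨0, by simp⟩⟩))} ⊔
      Submodule.span ℂ (Set.range fun i => α (π₁ (b ⟨(s, 2), i, ⟨0, by simp⟩⟩)))).comap α)
      (hcases _ ?_ ?_ ?_ ?_ ?_ ?_ ?_ ?_ ?_) u
    · obtain ⟨y, hy, z, hz, h⟩ := Submodule.mem_sup.1 (Submodule.mem_comap.1 this)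
      obtain ⟨r, rfl⟩ := Submodule.mem_span_singleton.1 hy
      obtain ⟨w, rfl⟩ := (Submodule.mem_span_range_iff_exists_fun ℂ).1 hz
      exact ⟨r, w, h.symm⟩
    · exact Submodule.mem_sup_left (Submodule.mem_span_singleton_self _)
    · rw [a1.2]; exact zero_mem _
    · rw [Submodule.mem_comap, αa2]; exact zero_mem _
    · exact fun i => Submodule.mem_sup_right (Submodule.subset_span ⟨i, rfl⟩)
    · intro i; rw [(p1 i).2]; exact zero_mem _
    · intro i; rw [(q0 i).2]; exact zero_mem _
    · intro i; rw [Submodule.mem_comap, αq1]; exact zero_mem _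
    · intro i; rw [Submodule.mem_comap, αl0]; exact zero_mem _
    · intro i; rw [(m0 i).2]; exact zero_mem _
  · refine LinearIndependent.of_comp i₂ ?_
    rw [show i₂ ∘ (fun i => α (π₁ (b ⟨(s, 2), i, ⟨0, by simp⟩⟩))) =
      b ∘ fun i => ⟨(s, 2), i, ⟨1, by simp⟩⟩ from funext αp0]
    exact b.linearIndependent.comp _ fun i j h => by simpa using h

end SignedDiagrams

/-! ### Transport to the blocks of e -/

theorem nonempty_componentGroup_congr {G H : Type*} [TopologicalSpace G] [Group G]
    [IsTopologicalGroup G] [TopologicalSpace H] [Group H] [IsTopologicalGroup H] (f : G ≃* H)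
    (hf : Continuous f) (hf' : Continuous f.symm) :
    Nonempty (ComponentGroup G ≃* ComponentGroup H) := by
  refine ⟨QuotientGroup.congr _ _ f ?_⟩
  refine le_antisymm ?_ fun h hh => ?_
  · rintro _ ⟨g, hg, rfl⟩
    have := hf.image_connectedComponent_subset 1 ⟨g, hg, rfl⟩
    rwa [map_one] at this
  · have := hf'.image_connectedComponent_subset 1 ⟨h, hh, rfl⟩
    rw [map_one] at this
    exact ⟨f.symm h, this, f.apply_symm_apply h⟩

section Transport

variable {Vp Vm : Type*} [AddCommGroup Vp] [Module ℂ Vp]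
  [AddCommGroup Vm] [Module ℂ Vm]

theorem mem_signedPart_one {v : Vp × Vm} : v ∈ signedPart Vp Vm 1 ↔ v.2 = 0 := by
  simp [signedPart, Submodule.mem_prod]

theorem mem_signedPart_neg_one {v : Vp × Vm} : v ∈ signedPart Vp Vm (-1) ↔ v.1 = 0 := by
  simp [signedPart, Submodule.mem_prod, show (-1 : ℤˣ) ≠ 1 by decide]

/-- The block `V⁺ → V⁻` of an endomorphism. -/
def blockMP (e : Module.End ℂ (Vp × Vm)) : Vp →ₗ[ℂ] Vm :=
  LinearMap.snd ℂ Vp Vm ∘ₗ e ∘ₗ LinearMap.inl ℂ Vp Vm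

/-- The block `V⁻ → V⁺` of an endomorphism. -/
def blockPM (e : Module.End ℂ (Vp × Vm)) : Vm →ₗ[ℂ] Vp :=
  LinearMap.fst ℂ Vp Vm ∘ₗ e ∘ₗ LinearMap.inr ℂ Vp Vm

variable {Qp : QuadraticForm ℂ Vp} {Qm : QuadraticForm ℂ Vm} {e : Module.End ℂ (Vp × Vm)}

theorem IsInS.apply_inl (he : IsInS Qp Qm e) (u : Vp) : e (u, 0) = (0, blockMP e u) :=
  Prod.ext (mem_signedPart_neg_one.1 (he.swap 1 _ (mem_signedPart_one.2 rfl))) rfl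

theorem IsInS.apply_inr (he : IsInS Qp Qm e) (v : Vm) : e (0, v) = (blockPM e v, 0) :=
  Prod.ext rfl (mem_signedPart_one.1 (by
    have := he.swap (-1) (0, v) (mem_signedPart_neg_one.2 rfl)
    rwa [neg_neg] at this))

theorem IsInS.skew_block (he : IsInS Qp Qm e) (u : Vp) (v : Vm) :
    QuadraticMap.polar Qm (blockMP e u) v = -QuadraticMap.polar Qp u (blockPM e v) := by
  have h := he.skew (u, 0) (0, v)
  simp only [Pi.neg_apply] at h
  rw [he.apply_inl, he.apply_inr, QuadraticMap.polarBilin_apply_apply,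
    QuadraticMap.polarBilin_apply_apply] at h
  simpa [QuadraticMap.polar_prod, QuadraticMap.polar_neg_right, QuadraticMap.polar_zero_left,
    QuadraticMap.polar_zero_right] using h

theorem IsInS.mem_centralizer_iff (he : IsInS Qp Qm e) (g : Ktilde Qp Qm) :
    g ∈ centralizer Qp Qm e ↔ g ∈ pairCentralizer Qp Qm (blockMP e) (blockPM e) := by
  constructor
  · intro h
    have h' : ktildeRep Qp Qm g * e = e * ktildeRep Qp Qm g := h
    refine ⟨fun u => ?_, fun v => ?_⟩
    · have h1 := LinearMap.congr_fun h' (u, 0)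
      simp only [ktildeRep, MonoidHom.coe_mk, OneHom.coe_mk, Module.End.mul_apply,
        LinearMap.prodMap_apply, map_zero, he.apply_inl] at h1
      exact congrArg Prod.snd h1
    · have h1 := LinearMap.congr_fun h' (0, v)
      simp only [ktildeRep, MonoidHom.coe_mk, OneHom.coe_mk, Module.End.mul_apply,
        LinearMap.prodMap_apply, map_zero, he.apply_inr] at h1
      exact congrArg Prod.fst h1
  · rintro ⟨h1, h2⟩
    change ktildeRep Qp Qm g * e = e * ktildeRep Qp Qm g
    apply LinearMap.prod_ext
    · ext u : 1
      simp only [ktildeRep, MonoidHom.coe_mk, OneHom.coe_mk, Module.End.mul_apply,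
        LinearMap.prodMap_apply, map_zero, he.apply_inl, LinearMap.comp_apply,
        LinearMap.inl_apply, h1]
    · ext u : 1
      simp only [ktildeRep, MonoidHom.coe_mk, OneHom.coe_mk, Module.End.mul_apply,
        LinearMap.prodMap_apply, map_zero, he.apply_inr, LinearMap.comp_apply,
        LinearMap.inr_apply, h2]

variable [FiniteDimensional ℂ Vp] [FiniteDimensional ℂ Vm]

theorem IsInS.nonempty_equiv_plus (he : IsInS Qp Qm e) : Nonempty (A Qp Qm e ≃*
    ComponentGroup (pairCentralizer Qp Qm (blockMP e) (blockPM e))) := by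
  have h : centralizer Qp Qm e = pairCentralizer Qp Qm (blockMP e) (blockPM e) :=
    Subgroup.ext he.mem_centralizer_iff
  refine nonempty_componentGroup_congr (MulEquiv.subgroupCongr h) ?_ ?_
  · exact Continuous.subtype_mk continuous_subtype_val _
  · exact Continuous.subtype_mk continuous_subtype_val _

/-- For a row of length three starting with the sign -, the first space of the adapted frame is
`V⁻`, so the two factors of `K̃` are exchanged. -/
theorem IsInS.nonempty_equiv_minus (he : IsInS Qp Qm e) : Nonempty (A Qp Qm e ≃*
    ComponentGroup (pairCentralizer Qm Qp (blockPM e) (blockMP e))) := by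
  have h : ∀ g : Ktilde Qp Qm, g ∈ centralizer Qp Qm e ↔
      g.swap ∈ pairCentralizer Qm Qp (blockPM e) (blockMP e) := fun g =>
    (he.mem_centralizer_iff g).trans and_comm
  let f : centralizer Qp Qm e ≃* pairCentralizer Qm Qp (blockPM e) (blockMP e) :=
    { toFun := fun g => ⟨g.1.swap, (h _).1 g.2⟩
      invFun := fun g => ⟨g.1.swap, (h _).2 g.2⟩
      left_inv := fun _ => rfl
      right_inv := fun _ => rfl
      map_mul' := fun _ _ => rfl }
  refine nonempty_componentGroup_congr f ?_ ?_
  · exact Continuous.subtype_mk (continuous_swap.comp continuous_subtype_val) _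
  · exact Continuous.subtype_mk (continuous_swap.comp continuous_subtype_val) _

theorem diagram_eq (s : ℤˣ) (k c d : ℕ) (row : ℤˣ × ℕ) (h : diagram s k c d row ≠ 0) :
    row = (s, 3) ∨ row = (s, 2) ∨ row = (-s, 2) ∨ row = (s, 1) ∨ row = (-s, 1) := by
  obtain ⟨t, n⟩ := row
  have hu : ∀ a b : ℤˣ, a = b ∨ a = -b := by decide
  have hn : n = 3 ∧ t = s ∨ n = 2 ∨ n = 1 := by
    unfold diagram at h
    split_ifs at h with h1 h2 h3 h4
    · exact Or.inl ⟨congrArg Prod.snd h1, congrArg Prod.fst h1⟩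
    · exact Or.inr (Or.inl h2)
    · exact Or.inr (Or.inr (congrArg Prod.snd h3))
    · exact Or.inr (Or.inr (congrArg Prod.snd h4))
    · exact absurd rfl h
  rcases hn with ⟨rfl, rfl⟩ | rfl | rfl
  · exact Or.inl rfl
  · rcases hu t s with rfl | rfl
    · exact Or.inr (Or.inl rfl)
    · exact Or.inr (Or.inr (Or.inl rfl))
  · rcases hu t s with rfl | rfl
    · exact Or.inr (Or.inr (Or.inr (Or.inl rfl)))
    · exact Or.inr (Or.inr (Or.inr (Or.inr rfl)))

theorem diagram_three (s : ℤˣ) (k c d : ℕ) : diagram s k c d (s, 3) = 1 := if_pos rfl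

theorem diagram_two (s t : ℤˣ) (k c d : ℕ) : diagram s k c d (t, 2) = k :=
  (if_neg fun h => absurd (Prod.mk.inj h).2 (by decide)).trans (if_pos rfl)

theorem IsInS.adaptedFrame_plus (he : IsInS Qp Qm e)
    (hQp : (QuadraticMap.polarBilin Qp).Nondegenerate)
    (hQm : (QuadraticMap.polarBilin Qm).Nondegenerate) {k c d : ℕ}
    (hd : HasSignedDiagram e (diagram 1 k c d)) :
    Nonempty (AdaptedFrame Qp Qm (blockMP e) (blockPM e) k c d) := by
  have h := exists_adaptedFrame_of_basis hQp hQm he.skew_block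
    (i₁ := LinearMap.inl ℂ Vp Vm) (i₂ := LinearMap.inr ℂ Vp Vm) (π₁ := LinearMap.fst ℂ Vp Vm)
    (π₂ := LinearMap.snd ℂ Vp Vm) (s := 1) (fun _ => rfl) (fun _ => rfl)
    (fun v hv => ⟨Prod.ext rfl (mem_signedPart_one.1 hv).symm, mem_signedPart_one.1 hv⟩)
    (fun v hv => ⟨Prod.ext (mem_signedPart_neg_one.1 hv).symm rfl, mem_signedPart_neg_one.1 hv⟩)
    he.apply_inl he.apply_inr (diagram_three ..) (by rw [diagram_two, diagram_two])
    (fun row h _ => diagram_eq 1 k c d row h) hd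
  have h1 := diagram_two 1 1 k c d
  have h2 : diagram 1 k c d (1, 1) = c := by simp [diagram]
  have h3 : diagram 1 k c d (-1, 1) = d := by simp [diagram, show (-1 : ℤˣ) ≠ 1 by decide]
  rwa [h1, h2, h3] at h

/-- Since the spaces are exchanged, the numbers of rows of length one appear in the order `d`, `c`.
-/
theorem IsInS.adaptedFrame_minus (he : IsInS Qp Qm e)
    (hQp : (QuadraticMap.polarBilin Qp).Nondegenerate)
    (hQm : (QuadraticMap.polarBilin Qm).Nondegenerate) {k c d : ℕ}
    (hd : HasSignedDiagram e (diagram (-1) k c d)) :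
    Nonempty (AdaptedFrame Qm Qp (blockPM e) (blockMP e) k d c) := by
  have h := exists_adaptedFrame_of_basis hQm hQp (fun v u => by
      rw [QuadraticMap.polar_comm, QuadraticMap.polar_comm Qm, he.skew_block, neg_neg])
    (i₁ := LinearMap.inr ℂ Vp Vm) (i₂ := LinearMap.inl ℂ Vp Vm) (π₁ := LinearMap.snd ℂ Vp Vm)
    (π₂ := LinearMap.fst ℂ Vp Vm) (s := -1) (fun _ => rfl) (fun _ => rfl)
    (fun v hv => ⟨Prod.ext (mem_signedPart_neg_one.1 hv).symm rfl, mem_signedPart_neg_one.1 hv⟩)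
    (fun v hv => by
      rw [neg_neg] at hv
      exact ⟨Prod.ext rfl (mem_signedPart_one.1 hv).symm, mem_signedPart_one.1 hv⟩)
    he.apply_inr he.apply_inl (diagram_three ..) (by rw [diagram_two, diagram_two])
    (fun row h _ => diagram_eq (-1) k c d row h) hd
  have h1 := diagram_two (-1) (-1) k c d
  have h2 : diagram (-1) k c d (-1, 1) = d := by
    simp [diagram, show (-1 : ℤˣ) ≠ 1 by decide]
  have h3 : diagram (-1) k c d (- -1, 1) = c := by
    simp [diagram]
  rwa [h1, h2, h3] at h

end Transport

end SpinOrbit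

end

/-! ### The seven families -/

theorem proposition2p2
    {Vp Vm : Type*} [AddCommGroup Vp] [Module ℂ Vp] [FiniteDimensional ℂ Vp]
    [AddCommGroup Vm] [Module ℂ Vm] [FiniteDimensional ℂ Vm]
    (Qp : QuadraticForm ℂ Vp) (hQp : (QuadraticMap.polarBilin Qp).Nondegenerate)
    (Qm : QuadraticForm ℂ Vm) (hQm : (QuadraticMap.polarBilin Qm).Nondegenerate)
    (e : Module.End ℂ (Vp × Vm)) (he : SpinOrbit.IsInS Qp Qm e)
    (k : ℕ) (hk : 0 < k) :
    -- `[3⁺ 2^{2k} 1⁻]` and `[3⁻ 2^{2k} 1⁺]`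
    ((SpinOrbit.HasSignedDiagram e (SpinOrbit.diagram 1 k 0 1) ∨
        SpinOrbit.HasSignedDiagram e (SpinOrbit.diagram (-1) k 1 0)) →
      Nonempty (SpinOrbit.A Qp Qm e ≃* SpinOrbit.Z2 × SpinOrbit.Z2)) ∧
    -- `[3⁻ 2^{2k} 1^{+,2r+1}]` and `[3⁺ 2^{2k} 1^{-,2r+1}]`, `r > 0`
    (∀ r : ℕ, 0 < r →
      (SpinOrbit.HasSignedDiagram e (SpinOrbit.diagram (-1) k (2 * r + 1) 0) ∨
        SpinOrbit.HasSignedDiagram e (SpinOrbit.diagram 1 k 0 (2 * r + 1))) →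
      Nonempty (SpinOrbit.A Qp Qm e ≃* SpinOrbit.Z2)) ∧
    -- `[3⁺ 2^{2k} 1⁻ 1^{+,2r}]` and `[3⁻ 2^{2k} 1⁺ 1^{-,2r}]`, `r > 0`
    (∀ r : ℕ, 0 < r →
      (SpinOrbit.HasSignedDiagram e (SpinOrbit.diagram 1 k (2 * r) 1) ∨
        SpinOrbit.HasSignedDiagram e (SpinOrbit.diagram (-1) k 1 (2 * r))) →
      Nonempty (SpinOrbit.A Qp Qm e ≃* SpinOrbit.Z2)) ∧
    -- `[3⁺ 2^{2k} 1⁺ 1^{-,2}]` and `[3⁻ 2^{2k} 1⁻ 1^{+,2}]`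
    ((SpinOrbit.HasSignedDiagram e (SpinOrbit.diagram 1 k 1 2) ∨
        SpinOrbit.HasSignedDiagram e (SpinOrbit.diagram (-1) k 2 1)) →
      Nonempty (SpinOrbit.A Qp Qm e ≃* SpinOrbit.Z2)) ∧
    -- `[3⁺ 2^{2k} 1⁺]` and `[3⁻ 2^{2k} 1⁻]`
    ((SpinOrbit.HasSignedDiagram e (SpinOrbit.diagram 1 k 1 0) ∨
        SpinOrbit.HasSignedDiagram e (SpinOrbit.diagram (-1) k 0 1)) →
      Nonempty (SpinOrbit.A Qp Qm e ≃* SpinOrbit.Z2)) ∧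
    -- `[3⁺ 2^{2k} 1^{+,2r+1}]` and `[3⁻ 2^{2k} 1^{-,2r+1}]`, `r > 0`: the trivial group
    (∀ r : ℕ, 0 < r →
      (SpinOrbit.HasSignedDiagram e (SpinOrbit.diagram 1 k (2 * r + 1) 0) ∨
        SpinOrbit.HasSignedDiagram e (SpinOrbit.diagram (-1) k 0 (2 * r + 1))) →
      Subsingleton (SpinOrbit.A Qp Qm e)) ∧
    -- `[3⁻ 2^{2k} 1⁻ 1^{+,2r}]` and `[3⁺ 2^{2k} 1⁺ 1^{-,2r}]`, `r ≥ 2`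
    (∀ r : ℕ, 2 ≤ r →
      (SpinOrbit.HasSignedDiagram e (SpinOrbit.diagram (-1) k (2 * r) 1) ∨
        SpinOrbit.HasSignedDiagram e (SpinOrbit.diagram 1 k 1 (2 * r))) →
      Nonempty (SpinOrbit.A Qp Qm e ≃* SpinOrbit.Z2)) := by
  have plus : ∀ c d, SpinOrbit.HasSignedDiagram e (SpinOrbit.diagram 1 k c d) →
      Nonempty (SpinOrbit.AdaptedFrame Qp Qm (SpinOrbit.blockMP e) (SpinOrbit.blockPM e) k c d) :=
    fun _ _ h => he.adaptedFrame_plus hQp hQm h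
  have minus : ∀ c d, SpinOrbit.HasSignedDiagram e (SpinOrbit.diagram (-1) k c d) →
      Nonempty (SpinOrbit.AdaptedFrame Qm Qp (SpinOrbit.blockPM e) (SpinOrbit.blockMP e) k d c) :=
    fun _ _ h => he.adaptedFrame_minus hQp hQm h
  obtain ⟨i⟩ := he.nonempty_equiv_plus
  obtain ⟨j⟩ := he.nonempty_equiv_minus
  -- With c and d counted from the space where the row of length three starts, the families are (0,
  -- 1), (0, 2r + 1), (2r, 1), (1, 2), (1, 0), (2r + 1, 0) and (1, 2r). The second, third, fourth
  -- and seventh all have d > 0 and c ≥ 2 or d ≥ 2.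
  refine ⟨?_, ?_, ?_, ?_, ?_, ?_, ?_⟩
  · rintro (h | h)
    · obtain ⟨B⟩ := plus _ _ h
      exact (B.componentGroup_zero_one hk hQp hQm).map i.trans
    · obtain ⟨B⟩ := minus _ _ h
      exact (B.componentGroup_zero_one hk hQm hQp).map j.trans
  · rintro r hr (h | h)
    · obtain ⟨B⟩ := minus _ _ h
      exact (B.componentGroup_of_two_le hk hQm hQp (by lia) (by lia)).map j.trans
    · obtain ⟨B⟩ := plus _ _ h
      exact (B.componentGroup_of_two_le hk hQp hQm (by lia) (by lia)).map i.trans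
  · rintro r hr (h | h)
    · obtain ⟨B⟩ := plus _ _ h
      exact (B.componentGroup_of_two_le hk hQp hQm (by lia) (by lia)).map i.trans
    · obtain ⟨B⟩ := minus _ _ h
      exact (B.componentGroup_of_two_le hk hQm hQp (by lia) (by lia)).map j.trans
  · rintro (h | h)
    · obtain ⟨B⟩ := plus _ _ h
      exact (B.componentGroup_of_two_le hk hQp hQm (by lia) (by lia)).map i.trans
    · obtain ⟨B⟩ := minus _ _ h
      exact (B.componentGroup_of_two_le hk hQm hQp (by lia) (by lia)).map j.trans
  · rintro (h | h)
    · obtain ⟨B⟩ := plus _ _ h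
      exact (B.componentGroup_one_zero hk hQp hQm).map i.trans
    · obtain ⟨B⟩ := minus _ _ h
      exact (B.componentGroup_one_zero hk hQm hQp).map j.trans
  · rintro r hr (h | h)
    · obtain ⟨B⟩ := plus _ _ h
      have := B.subsingleton_componentGroup hk hQp hQm (by lia)
      exact i.toEquiv.subsingleton
    · obtain ⟨B⟩ := minus _ _ h
      have := B.subsingleton_componentGroup hk hQm hQp (by lia)
      exact j.toEquiv.subsingleton
  · rintro r hr (h | h)
    · obtain ⟨B⟩ := minus _ _ h
      exact (B.componentGroup_of_two_le hk hQm hQp (by lia) (by lia)).map j.trans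
    · obtain ⟨B⟩ := plus _ _ h
      exact (B.componentGroup_of_two_le hk hQp hQm (by lia) (by lia)).map i.trans
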